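/- Consider the segment-restricted maximum cover under rotation (MCR) problem: given a nondegenerate line segment $\ell=\overline{ab}$, a simple polygon $P$ with $m\ge 3$ vertices (regarded as the closed region that it bounds, and given by its vertices in boundary order), and a set $S$ of $n\ge 1$ points in the plane, find a point $r\in\ell$ and an angle $\theta\in[0,2\pi)$ such that, after rotating $P$ clockwise around $r$ by $\theta$, the number of points of $S$ contained in $P$ is maximum over all $r\in\ell$ and $\theta\in[0,2\pi)$. This problem can be solved in $O(n^2m^2\log(nm))$ time and $O(n^2m^2)$ space: on a real RAM there are a single program and a constant $C$ such that on every such input the program halts with an optimal pair $(r,\theta)$ after at most $C\,n^2m^2\log(nm)$ steps, using at most $C\,n^2m^2$ memory cells. Here the real RAM has exact real cells and integer cells (the integers stored being at most $C\,n^2m^2$, and being the only addresses), rational constants, and unit-cost arithmetic operations, comparisons, indirect memory accesses, square roots, arccosines, and computation of the $k$-th smallest real root of a polynomial of fixed degree, for fixed $k$. -/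

import Mathlib

/-! ### A real RAM

The memory consists of two arrays: integer cells, whose contents may be used as addresses, and
real cells, each of which stores one real number. -/

namespace RealRAM

/-- The contents of the memory. -/
structure State where
  word : ℕ → ℕ
  real : ℕ → ℝ

/-- The memory content fits in space `w`: no cell with address `w` or more is in use, and every
integer stored is at most `w` (so that an integer cell holds `O(log w)` bits). -/
def State.Fits (s : State) (w : ℕ) : Prop :=
  (∀ j, w ≤ j → s.word j = 0 ∧ s.real j = 0) ∧ ∀ j, s.word j ≤ w

def State.setWord (s : State) (j v : ℕ) : State :=
  { s with word := Function.update s.word j v }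

noncomputable def State.setReal (s : State) (j : ℕ) (v : ℝ) : State :=
  { s with real := Function.update s.real j v }

/-- Integer expressions; `cell e` reads the integer cell whose address is the value of `e`. -/
inductive WExpr where
  | lit (k : ℕ)
  | cell (e : WExpr)
  | add (e f : WExpr)
  | sub (e f : WExpr)
  | mul (e f : WExpr)
  | div (e f : WExpr)

def WExpr.eval (s : State) : WExpr → ℕ
  | lit k => k
  | cell e => s.word (e.eval s)
  | add e f => e.eval s + f.eval s
  | sub e f => e.eval s - f.eval s
  | mul e f => e.eval s * f.eval s
  | div e f => e.eval s / f.eval s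

/-- Every operation and every memory access costs one unit. -/
def WExpr.cost : WExpr → ℕ
  | lit _ => 1
  | cell e => e.cost + 1
  | add e f => e.cost + f.cost + 1
  | sub e f => e.cost + f.cost + 1
  | mul e f => e.cost + f.cost + 1
  | div e f => e.cost + f.cost + 1

/-- The `k`-th smallest (counting from `0`) of the distinct real roots of the polynomial
`∑ i, c i * X ^ i`; it is `0` if there is no such root, or if the polynomial is zero. -/
noncomputable def kthRealRoot (d : ℕ) (c : Fin (d + 1) → ℝ) (k : ℕ) : ℝ :=
  ((∑ i, Polynomial.C (c i) * Polynomial.X ^ (i : ℕ)).roots.toFinset.sort (· ≤ ·)).getD k 0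

/-- Real expressions. Constants are rational. The degree `d` in `root` is part of the program
text, hence fixed. There is no conversion from reals to integers, and no rounding. -/
inductive RExpr where
  | lit (q : ℚ)
  | cell (e : WExpr)
  | add (e f : RExpr)
  | sub (e f : RExpr)
  | mul (e f : RExpr)
  | div (e f : RExpr)
  | sqrt (e : RExpr)
  | arccos (e : RExpr)
  | root (d : ℕ) (c : Fin (d + 1) → RExpr) (k : ℕ)

noncomputable def RExpr.eval (s : State) : RExpr → ℝ
  | lit q => (q : ℝ)
  | cell e => s.real (e.eval s)
  | add e f => e.eval s + f.eval s
  | sub e f => e.eval s - f.eval s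
  | mul e f => e.eval s * f.eval s
  | div e f => e.eval s / f.eval s
  | sqrt e => Real.sqrt (e.eval s)
  | arccos e => Real.arccos (e.eval s)
  | root d c k => kthRealRoot d (fun i => (c i).eval s) k

def RExpr.cost : RExpr → ℕ
  | lit _ => 1
  | cell e => e.cost + 1
  | add e f => e.cost + f.cost + 1
  | sub e f => e.cost + f.cost + 1
  | mul e f => e.cost + f.cost + 1
  | div e f => e.cost + f.cost + 1
  | sqrt e => e.cost + 1
  | arccos e => e.cost + 1
  | root _ c _ => (∑ i, (c i).cost) + 1

/-- Conditions. -/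
inductive Test where
  | wlt (e f : WExpr)
  | rlt (e f : RExpr)
  | not (a : Test)
  | and (a b : Test)

def Test.eval (s : State) : Test → Prop
  | wlt e f => e.eval s < f.eval s
  | rlt e f => e.eval s < f.eval s
  | not a => ¬ a.eval s
  | and a b => a.eval s ∧ b.eval s

def Test.cost : Test → ℕ
  | wlt e f => e.cost + f.cost + 1
  | rlt e f => e.cost + f.cost + 1
  | not a => a.cost + 1
  | and a b => a.cost + b.cost + 1

/-- Programs. `wset e f` stores the value of `f` in the integer cell with address `e`, and
`rset e f` stores the value of `f` in the real cell with address `e`. -/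
inductive Program where
  | skip
  | wset (addr : WExpr) (val : WExpr)
  | rset (addr : WExpr) (val : RExpr)
  | seq (c d : Program)
  | ite (b : Test) (c d : Program)
  | loop (b : Test) (c : Program)

/-- `Runs w c s t s'`: started with memory `s`, the program `c` halts with memory `s'` after
exactly `t` time units, and at every moment of the run the memory content fits in space `w`. -/
inductive Runs (w : ℕ) : Program → State → ℕ → State → Prop
  | skip {s : State} (h : s.Fits w) : Runs w .skip s 1 s
  | wset {s : State} {e f : WExpr} (h : s.Fits w)
      (h' : (s.setWord (e.eval s) (f.eval s)).Fits w) :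
      Runs w (.wset e f) s (e.cost + f.cost + 1) (s.setWord (e.eval s) (f.eval s))
  | rset {s : State} {e : WExpr} {f : RExpr} (h : s.Fits w)
      (h' : (s.setReal (e.eval s) (f.eval s)).Fits w) :
      Runs w (.rset e f) s (e.cost + f.cost + 1) (s.setReal (e.eval s) (f.eval s))
  | seq {c d : Program} {s₁ s₂ s₃ : State} {t u : ℕ}
      (h : Runs w c s₁ t s₂) (h' : Runs w d s₂ u s₃) : Runs w (.seq c d) s₁ (t + u) s₃
  | iteTrue {b : Test} {c d : Program} {s s' : State} {t : ℕ}
      (hb : b.eval s) (h : Runs w c s t s') : Runs w (.ite b c d) s (b.cost + t) s'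
  | iteFalse {b : Test} {c d : Program} {s s' : State} {t : ℕ}
      (hb : ¬ b.eval s) (h : Runs w d s t s') : Runs w (.ite b c d) s (b.cost + t) s'
  | loopTrue {b : Test} {c : Program} {s₁ s₂ s₃ : State} {t u : ℕ}
      (hb : b.eval s₁) (h : Runs w c s₁ t s₂) (h' : Runs w (.loop b c) s₂ u s₃) :
      Runs w (.loop b c) s₁ (b.cost + t + u) s₃
  | loopFalse {b : Test} {c : Program} {s : State}
      (hb : ¬ b.eval s) (h : s.Fits w) : Runs w (.loop b c) s b.cost s

end RealRAM

/-! ### Segment-restricted maximum cover under rotation -/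

namespace MCR

/-- A simple polygon, given by its vertices in cyclic order: consecutive edges meet only in their
common vertex, and nonconsecutive edges are disjoint. -/
def IsSimple {m : ℕ} (P : Polygon (ℝ × ℝ) m) : Prop :=
  3 ≤ m ∧ P.HasNondegenerateEdges ∧
  (∀ i, P.edgeSet ℝ i ∩ P.edgeSet ℝ (finRotate m i) = {P (finRotate m i)}) ∧
  ∀ i j, i ≠ j → j ≠ finRotate m i → i ≠ finRotate m j →
    Disjoint (P.edgeSet ℝ i) (P.edgeSet ℝ j)

/-- The closed region enclosed by a polygon: its boundary, together with the bounded components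
of the complement of the boundary. -/
def region {m : ℕ} (P : Polygon (ℝ × ℝ) m) : Set (ℝ × ℝ) :=
  P.boundary ℝ ∪
    {z | z ∉ P.boundary ℝ ∧ Bornology.IsBounded (connectedComponentIn (P.boundary ℝ)ᶜ z)}

/-- Clockwise rotation around `r` by the angle `θ`. -/
noncomputable def rotateCW (r : ℝ × ℝ) (θ : ℝ) (z : ℝ × ℝ) : ℝ × ℝ :=
  (r.1 + (Real.cos θ * (z.1 - r.1) + Real.sin θ * (z.2 - r.2)),
   r.2 + (- Real.sin θ * (z.1 - r.1) + Real.cos θ * (z.2 - r.2)))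

/-- An instance with `n` points, a polygon with `m` vertices, and the segment from `a` to `b`. -/
structure Instance (n m : ℕ) where
  a : ℝ × ℝ
  b : ℝ × ℝ
  points : Fin n → ℝ × ℝ
  polygon : Polygon (ℝ × ℝ) m

namespace Instance

variable {n m : ℕ}

/-- The segment is nondegenerate, the points form a nonempty set of `n` points, and the polygon
is simple. -/
def Valid (I : Instance n m) : Prop :=
  I.a ≠ I.b ∧ 1 ≤ n ∧ Function.Injective I.points ∧ IsSimple I.polygon

/-- The number of points contained in the polygon rotated clockwise around `r` by `θ`. -/
noncomputable def covered (I : Instance n m) (r : ℝ × ℝ) (θ : ℝ) : ℕ :=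
  (Set.range I.points ∩ rotateCW r θ '' region I.polygon).ncard

/-- The pair `(r, θ)` is a solution of the instance. -/
def IsSolution (I : Instance n m) (r : ℝ × ℝ) (θ : ℝ) : Prop :=
  r ∈ segment ℝ I.a I.b ∧ θ ∈ Set.Ico 0 (2 * Real.pi) ∧
  ∀ r' ∈ segment ℝ I.a I.b, ∀ θ' ∈ Set.Ico 0 (2 * Real.pi), I.covered r' θ' ≤ I.covered r θ

/-- The input: the integer cells `0` and `1` hold `n` and `m`, and the real cells hold, one after
the other from cell `0` on, the coordinates of `a`, of `b`, of the points, and of the vertices of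
the polygon. All other cells are `0`. -/
noncomputable def input (I : Instance n m) : RealRAM.State where
  word j := [n, m].getD j 0
  real j := (([I.a, I.b] ++ List.ofFn I.points ++ List.ofFn I.polygon.vertices).flatMap
    fun p => [p.1, p.2]).getD j 0

/-- The output: the real cells `0` and `1` hold the coordinates of the rotation center, and the
real cell `2` holds the angle. -/
def Answer (I : Instance n m) (s : RealRAM.State) : Prop :=
  I.IsSolution (s.real 0, s.real 1) (s.real 2)

end Instance

end MCR

/-! Rotating the polygon clockwise about `r` covers a point `p` exactly when turning `p`
counterclockwise about `r` brings it into the fixed polygon. Membership in the fixed polygon is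
decided by signs: a Jordan theorem for polygons (`IsSimple.mem_region_iff`) says that a point
belongs to the closed region iff it lies on an edge or its upward vertical ray crosses an odd number
of edges. The parity is locally constant off the boundary and vanishes far away, so odd points lie
in bounded components. Conversely, near each boundary point the even set is connected and touches
all of the nearby boundary, and the boundary is connected; hence the even set is connected and
unbounded (`evenSet_subset_component`). Crossing and incidence of one edge depend only on the signs
of five affine functionals.

Write `r = a + t (b - a)` and describe the angle by the tangent `u` of its half together with a sign
`σ = ±1`. The value of a functional at the turned point, times `1 + u²`, is `A(u) t + B(u)` with
quadratics `A` and `B` (`lin_turn`). For fixed `u`, lower `t` until some functional vanishes or `t =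
0`: no covered point is lost, because the region is closed. So some optimum lies on the curve `t =
0` or on one of the `5nm` curves `t = -B/A`, for one of the two signs (`exists_curve`). On a single
curve the sign of every functional is governed by a polynomial in `u` of degree at most 4. This
yields 32 critical parameters per pair of a point and an edge, between which the coverage is
constant. It suffices to inspect the critical parameters, a midpoint after each of them, and a
parameter before all of them (`Instance.exists_sample_covAt`).

The program treats the `O(nm)` curves one by one, reusing the same memory. For each it computes the
samples, merge sorts them and sweeps through them. Every sample belongs to one pair, and only the
contributions of that pair are recomputed, in constant time; after the last of a group of equal
parameters the counter equals the true coverage (`Prepared.count_eq`). One curve costs `O(nm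
log(nm))`, and the memory used is only `O(nm)`. Programs are verified by Hoare rules that carry time
and space bounds (`Ok`). -/

namespace MCR
-- Sign conditions and crossing parity of a single edge
open Filter Topology Set

/-- The cross product of two vectors in the plane. -/
def cr (a b : ℝ × ℝ) : ℝ := a.1 * b.2 - a.2 * b.1

/-- The upward vertical ray from `q` crosses the edge from `v` to `w`, where the edge is
considered half-open in the horizontal direction. -/
def RayCross (v w q : ℝ × ℝ) : Prop :=
  (0 ≤ q.1 - v.1 ∧ q.1 - w.1 < 0 ∧ cr (w - v) (q - v) < 0) ∨
    (0 ≤ q.1 - w.1 ∧ q.1 - v.1 < 0 ∧ 0 < cr (w - v) (q - v))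

/-- A description of the edge from `v` to `w` by sign conditions. -/
def OnEdge (v w q : ℝ × ℝ) : Prop :=
  cr (w - v) (q - v) = 0 ∧ (q.1 - v.1) * (q.1 - w.1) ≤ 0 ∧ (q.2 - v.2) * (q.2 - w.2) ≤ 0

/-- Collinearity and the bounding box together characterize a segment. Both coordinates of the box
are needed, since a vertical or horizontal edge is invisible to one of them; a degenerate edge is
covered as well. -/
theorem onEdge_iff {v w q : ℝ × ℝ} : OnEdge v w q ↔ q ∈ segment ℝ v w := by
  constructor
  · rintro ⟨h0, h1, h2⟩
    rw [segment_eq_image_lineMap]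
    simp only [cr, Prod.fst_sub, Prod.snd_sub] at h0
    by_cases hx : v.1 = w.1
    · by_cases hy : v.2 = w.2
      · rw [← hx] at h1
        rw [← hy] at h2
        have e1 : q.1 - v.1 = 0 := by nlinarith
        have e2 : q.2 - v.2 = 0 := by nlinarith
        refine ⟨0, by simp, ?_⟩
        ext <;> simp <;> linarith
      · have hd : w.2 - v.2 ≠ 0 := sub_ne_zero.2 (Ne.symm hy)
        rw [← hx] at h1
        have e1 : q.1 - v.1 = 0 := by nlinarith
        have hp : 0 < (w.2 - v.2) ^ 2 := by positivity
        refine ⟨(q.2 - v.2) / (w.2 - v.2), ⟨?_, ?_⟩, ?_⟩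
        -- A squared denominator avoids a case distinction on the direction of the edge.
        · rw [show (q.2 - v.2) / (w.2 - v.2) = (q.2 - v.2) * (w.2 - v.2) / (w.2 - v.2) ^ 2 by
            field_simp]
          apply div_nonneg _ hp.le
          nlinarith [sq_nonneg (q.2 - v.2)]
        · rw [show (q.2 - v.2) / (w.2 - v.2) = (q.2 - v.2) * (w.2 - v.2) / (w.2 - v.2) ^ 2 by
            field_simp]
          rw [div_le_one hp]
          nlinarith [sq_nonneg (q.2 - w.2)]
        · ext
          · simp [AffineMap.lineMap_apply]; rw [hx]; simp; linarith
          · simp [AffineMap.lineMap_apply]; field_simp; ring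
    · have hd : w.1 - v.1 ≠ 0 := sub_ne_zero.2 (Ne.symm hx)
      have hp : 0 < (w.1 - v.1) ^ 2 := by positivity
      refine ⟨(q.1 - v.1) / (w.1 - v.1), ⟨?_, ?_⟩, ?_⟩
      · rw [show (q.1 - v.1) / (w.1 - v.1) = (q.1 - v.1) * (w.1 - v.1) / (w.1 - v.1) ^ 2 by
          field_simp]
        apply div_nonneg _ hp.le
        nlinarith [sq_nonneg (q.1 - v.1)]
      · rw [show (q.1 - v.1) / (w.1 - v.1) = (q.1 - v.1) * (w.1 - v.1) / (w.1 - v.1) ^ 2 by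
          field_simp]
        rw [div_le_one hp]
        nlinarith [sq_nonneg (q.1 - w.1)]
      · ext
        · simp [AffineMap.lineMap_apply]; field_simp; ring
        · simp [AffineMap.lineMap_apply]; field_simp; linarith
  · intro h
    rw [segment_eq_image_lineMap] at h
    obtain ⟨t, ⟨h0, h1⟩, rfl⟩ := h
    simp only [OnEdge, cr, AffineMap.lineMap_apply, vsub_eq_sub, vadd_eq_add, Prod.fst_add,
      Prod.snd_add, Prod.smul_fst, Prod.smul_snd, Prod.fst_sub, Prod.snd_sub, smul_eq_mul]
    have ht : 0 ≤ t * (1 - t) := mul_nonneg h0 (by linarith)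
    refine ⟨by ring, ?_, ?_⟩
    · nlinarith [mul_nonneg ht (sq_nonneg (w.1 - v.1))]
    · nlinarith [mul_nonneg ht (sq_nonneg (w.2 - v.2))]

open Classical in
/-- The contribution of the edge from `v` to `w` to the crossing parity. -/
noncomputable def chiP (v w q : ℝ × ℝ) : ZMod 2 := if RayCross v w q then 1 else 0

open Classical in
/-- The vertex `v` lies vertically above `q`. -/
noncomputable def upP (q v : ℝ × ℝ) : ZMod 2 := if v.1 = q.1 ∧ q.2 < v.2 then 1 else 0

-- The half-open convention makes the contribution of an edge jump only when the ray moves left off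
-- an endpoint; this is the indicator of such a move.
open Classical in
noncomputable def leftP (q₀ q : ℝ × ℝ) : ZMod 2 := if q.1 < q₀.1 then 1 else 0

theorem two_eq_zero_zmod : (1 : ZMod 2) + 1 = 0 := by decide

theorem cr_swap_edge (v w q : ℝ × ℝ) : cr (v - w) (q - w) = - cr (w - v) (q - v) := by
  simp only [cr, Prod.fst_sub, Prod.snd_sub]; ring

theorem chiP_comm (v w q : ℝ × ℝ) : chiP v w q = chiP w v q := by
  simp only [chiP, RayCross, cr_swap_edge v w]
  congr 1
  simp only [eq_iff_iff]
  constructor <;> (rintro (⟨h1, h2, h3⟩ | ⟨h1, h2, h3⟩) <;> [right; left] <;>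
    exact ⟨h1, h2, by linarith⟩)

theorem OnEdge.symm {v w q : ℝ × ℝ} (h : OnEdge v w q) : OnEdge w v q := by
  rw [onEdge_iff] at *
  rwa [segment_symm]

theorem rayCross_of_lt {v w q : ℝ × ℝ} (h : v.1 < w.1) :
    RayCross v w q ↔ v.1 ≤ q.1 ∧ q.1 < w.1 ∧ cr (w - v) (q - v) < 0 := by
  simp only [RayCross, sub_nonneg, sub_neg]
  constructor
  · rintro (h1 | ⟨h1, h2, -⟩)
    · exact h1
    · linarith
  · exact Or.inl

theorem not_rayCross_of_eq {v w q : ℝ × ℝ} (h : v.1 = w.1) : ¬ RayCross v w q := by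
  simp only [RayCross, sub_nonneg, sub_neg]
  rintro (⟨h1, h2, -⟩ | ⟨h1, h2, -⟩) <;> linarith

theorem onEdge_of_between {v w q : ℝ × ℝ} (h1 : v.1 ≤ q.1) (h2 : q.1 ≤ w.1) (h : v.1 < w.1)
    (h0 : cr (w - v) (q - v) = 0) : OnEdge v w q := by
  rw [onEdge_iff, segment_eq_image_lineMap]
  have hd : w.1 - v.1 ≠ 0 := (sub_pos.2 h).ne'
  simp only [cr, Prod.fst_sub, Prod.snd_sub] at h0
  refine ⟨(q.1 - v.1) / (w.1 - v.1), ⟨div_nonneg (by linarith) (by linarith), ?_⟩, ?_⟩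
  · rw [div_le_one (by linarith)]; linarith
  · ext
    · simp [AffineMap.lineMap_apply]; field_simp; ring
    · simp [AffineMap.lineMap_apply]; field_simp; linarith

theorem continuous_cr_edge (v w : ℝ × ℝ) : Continuous fun q : ℝ × ℝ => cr (w - v) (q - v) := by
  unfold cr; fun_prop

theorem eventually_fst_lt {q₀ : ℝ × ℝ} {a : ℝ} (ha : q₀.1 < a) : ∀ᶠ q in 𝓝 q₀, q.1 < a :=
  continuous_fst.continuousAt.eventually_lt continuousAt_const ha

theorem eventually_lt_fst {q₀ : ℝ × ℝ} {a : ℝ} (ha : a < q₀.1) : ∀ᶠ q in 𝓝 q₀, a < q.1 :=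
  continuousAt_const.eventually_lt continuous_fst.continuousAt ha

/-- A small motion of the ray matters only if an endpoint lies vertically above `q₀`. The column of
the left endpoint belongs to the edge and that of the right endpoint does not, so moving right
changes nothing, while moving left toggles the crossing once for each endpoint above. The correction
is kept explicit because it cancels around the polygon. -/
theorem chiP_eventually_of_lt {v w q₀ : ℝ × ℝ} (h : ¬ OnEdge v w q₀) (hvw : v.1 < w.1) :
    ∀ᶠ q in 𝓝 q₀, chiP v w q = chiP v w q₀ + leftP q₀ q * (upP q₀ v + upP q₀ w) := by
  have cn : ∀ᶠ q in 𝓝 q₀, cr (w - v) (q₀ - v) < 0 → cr (w - v) (q - v) < 0 := by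
    by_cases hc : cr (w - v) (q₀ - v) < 0
    · filter_upwards [(continuous_cr_edge v w).continuousAt.eventually_lt continuousAt_const hc]
        with q hq _ using hq
    · simp [hc]
  have cp : ∀ᶠ q in 𝓝 q₀, 0 < cr (w - v) (q₀ - v) → 0 < cr (w - v) (q - v) := by
    by_cases hc : 0 < cr (w - v) (q₀ - v)
    · filter_upwards [continuousAt_const.eventually_lt (continuous_cr_edge v w).continuousAt hc]
        with q hq _ using hq
    · simp [hc]
  simp only [chiP, rayCross_of_lt hvw]
  by_cases hb : v.1 ≤ q₀.1 ∧ q₀.1 ≤ w.1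
  · have hc : cr (w - v) (q₀ - v) ≠ 0 := fun h0 => h (onEdge_of_between hb.1 hb.2 hvw h0)
    rcases hb.1.eq_or_lt with e | hv
    · have hw : q₀.1 < w.1 := e ▸ hvw
      have hcr : cr (w - v) (q₀ - v) = (w.1 - v.1) * (q₀.2 - v.2) := by
        simp [cr, e]
      filter_upwards [cn, cp, eventually_fst_lt hw] with q h1 h2 h3
      rcases hc.lt_or_gt with h4 | h4
      · have h5 := h1 h4
        have h6 : q₀.2 < v.2 := by rw [hcr] at h4; nlinarith
        by_cases h7 : q.1 < q₀.1
        · simp [leftP, upP, h7, not_le.2 h7, e, h6, hw, hw.ne', h4, two_eq_zero_zmod]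
        · simp [leftP, h7, not_lt.1 h7, e, hw, h4, h5, h3]
      · have h5 := h2 h4
        have h6 : ¬ q₀.2 < v.2 := by rw [hcr] at h4; intro; nlinarith
        simp [upP, h6, hw.ne', not_lt.2 h4.le, not_lt.2 h5.le]
    · rcases hb.2.eq_or_lt with e | hw
      · have hcr : cr (w - v) (q₀ - v) = (w.1 - v.1) * (q₀.2 - w.2) := by
          simp [cr, e]; ring
        filter_upwards [cn, cp, eventually_lt_fst hv] with q h1 h2 h3
        rcases hc.lt_or_gt with h4 | h4
        · have h5 := h1 h4
          have h6 : q₀.2 < w.2 := by rw [hcr] at h4; nlinarith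
          rw [← e]
          by_cases h7 : q.1 < q₀.1
          · have h7' : q.1 < w.1 := e ▸ h7
            simp [leftP, upP, h7', h3.le, h5, (hv.trans_eq e).ne, h6, e]
          · simp [leftP, h7]
        · have h5 := h2 h4
          have h6 : ¬ q₀.2 < w.2 := by rw [hcr] at h4; intro; nlinarith
          simp [upP, h6, hv.ne, not_lt.2 h4.le, not_lt.2 h5.le]
      · filter_upwards [cn, cp, eventually_lt_fst hv, eventually_fst_lt hw] with q h1 h2 h3 h3'
        rcases hc.lt_or_gt with h4 | h4
        · simp [upP, h4, h1 h4, h3.le, h3', hv.le, hw, hw.ne', hv.ne]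
        · simp [upP, not_lt.2 h4.le, not_lt.2 (h2 h4).le, hw.ne', hv.ne]
  · rw [not_and_or, not_le, not_le] at hb
    rcases hb with hb | hb
    · have hw : q₀.1 < w.1 := hb.trans hvw
      filter_upwards [eventually_fst_lt hb] with q h3
      simp [upP, hb.ne', hw.ne', not_le.2 hb, not_le.2 h3]
    · have hv : v.1 < q₀.1 := hvw.trans hb
      filter_upwards [eventually_lt_fst hb] with q h3
      simp [upP, hb.ne, hv.ne, not_lt.2 hb.le, not_lt.2 h3.le]

/-- The new case is a vertical edge, which is never crossed: off the edge, either both endpoints lie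
above `q₀` or neither does, so the correction vanishes modulo 2. -/
theorem chiP_eventually {v w q₀ : ℝ × ℝ} (h : ¬ OnEdge v w q₀) :
    ∀ᶠ q in 𝓝 q₀, chiP v w q = chiP v w q₀ + leftP q₀ q * (upP q₀ v + upP q₀ w) := by
  rcases lt_trichotomy v.1 w.1 with hvw | hvw | hvw
  · exact chiP_eventually_of_lt h hvw
  · simp only [chiP, not_rayCross_of_eq hvw]
    by_cases e : q₀.1 = v.1
    · have : upP q₀ v + upP q₀ w = 0 := by
        simp only [OnEdge, not_and, not_le] at h
        have h2 := h (by simp [cr, ← hvw, e]) (by simp [e])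
        simp only [upP, ← hvw, e, true_and]
        by_cases h3 : q₀.2 < v.2
        · have : q₀.2 < w.2 := by nlinarith
          simp [h3, this]; decide
        · have : ¬ q₀.2 < w.2 := by intro; nlinarith
          simp [h3, this]
      simp [this]
    · have e' : v.1 ≠ q₀.1 := Ne.symm e
      have e'' : w.1 ≠ q₀.1 := by rwa [← hvw]
      simp [upP, e', e'']
  · have := chiP_eventually_of_lt (fun h' => h h'.symm) hvw
    filter_upwards [this] with q hq
    rw [chiP_comm, hq, chiP_comm w v, add_comm (upP q₀ w)]

theorem ne_of_onEdge_lt {v w q : ℝ × ℝ} (hvw : v.1 < w.1) (h : OnEdge v w q) (hv : q ≠ v)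
    (hw : q ≠ w) : v.1 < q.1 ∧ q.1 < w.1 := by
  obtain ⟨h0, h1, h2⟩ := h
  simp only [cr, Prod.fst_sub, Prod.snd_sub] at h0
  have hd : 0 < w.1 - v.1 := by linarith
  refine ⟨lt_of_le_of_ne (by nlinarith) fun e => hv ?_, lt_of_le_of_ne (by nlinarith) fun e => hw ?_⟩
  · ext
    · exact e.symm
    · have : (w.1 - v.1) * (q.2 - v.2) = 0 := by rw [e] at h0 ⊢; linarith
      rcases mul_eq_zero.1 this with h | h <;> linarith
  · ext
    · exact e
    · have : (w.1 - v.1) * (q.2 - w.2) = 0 := by rw [e] at h0; linarith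
      rcases mul_eq_zero.1 this with h | h <;> linarith

open Classical in
/-- The side of the line from `v` to `w` on which `q` lies. -/
noncomputable def sideP (v w q : ℝ × ℝ) : ZMod 2 := if cr (w - v) (q - v) < 0 then 1 else 0

theorem sideP_comm {v w q : ℝ × ℝ} (h : cr (w - v) (q - v) ≠ 0) :
    sideP w v q = sideP v w q + 1 := by
  simp only [sideP, cr_swap_edge v w]
  rcases h.lt_or_gt with h | h
  · simp [h, not_lt.2 h.le]; decide
  · simp [h, not_lt.2 h.le]

/-- At an interior point of the edge, the ray meets the edge or not according to the side of its
line. For a vertical edge there is never a crossing, but exactly one endpoint lies above `q₀`, so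
the correction is itself the side up to a constant and the same formula holds. -/
theorem chiP_eventually_side {v w q₀ : ℝ × ℝ} (hne : v ≠ w) (h : OnEdge v w q₀) (hv : q₀ ≠ v)
    (hw : q₀ ≠ w) : ∃ c : ZMod 2, ∀ᶠ q in 𝓝 q₀, cr (w - v) (q - v) ≠ 0 →
      chiP v w q = c + sideP v w q + leftP q₀ q * (upP q₀ v + upP q₀ w) := by
  have key : ∀ {v w : ℝ × ℝ}, v.1 < w.1 → OnEdge v w q₀ → q₀ ≠ v → q₀ ≠ w →
      ∀ᶠ q in 𝓝 q₀, chiP v w q = sideP v w q + leftP q₀ q * (upP q₀ v + upP q₀ w) := by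
    intro v w hvw h hv hw
    obtain ⟨h1, h2⟩ := ne_of_onEdge_lt hvw h hv hw
    filter_upwards [eventually_lt_fst h1, eventually_fst_lt h2] with q h3 h4
    simp [upP, h1.ne, h2.ne', chiP, rayCross_of_lt hvw, h3.le, h4, sideP]
  rcases lt_trichotomy v.1 w.1 with hvw | hvw | hvw
  · refine ⟨0, (key hvw h hv hw).mono fun q hq _ => by rw [hq, zero_add]⟩
  · obtain ⟨h0, h1, h2⟩ := h
    have e : q₀.1 = v.1 := by rw [← hvw] at h1; nlinarith
    have e2 : q₀.2 ≠ v.2 := fun e2 => hv (Prod.ext e e2)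
    have e3 : q₀.2 ≠ w.2 := fun e2 => hw (Prod.ext (e.trans hvw) e2)
    have e4 : upP q₀ v + upP q₀ w = 1 := by
      simp only [upP, ← hvw, e, true_and]
      rcases e2.lt_or_gt with h3 | h3
      · have : ¬ q₀.2 < w.2 := by intro; nlinarith
        simp [h3, this]
      · have : q₀.2 < w.2 := lt_of_le_of_ne (by nlinarith) e3
        simp [not_lt.2 h3.le, this]
    have hc : ∀ q : ℝ × ℝ, cr (w - v) (q - v) = (w.2 - v.2) * (q₀.1 - q.1) := by
      intro q; simp [cr, ← hvw, e]; ring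
    have h5 : v.2 ≠ w.2 := fun e2 => hne (Prod.ext hvw e2)
    rcases h5.lt_or_gt with h5 | h5
    · refine ⟨1, Eventually.of_forall fun q hq => ?_⟩
      rw [hc] at hq
      simp only [chiP, not_rayCross_of_eq hvw, e4, sideP, hc, leftP]
      by_cases h6 : q.1 < q₀.1
      · have : ¬ (w.2 - v.2) * (q₀.1 - q.1) < 0 := by intro; nlinarith
        simp [h6, this]; decide
      · have : (w.2 - v.2) * (q₀.1 - q.1) < 0 := lt_of_le_of_ne (by nlinarith) hq
        simp [h6, this]; decide
    · refine ⟨0, Eventually.of_forall fun q hq => ?_⟩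
      rw [hc] at hq
      simp only [chiP, not_rayCross_of_eq hvw, e4, sideP, hc, leftP]
      by_cases h6 : q.1 < q₀.1
      · have : (w.2 - v.2) * (q₀.1 - q.1) < 0 := by nlinarith
        simp [h6, this]; decide
      · have : ¬ (w.2 - v.2) * (q₀.1 - q.1) < 0 := by intro; nlinarith
        simp [h6, this]
  · refine ⟨1, (key hvw h.symm hw hv).mono fun q hq hc => ?_⟩
    rw [chiP_comm, hq, sideP_comm hc]; ring

end MCR

/-! ### Crossing parity of a polygon -/

namespace MCR
open Filter Topology Set

variable {m : ℕ}

/-- The parity of the number of edges that are crossed by the upward ray from `q`. -/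
noncomputable def par (P : Polygon (ℝ × ℝ) m) (q : ℝ × ℝ) : ZMod 2 :=
  ∑ i, chiP (P i) (P (finRotate m i)) q

theorem mem_edgeSet {P : Polygon (ℝ × ℝ) m} {i : Fin m} {q : ℝ × ℝ} :
    q ∈ P.edgeSet ℝ i ↔ OnEdge (P i) (P (finRotate m i)) q := by
  rw [onEdge_iff, ← affineSegment_eq_segment]; rfl

theorem mem_boundary {P : Polygon (ℝ × ℝ) m} {q : ℝ × ℝ} :
    q ∈ P.boundary ℝ ↔ ∃ i, OnEdge (P i) (P (finRotate m i)) q := by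
  simp [Polygon.boundary, mem_edgeSet]

theorem isClosed_edgeSet (P : Polygon (ℝ × ℝ) m) (i : Fin m) : IsClosed (P.edgeSet ℝ i) := by
  rw [Polygon.edgeSet_eq_image_edgePath]
  refine (isCompact_Icc.image ?_).isClosed
  simp only [Polygon.edgePath]
  change Continuous fun c : ℝ => AffineMap.lineMap (P i) (P (finRotate m i)) c
  exact AffineMap.lineMap_continuous

theorem isClosed_boundary (P : Polygon (ℝ × ℝ) m) : IsClosed (P.boundary ℝ) :=
  isClosed_iUnion_of_finite fun i => isClosed_edgeSet P i

/-- Every vertex is the end of one edge and the start of another, hence is counted twice. -/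
theorem sum_upP_rotate (P : Polygon (ℝ × ℝ) m) (q : ℝ × ℝ) :
    ∑ i, (upP q (P i) + upP q (P (finRotate m i))) = 0 := by
  rw [Finset.sum_add_distrib, Equiv.sum_comp (finRotate m) fun i => upP q (P i)]
  exact CharTwo.add_self_eq_zero _

theorem par_eventually {P : Polygon (ℝ × ℝ) m} {q₀ : ℝ × ℝ} (h : q₀ ∉ P.boundary ℝ) :
    ∀ᶠ q in 𝓝 q₀, par P q = par P q₀ := by
  rw [mem_boundary, not_exists] at h
  filter_upwards [eventually_all.2 fun i => chiP_eventually (h i)] with q hq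
  simp only [par, hq, Finset.sum_add_distrib, ← Finset.mul_sum]
  rw [← Finset.sum_add_distrib, sum_upP_rotate, mul_zero, add_zero]

/-- The corrections still cancel over all edges, including the edge through `q₀`, so what remains is
the side relative to that edge. This is why the parity flips when the boundary is crossed. -/
theorem par_eventually_side {P : Polygon (ℝ × ℝ) m} {q₀ : ℝ × ℝ} {j : Fin m}
    (hne : P j ≠ P (finRotate m j)) (hj : OnEdge (P j) (P (finRotate m j)) q₀)
    (hv : q₀ ≠ P j) (hw : q₀ ≠ P (finRotate m j))
    (h : ∀ i ≠ j, ¬ OnEdge (P i) (P (finRotate m i)) q₀) :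
    ∃ c : ZMod 2, ∀ᶠ q in 𝓝 q₀, cr (P (finRotate m j) - P j) (q - P j) ≠ 0 →
      par P q = c + sideP (P j) (P (finRotate m j)) q := by
  obtain ⟨c, hc⟩ := chiP_eventually_side hne hj hv hw
  refine ⟨c + ∑ i ∈ Finset.univ.erase j, chiP (P i) (P (finRotate m i)) q₀, ?_⟩
  have h' : ∀ᶠ q in 𝓝 q₀, ∀ i, i ≠ j → chiP (P i) (P (finRotate m i)) q =
      chiP (P i) (P (finRotate m i)) q₀ +
        leftP q₀ q * (upP q₀ (P i) + upP q₀ (P (finRotate m i))) := by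
    refine eventually_all.2 fun i => ?_
    by_cases hi : i = j
    · simp [hi]
    · simpa [hi] using chiP_eventually (h i hi)
  filter_upwards [hc, h'] with q h1 h2 h3
  have e := sum_upP_rotate P q₀
  rw [← Finset.add_sum_erase _ _ (Finset.mem_univ j)] at e
  rw [par, ← Finset.add_sum_erase _ _ (Finset.mem_univ j), h1 h3,
    Finset.sum_congr rfl fun i hi => h2 i (Finset.ne_of_mem_erase hi), Finset.sum_add_distrib,
    ← Finset.mul_sum]
  linear_combination leftP q₀ q * e

theorem par_eq_of_isPreconnected {P : Polygon (ℝ × ℝ) m} {S : Set (ℝ × ℝ)}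
    (hS : IsPreconnected S) (h : S ⊆ (P.boundary ℝ)ᶜ) {x y : ℝ × ℝ} (hx : x ∈ S) (hy : y ∈ S) :
    par P x = par P y := by
  refine hS.constant (f := par P) (fun q hq => ?_) hx hy
  refine ContinuousAt.continuousWithinAt ?_
  have := par_eventually (h hq)
  exact (continuousAt_const (y := par P q)).congr (this.mono fun q hq => hq.symm)

/-! ### Far points -/

theorem onEdge_mem_of_convex {P : Polygon (ℝ × ℝ) m} {S : Set (ℝ × ℝ)} (hS : Convex ℝ S)
    (h : ∀ i, P i ∈ S) : P.boundary ℝ ⊆ S := by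
  intro q hq
  obtain ⟨i, hi⟩ := mem_boundary.1 hq
  rw [onEdge_iff] at hi
  exact hS.segment_subset (h _) (h _) hi

theorem exists_box (P : Polygon (ℝ × ℝ) m) : ∃ R : ℝ, ∀ i, |(P i).1| < R ∧ |(P i).2| < R := by
  refine ⟨1 + ∑ i, (|(P i).1| + |(P i).2|), fun i => ?_⟩
  have := Finset.single_le_sum (f := fun i => |(P i).1| + |(P i).2|)
    (fun i _ => by positivity) (Finset.mem_univ i)
  constructor <;> linarith [abs_nonneg (P i).1, abs_nonneg (P i).2]

/-- There is a connected unbounded set of points of parity zero that contains the complement of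
a bounded set. -/
theorem par_eq_zero_of_far {P : Polygon (ℝ × ℝ) m} {R : ℝ}
    (hR : ∀ i, |(P i).1| < R ∧ |(P i).2| < R) {q : ℝ × ℝ} (hq : R ≤ |q.1| ∨ R ≤ |q.2|) :
    q ∉ P.boundary ℝ ∧ par P q = 0 := by
  have h1 : ∀ i, -R < (P i).1 ∧ (P i).1 < R := fun i => abs_lt.1 (hR i).1
  have h2 : ∀ i, -R < (P i).2 ∧ (P i).2 < R := fun i => abs_lt.1 (hR i).2
  have left : ∀ q : ℝ × ℝ, q.1 ≤ -R → par P q = 0 := fun q hq => by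
    refine Finset.sum_eq_zero fun i _ => ?_
    have a := (h1 i).1
    have b := (h1 (finRotate m i)).1
    rw [chiP, if_neg]
    rintro (⟨h, -⟩ | ⟨h, -⟩) <;> linarith
  have right : ∀ q : ℝ × ℝ, R ≤ q.1 → par P q = 0 := fun q hq => by
    refine Finset.sum_eq_zero fun i _ => ?_
    have a := (h1 i).2
    have b := (h1 (finRotate m i)).2
    rw [chiP, if_neg]
    rintro (⟨-, h, -⟩ | ⟨-, h, -⟩) <;> linarith
  have b1 : ∀ q ∈ P.boundary ℝ, -R < q.1 := fun q hq =>
    onEdge_mem_of_convex (S := {q | -R < q.1}) (convex_halfSpace_gt (IsLinearMap.mk (by simp) (by simp)) _)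
      (fun i => (h1 i).1) hq
  have b2 : ∀ q ∈ P.boundary ℝ, q.1 < R := fun q hq =>
    onEdge_mem_of_convex (S := {q | q.1 < R}) (convex_halfSpace_lt (IsLinearMap.mk (by simp) (by simp)) _)
      (fun i => (h1 i).2) hq
  have b3 : ∀ q ∈ P.boundary ℝ, -R < q.2 := fun q hq =>
    onEdge_mem_of_convex (S := {q | -R < q.2}) (convex_halfSpace_gt (IsLinearMap.mk (by simp) (by simp)) _)
      (fun i => (h2 i).1) hq
  have b4 : ∀ q ∈ P.boundary ℝ, q.2 < R := fun q hq =>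
    onEdge_mem_of_convex (S := {q | q.2 < R}) (convex_halfSpace_lt (IsLinearMap.mk (by simp) (by simp)) _)
      (fun i => (h2 i).2) hq
  rcases hq with hq | hq <;> rcases le_abs.1 hq with h | h
  · exact ⟨fun hb => absurd (b2 _ hb) (not_lt.2 h), right q h⟩
  · exact ⟨fun hb => absurd (b1 _ hb) (not_lt.2 (by linarith)), left q (by linarith)⟩
  -- The half-plane above the box is connected and misses the boundary, so the parity can be read
  -- off at its point `(-R, R)`, which is to the left of all edges. The half-plane below is treated
  -- alike.
  · refine ⟨fun hb => absurd (b4 _ hb) (not_lt.2 h), ?_⟩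
    have hc : Convex ℝ {q : ℝ × ℝ | R ≤ q.2} :=
      convex_halfSpace_ge (IsLinearMap.mk (by simp) (by simp)) _
    rw [par_eq_of_isPreconnected (P := P) hc.isPreconnected
      (fun z hz hb => absurd (b4 _ hb) (not_lt.2 hz)) h (y := (-R, R)) (by simp)]
    exact left _ le_rfl
  · refine ⟨fun hb => absurd (b3 _ hb) (not_lt.2 (by linarith)), ?_⟩
    have hc : Convex ℝ {q : ℝ × ℝ | q.2 ≤ -R} :=
      convex_halfSpace_le (IsLinearMap.mk (by simp) (by simp)) _
    rw [par_eq_of_isPreconnected (P := P) hc.isPreconnected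
      (fun z hz hb => absurd (b3 _ hb) (not_lt.2 hz)) (show q ∈ {q : ℝ × ℝ | q.2 ≤ -R} by simp; linarith)
      (y := (-R, -R)) (by simp)]
    exact left _ le_rfl

theorem isBounded_of_par_eq_one {P : Polygon (ℝ × ℝ) m} {S : Set (ℝ × ℝ)}
    (h : ∀ q ∈ S, par P q = 1) : Bornology.IsBounded S := by
  obtain ⟨R, hR⟩ := exists_box P
  refine (Metric.isBounded_closedBall (x := (0 : ℝ × ℝ)) (r := R)).subset fun q hq => ?_
  rw [mem_closedBall_zero_iff, Prod.norm_def, Real.norm_eq_abs, Real.norm_eq_abs]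
  by_contra hc
  rw [max_le_iff, not_and_or, not_le, not_le] at hc
  have := (par_eq_zero_of_far hR (hc.imp le_of_lt le_of_lt)).2
  rw [h q hq] at this
  exact one_ne_zero this

/-! ### Sectors -/

theorem cr_add_left (a b c : ℝ × ℝ) : cr (a + b) c = cr a c + cr b c := by simp [cr]; ring
theorem cr_add_right (a b c : ℝ × ℝ) : cr a (b + c) = cr a b + cr a c := by simp [cr]; ring
theorem cr_sub_right (a b c : ℝ × ℝ) : cr a (b - c) = cr a b - cr a c := by simp [cr]; ring
theorem cr_smul_left (s : ℝ) (a b : ℝ × ℝ) : cr (s • a) b = s * cr a b := by simp [cr]; ring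
theorem cr_smul_right (s : ℝ) (a b : ℝ × ℝ) : cr a (s • b) = s * cr a b := by simp [cr]; ring
theorem cr_self (a : ℝ × ℝ) : cr a a = 0 := by simp [cr]; ring
theorem cr_anti (a b : ℝ × ℝ) : cr a b = - cr b a := by simp [cr]; ring

/-- The open sector at `x` from direction `d₁` to direction `d₂`, of angle at most `π`. -/
def sector (x d₁ d₂ : ℝ × ℝ) : Set (ℝ × ℝ) := {z | 0 < cr d₁ (z - x) ∧ 0 < cr (z - x) d₂}

/-- The complementary sector. -/
def cosector (x d₁ d₂ : ℝ × ℝ) : Set (ℝ × ℝ) := {z | cr d₁ (z - x) < 0 ∨ cr (z - x) d₂ < 0}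

/-- The two rays from `x` with directions `d₁` and `d₂`. -/
def rays (x d₁ d₂ : ℝ × ℝ) : Set (ℝ × ℝ) := {z | ∃ s : ℝ, 0 ≤ s ∧ (z = x + s • d₁ ∨ z = x + s • d₂)}

theorem convex_cr_lt (x d : ℝ × ℝ) : Convex ℝ {z | cr d (z - x) < 0} := by
  have : {z | cr d (z - x) < 0} = {z | cr d z < cr d x} := by
    ext z; simp [cr_sub_right]
  rw [this]
  exact convex_halfSpace_lt (IsLinearMap.mk (cr_add_right d) fun c z => by simp [cr_smul_right]) _

theorem convex_sector (x d₁ d₂ : ℝ × ℝ) : Convex ℝ (sector x d₁ d₂) := by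
  have : sector x d₁ d₂ = {z | cr (-d₁) (z - x) < 0} ∩ {z | cr d₂ (z - x) < 0} := by
    ext z
    simp only [sector, mem_ofPred_eq, mem_inter_iff, cr_anti (z - x)]
    simp [cr]
  rw [this]
  exact (convex_cr_lt _ _).inter (convex_cr_lt _ _)

theorem exists_small_smul (x g : ℝ × ℝ) {ε : ℝ} (hε : 0 < ε) :
    ∀ᶠ s : ℝ in 𝓝 0, x + s • g ∈ Metric.ball x ε := by
  have hc : Continuous fun s : ℝ => x + s • g := by fun_prop
  have := hc.tendsto 0
  simp only [zero_smul, add_zero] at this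
  exact this.eventually (Metric.ball_mem_nhds x hε)

/-- The complementary sector is a union of two half-planes, which share the points `x - s g` for
small `s > 0`; each of them meets the ball in a convex set. -/
theorem isPreconnected_cosector_inter {x d₁ d₂ g : ℝ × ℝ} (h1 : 0 < cr d₁ g) (h2 : 0 < cr g d₂)
    {ε : ℝ} (hε : 0 < ε) : IsPreconnected (cosector x d₁ d₂ ∩ Metric.ball x ε) := by
  have : cosector x d₁ d₂ ∩ Metric.ball x ε =
      ({z | cr d₁ (z - x) < 0} ∩ Metric.ball x ε) ∪
        ({z | cr (-d₂) (z - x) < 0} ∩ Metric.ball x ε) := by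
    ext z
    simp only [cosector, mem_ofPred_eq, mem_inter_iff, mem_union, cr_anti (z - x)]
    have : cr (-d₂) (z - x) = - cr d₂ (z - x) := by simp [cr]; ring
    rw [this]; tauto
  rw [this]
  obtain ⟨s, hs, hs0⟩ := (((exists_small_smul x (-g) hε).filter_mono nhdsWithin_le_nhds).and
    (self_mem_nhdsWithin : Ioi (0 : ℝ) ∈ 𝓝[>] 0)).exists
  have hs0 : 0 < s := hs0
  refine IsPreconnected.union (x + s • (-g)) ⟨?_, hs⟩ ⟨?_, hs⟩
    ((convex_cr_lt _ _).inter (convex_ball _ _)).isPreconnected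
    ((convex_cr_lt _ _).inter (convex_ball _ _)).isPreconnected
  · have : cr d₁ (x + s • (-g) - x) = - (s * cr d₁ g) := by simp [cr]; ring
    simp only [mem_ofPred_eq, this]; nlinarith [mul_pos hs0 h1]
  · have : cr (-d₂) (x + s • (-g) - x) = - (s * cr g d₂) := by simp [cr]; ring
    simp only [mem_ofPred_eq, this]; nlinarith [mul_pos hs0 h2]

/-- Outside both sectors one of the two cross products vanishes, so `z - x` is a multiple of `d₁` or
of `d₂`. A negative multiple is possible only for a straight angle, and then it is a nonnegative
multiple of the other direction. -/
theorem mem_trichotomy_sector {x d₁ d₂ g : ℝ × ℝ} (h1 : 0 < cr d₁ g) (h2 : 0 < cr g d₂)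
    (h : 0 ≤ cr d₁ d₂) (z : ℝ × ℝ) : z ∈ sector x d₁ d₂ ∨ z ∈ cosector x d₁ d₂ ∨ z ∈ rays x d₁ d₂ := by
  by_cases a : z ∈ sector x d₁ d₂
  · exact Or.inl a
  by_cases b : z ∈ cosector x d₁ d₂
  · exact Or.inr (Or.inl b)
  right; right
  simp only [sector, cosector, mem_ofPred_eq, not_and_or, not_or, not_lt] at a b
  set y := z - x with hy
  have hz : z = x + y := by simp [hy]
  -- `cr d₁ g • y = cr y g • d₁ + cr d₁ y • g`
  have id1 : cr d₁ g • y = cr y g • d₁ + cr d₁ y • g := by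
    ext <;> simp [cr] <;> ring
  have id2 : cr g d₂ • y = cr g y • d₂ + cr y d₂ • g := by
    ext <;> simp [cr] <;> ring
  have E1 : cr d₁ y = 0 → y = (cr y g / cr d₁ g) • d₁ := fun e => by
    rw [e, zero_smul, add_zero] at id1
    rw [div_eq_inv_mul, mul_smul, ← id1, smul_smul, inv_mul_cancel₀ h1.ne', one_smul]
  have E2 : cr y d₂ = 0 → y = (cr g y / cr g d₂) • d₂ := fun e => by
    rw [e, zero_smul, add_zero] at id2
    rw [div_eq_inv_mul, mul_smul, ← id2, smul_smul, inv_mul_cancel₀ h2.ne', one_smul]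
  rcases a with a | a
  · have e := E1 (le_antisymm a b.1)
    rcases le_or_gt 0 (cr y g / cr d₁ g) with hs | hs
    · exact ⟨_, hs, Or.inl (by rw [hz]; nth_rewrite 1 [e]; rfl)⟩
    · have h3 : cr y d₂ = (cr y g / cr d₁ g) * cr d₁ d₂ := by
        nth_rewrite 1 [e]; rw [cr_smul_left]
      have h4 : cr y d₂ = 0 := le_antisymm (by rw [h3]; nlinarith) b.2
      refine ⟨_, ?_, Or.inr (by rw [hz]; nth_rewrite 1 [E2 h4]; rfl)⟩
      have : cr y g < 0 := by
        by_contra hc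
        exact absurd hs (not_lt.2 (div_nonneg (not_lt.1 hc) h1.le))
      exact div_nonneg (by rw [cr_anti]; linarith) h2.le
  · have e := E2 (le_antisymm a b.2)
    rcases le_or_gt 0 (cr g y / cr g d₂) with hs | hs
    · exact ⟨_, hs, Or.inr (by rw [hz]; nth_rewrite 1 [e]; rfl)⟩
    · have h3 : cr d₁ y = (cr g y / cr g d₂) * cr d₁ d₂ := by
        nth_rewrite 1 [e]; rw [cr_smul_right]
      have h4 : cr d₁ y = 0 := le_antisymm (by rw [h3]; nlinarith) b.1
      refine ⟨_, ?_, Or.inl (by rw [hz]; nth_rewrite 1 [E1 h4]; rfl)⟩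
      have : cr g y < 0 := by
        by_contra hc
        exact absurd hs (not_lt.2 (div_nonneg (not_lt.1 hc) h2.le))
      exact div_nonneg (by rw [cr_anti]; linarith) h1.le

theorem rays_disjoint {x d₁ d₂ : ℝ × ℝ} (h : 0 ≤ cr d₁ d₂) {z : ℝ × ℝ} (hz : z ∈ rays x d₁ d₂) :
    z ∉ sector x d₁ d₂ ∧ z ∉ cosector x d₁ d₂ := by
  obtain ⟨s, hs, rfl | rfl⟩ := hz <;>
    simp only [sector, cosector, mem_ofPred_eq, add_sub_cancel_left, cr_smul_left, cr_smul_right,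
      cr_self, mul_zero, lt_irrefl, false_and, and_false, not_false_iff, true_and, false_or,
      or_false, not_lt] <;> positivity

end MCR

namespace MCR
open Filter Topology Set

variable {m : ℕ}

/-- The points off the boundary with crossing parity zero. -/
def evenSet (P : Polygon (ℝ × ℝ) m) : Set (ℝ × ℝ) := {q | q ∉ P.boundary ℝ ∧ par P q = 0}

theorem isOpen_evenSet (P : Polygon (ℝ × ℝ) m) : IsOpen (evenSet P) := by
  rw [isOpen_iff_mem_nhds]
  rintro q ⟨h1, h2⟩
  filter_upwards [par_eventually h1, (isClosed_boundary P).isOpen_compl.mem_nhds h1] with z h3 h4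
  exact ⟨h4, h3.trans h2⟩

/-- Near `x` the even side of the boundary is connected and touches all of the boundary. -/
def IsTame (P : Polygon (ℝ × ℝ) m) (x : ℝ × ℝ) : Prop :=
  ∃ ε > 0, IsPreconnected (evenSet P ∩ Metric.ball x ε) ∧
    P.boundary ℝ ∩ Metric.ball x ε ⊆ closure (evenSet P ∩ Metric.ball x ε)

/-- The two rays split the ball into a sector and a cosector, both connected, so the parity is
constant on each. At the point `x + s • d₁`, interior to edge `j` and on no other edge, the parity
flips, so exactly one of the two pieces is the even set. Translating boundary points by small
positive multiples of `g` or `-g` enters the sector or the cosector, whence the claim about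
closures. -/
theorem isTame_of_rays {P : Polygon (ℝ × ℝ) m} {x d₁ d₂ g : ℝ × ℝ} {j : Fin m} {ε s c : ℝ}
    (hε : 0 < ε) (h12 : 0 ≤ cr d₁ d₂) (h1 : 0 < cr d₁ g) (h2 : 0 < cr g d₂)
    (hray : ∀ z ∈ Metric.ball x ε, z ∈ P.boundary ℝ ↔ z ∈ rays x d₁ d₂)
    (hs : 0 < s) (hsb : x + s • d₁ ∈ Metric.ball x ε)
    (hj : OnEdge (P j) (P (finRotate m j)) (x + s • d₁)) (hv : x + s • d₁ ≠ P j)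
    (hw : x + s • d₁ ≠ P (finRotate m j))
    (ho : ∀ i ≠ j, ¬ OnEdge (P i) (P (finRotate m i)) (x + s • d₁))
    (hc : c ≠ 0) (hd : P (finRotate m j) - P j = c • d₁) : IsTame P x := by
  have hne : P j ≠ P (finRotate m j) := by
    intro e
    rw [e, sub_self, eq_comm, smul_eq_zero] at hd
    rcases hd with hd | hd
    · exact hc hd
    · rw [hd] at h1; simp [cr] at h1
  set z₀ := x + s • d₁ with hz₀
  obtain ⟨k, hk⟩ := par_eventually_side hne hj hv hw ho
  have T : ∀ z g : ℝ × ℝ, Tendsto (fun t : ℝ => z + t • g) (𝓝[>] 0) (𝓝 z) := fun z g => by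
    have hc : Continuous fun s : ℝ => z + s • g := by fun_prop
    have := (hc.tendsto 0).mono_left (nhdsWithin_le_nhds (s := Ioi 0))
    simpa using this
  have B : ∀ z ∈ Metric.ball x ε, ∀ g, ∀ᶠ t : ℝ in 𝓝[>] 0, z + t • g ∈ Metric.ball x ε :=
    fun z hz g => (T z g).eventually (Metric.isOpen_ball.mem_nhds hz)
  have pos : ∀ᶠ t : ℝ in 𝓝[>] 0, 0 < t := self_mem_nhdsWithin
  have S1 : ∀ z ∈ rays x d₁ d₂, ∀ t : ℝ, 0 < t → z + t • g ∈ sector x d₁ d₂ := by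
    rintro z ⟨s, hs, rfl | rfl⟩ t ht <;>
    simp only [sector, mem_ofPred_eq, add_assoc, add_sub_cancel_left, cr_add_left, cr_add_right,
      cr_smul_left, cr_smul_right, cr_self] <;>
    constructor <;> positivity
  have S2 : ∀ z ∈ rays x d₁ d₂, ∀ t : ℝ, 0 < t → z + t • (-g) ∈ cosector x d₁ d₂ := by
    have e1 : cr d₁ (-g) = - cr d₁ g := by simp [cr]; ring
    have e2 : cr (-g) d₂ = - cr g d₂ := by simp [cr]; ring
    rintro z ⟨s, hs, rfl | rfl⟩ t ht <;>
    simp only [cosector, mem_ofPred_eq, add_assoc, add_sub_cancel_left, cr_add_left, cr_add_right,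
      cr_smul_left, cr_smul_right, cr_self, e1, e2]
    · left; nlinarith [mul_pos ht h1]
    · right; nlinarith [mul_pos ht h2]
  have W1 : sector x d₁ d₂ ∩ Metric.ball x ε ⊆ (P.boundary ℝ)ᶜ := fun z hz hb =>
    (rays_disjoint h12 ((hray z hz.2).1 hb)).1 hz.1
  have W2 : cosector x d₁ d₂ ∩ Metric.ball x ε ⊆ (P.boundary ℝ)ᶜ := fun z hz hb =>
    (rays_disjoint h12 ((hray z hz.2).1 hb)).2 hz.1
  have C1 : IsPreconnected (sector x d₁ d₂ ∩ Metric.ball x ε) :=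
    ((convex_sector _ _ _).inter (convex_ball _ _)).isPreconnected
  have C2 := isPreconnected_cosector_inter (x := x) h1 h2 hε
  have hz₀r : z₀ ∈ rays x d₁ d₂ := ⟨s, hs.le, Or.inl rfl⟩
  -- One small `t` serves both sides: `z₀ ± t g` lie in the ball and in the range of the side
  -- formula.
  obtain ⟨t, ht, hb1, hb2, hk1, hk2⟩ := (pos.and ((B z₀ hsb g).and ((B z₀ hsb (-g)).and
    (((T z₀ g).eventually hk).and ((T z₀ (-g)).eventually hk))))).exists
  have e0 : cr (P (finRotate m j) - P j) (z₀ - P j) = 0 := hj.1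
  have e1 : cr (P (finRotate m j) - P j) (z₀ + t • g - P j) = t * (c * cr d₁ g) := by
    rw [add_sub_right_comm, cr_add_right, e0, hd, cr_smul_right, cr_smul_left, zero_add]
  have e2 : cr (P (finRotate m j) - P j) (z₀ + t • (-g) - P j) = - (t * (c * cr d₁ g)) := by
    rw [add_sub_right_comm, cr_add_right, e0, hd, cr_smul_right, cr_smul_left, zero_add]
    simp [cr]; ring
  have hn : t * (c * cr d₁ g) ≠ 0 := by positivity
  have hy1 : z₀ + t • g ∈ sector x d₁ d₂ ∩ Metric.ball x ε := ⟨S1 _ hz₀r t ht, hb1⟩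
  have hy2 : z₀ + t • (-g) ∈ cosector x d₁ d₂ ∩ Metric.ball x ε := ⟨S2 _ hz₀r t ht, hb2⟩
  have p1 := hk1 (by rw [e1]; exact hn)
  have p2 := hk2 (by rw [e2]; exact neg_ne_zero.2 hn)
  have hpar : par P (z₀ + t • g) = par P (z₀ + t • (-g)) + 1 := by
    rw [p1, p2, sideP, sideP, e1, e2]
    rcases hn.lt_or_gt with h | h
    · simp [h, not_lt.2 h.le]
    · simp [h, not_lt.2 h.le, add_assoc, two_eq_zero_zmod]
  have q1 : ∀ z ∈ sector x d₁ d₂ ∩ Metric.ball x ε, par P z = par P (z₀ + t • g) := fun z hz =>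
    par_eq_of_isPreconnected C1 W1 hz hy1
  have q2 : ∀ z ∈ cosector x d₁ d₂ ∩ Metric.ball x ε, par P z = par P (z₀ + t • (-g)) :=
    fun z hz => par_eq_of_isPreconnected C2 W2 hz hy2
  have cases2 : ∀ a : ZMod 2, a = 0 ∨ a = 1 := by decide
  have tri := fun z => mem_trichotomy_sector (x := x) h1 h2 h12 z
  refine ⟨ε, hε, ?_⟩
  rcases cases2 (par P (z₀ + t • (-g))) with h | h
  · have E : evenSet P ∩ Metric.ball x ε = cosector x d₁ d₂ ∩ Metric.ball x ε := by
      ext z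
      constructor
      · rintro ⟨⟨h3, h4⟩, h5⟩
        rcases tri z with h6 | h6 | h6
        · rw [q1 z ⟨h6, h5⟩, hpar, h] at h4; simp at h4
        · exact ⟨h6, h5⟩
        · exact absurd ((hray z h5).2 h6) h3
      · intro h3
        exact ⟨⟨W2 h3, (q2 z h3).trans h⟩, h3.2⟩
    rw [E]
    refine ⟨C2, fun z hz => mem_closure_of_tendsto (T z (-g)) ?_⟩
    filter_upwards [pos, B z hz.2 (-g)] with t ht hb
    exact ⟨S2 z ((hray z hz.2).1 hz.1) t ht, hb⟩
  · have h' : par P (z₀ + t • g) = 0 := by rw [hpar, h]; exact two_eq_zero_zmod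
    have E : evenSet P ∩ Metric.ball x ε = sector x d₁ d₂ ∩ Metric.ball x ε := by
      ext z
      constructor
      · rintro ⟨⟨h3, h4⟩, h5⟩
        rcases tri z with h6 | h6 | h6
        · exact ⟨h6, h5⟩
        · rw [q2 z ⟨h6, h5⟩, h] at h4; simp at h4
        · exact absurd ((hray z h5).2 h6) h3
      · intro h3
        exact ⟨⟨W1 h3, (q1 z h3).trans h'⟩, h3.2⟩
    rw [E]
    refine ⟨C1, fun z hz => mem_closure_of_tendsto (T z g) ?_⟩
    filter_upwards [pos, B z hz.2 g] with t ht hb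
    exact ⟨S1 z ((hray z hz.2).1 hz.1) t ht, hb⟩

/-! ### The complement of a polygon all of whose boundary points are tame -/

/-- The closure of a component of the even set meets the boundary, as otherwise the component would
be clopen in the plane. By tameness the part of the boundary in this closure is relatively open, so
by connectedness it is everything. Two components therefore both enter one tame ball, in which the
even set is connected, and they coincide. -/
theorem evenSet_subset_component {P : Polygon (ℝ × ℝ) m} (hb : IsPreconnected (P.boundary ℝ))
    (hne : (P.boundary ℝ).Nonempty) (ht : ∀ x ∈ P.boundary ℝ, IsTame P x) :
    IsPreconnected (evenSet P) := by
  -- a component meets a tame neighborhood in the whole even side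
  have key : ∀ z ∈ evenSet P, P.boundary ℝ ⊆ closure (connectedComponentIn (evenSet P) z) := by
    intro z hz
    set A := connectedComponentIn (evenSet P) z with hA
    have hAo : IsOpen A := (isOpen_evenSet P).connectedComponentIn
    have hzA : z ∈ A := mem_connectedComponentIn hz
    have hAE : A ⊆ evenSet P := connectedComponentIn_subset _ _
    have loc : ∀ x ∈ closure A ∩ P.boundary ℝ, ∃ ε > 0,
        P.boundary ℝ ∩ Metric.ball x ε ⊆ closure A := by
      rintro x ⟨hx, hxb⟩
      obtain ⟨ε, hε, hp, hc⟩ := ht x hxb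
      obtain ⟨y, hy, hyA⟩ := mem_closure_iff.1 hx _ Metric.isOpen_ball (Metric.mem_ball_self hε)
      refine ⟨ε, hε, hc.trans (closure_mono ?_)⟩
      have : connectedComponentIn (evenSet P) y = A := connectedComponentIn_eq hyA |>.symm
      rw [← this]
      exact hp.subset_connectedComponentIn ⟨hAE hyA, hy⟩ inter_subset_left
    have hnon : (closure A ∩ P.boundary ℝ).Nonempty := by
      by_contra hcon
      rw [not_nonempty_iff_eq_empty] at hcon
      have hcl : IsClosed A := by
        rw [← closure_subset_iff_isClosed]
        intro y hy
        have hyb : y ∉ P.boundary ℝ := fun h => by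
          have : y ∈ closure A ∩ P.boundary ℝ := ⟨hy, h⟩
          rw [hcon] at this; exact this
        have hU : {q | q ∉ P.boundary ℝ ∧ par P q = par P y} ∈ 𝓝 y := by
          filter_upwards [par_eventually hyb, (isClosed_boundary P).isOpen_compl.mem_nhds hyb]
            with q h1 h2 using ⟨h2, h1⟩
        obtain ⟨q, hq, hqA⟩ := mem_closure_iff_nhds.1 hy _ hU
        have hyE : y ∈ evenSet P := ⟨hyb, by rw [← hq.2]; exact (hAE hqA).2⟩
        have h2 : (connectedComponentIn (evenSet P) y) ∈ 𝓝 y :=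
          (isOpen_evenSet P).connectedComponentIn.mem_nhds (mem_connectedComponentIn hyE)
        obtain ⟨q, hq, hqA⟩ := mem_closure_iff_nhds.1 hy _ h2
        have e1 := connectedComponentIn_eq hq
        have e2 := connectedComponentIn_eq hqA
        rw [hA, e2, ← e1]
        exact mem_connectedComponentIn hyE
      have huniv := IsClopen.eq_univ ⟨hcl, hAo⟩ ⟨z, hzA⟩
      obtain ⟨x, hx⟩ := hne
      exact (hAE (huniv ▸ mem_univ x : x ∈ A)).1 hx
    -- connectedness of the boundary
    by_contra hcon
    obtain ⟨y, hyb, hy⟩ := not_subset.1 hcon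
    obtain ⟨x, hx, hxb⟩ := hnon
    choose! r hr hr' using loc
    -- The boundary is covered by two open sets that both meet it: the tame balls around its points
    -- in the closure of `A`, and the complement of that closure. A common boundary point
    -- contradicts the choice of the balls.
    obtain ⟨q, hqb, hq1, hq2⟩ := hb (⋃ x ∈ closure A ∩ P.boundary ℝ, Metric.ball x (r x)) (closure A)ᶜ
      (isOpen_biUnion fun _ _ => Metric.isOpen_ball) isClosed_closure.isOpen_compl
      (fun q hq => by
        by_cases h : q ∈ closure A
        · exact Or.inl (mem_biUnion (show q ∈ closure A ∩ P.boundary ℝ from ⟨h, hq⟩)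
            (Metric.mem_ball_self (hr q ⟨h, hq⟩)))
        · exact Or.inr h)
      ⟨x, hxb, mem_biUnion (show x ∈ closure A ∩ P.boundary ℝ from ⟨hx, hxb⟩)
        (Metric.mem_ball_self (hr x ⟨hx, hxb⟩))⟩ ⟨y, hyb, hy⟩
    obtain ⟨x', hx', hq⟩ := mem_iUnion₂.1 hq1
    exact hq2 (hr' x' hx' ⟨hqb, hq⟩)
  rcases (evenSet P).eq_empty_or_nonempty with he | ⟨z, hz⟩
  · rw [he]; exact isPreconnected_empty
  have : evenSet P ⊆ connectedComponentIn (evenSet P) z := by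
    intro y hy
    obtain ⟨x, hx⟩ := hne
    obtain ⟨ε, hε, hp, hc⟩ := ht x hx
    have touch : ∀ z ∈ evenSet P, ∃ w ∈ evenSet P ∩ Metric.ball x ε,
        w ∈ connectedComponentIn (evenSet P) z := by
      intro z hz
      obtain ⟨w, hw, hwA⟩ := mem_closure_iff.1 (key z hz hx) _ Metric.isOpen_ball
        (Metric.mem_ball_self hε)
      exact ⟨w, ⟨connectedComponentIn_subset _ _ hwA, hw⟩, hwA⟩
    obtain ⟨w₁, h1, h1'⟩ := touch z hz
    obtain ⟨w₂, h2, h2'⟩ := touch y hy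
    have h3 := hp.subset_connectedComponentIn h1 inter_subset_left h2
    have e1 := connectedComponentIn_eq h1'
    have e2 := connectedComponentIn_eq h2'
    have e3 := connectedComponentIn_eq h3
    rw [e1, e3, ← e2]
    exact mem_connectedComponentIn hy
  rw [(this.antisymm (connectedComponentIn_subset _ _))]
  exact isPreconnected_connectedComponentIn

/-- The component of an odd point is odd throughout, hence bounded. The component of an even point
contains the whole connected even set, hence all far points. -/
theorem mem_region_iff_of_tame {P : Polygon (ℝ × ℝ) m} (hb : IsPreconnected (P.boundary ℝ))
    (hne : (P.boundary ℝ).Nonempty) (ht : ∀ x ∈ P.boundary ℝ, IsTame P x) (q : ℝ × ℝ) :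
    q ∈ region P ↔ q ∈ P.boundary ℝ ∨ par P q = 1 := by
  have cases2 : ∀ a : ZMod 2, a = 0 ∨ a = 1 := by decide
  simp only [region, mem_union, mem_ofPred_eq]
  by_cases hq : q ∈ P.boundary ℝ
  · simp [hq]
  simp only [hq, false_or, not_false_iff, true_and]
  rcases cases2 (par P q) with h | h
  · simp only [h, zero_ne_one, iff_false]
    intro hbd
    have hsub : evenSet P ⊆ connectedComponentIn (P.boundary ℝ)ᶜ q :=
      (evenSet_subset_component hb hne ht).subset_connectedComponentIn ⟨hq, h⟩ fun z hz => hz.1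
    obtain ⟨R, hR⟩ := exists_box P
    obtain ⟨B, hB⟩ := (hbd.subset hsub).exists_norm_le
    -- A point beyond both the box around the polygon and the supposed bound `B`.
    have hz : ((max R (B + 1), 0) : ℝ × ℝ) ∈ evenSet P :=
      par_eq_zero_of_far hR (Or.inl ((le_max_left _ _).trans (le_abs_self _)))
    have h1 := (norm_fst_le _).trans (hB _ hz)
    have h2 := (le_max_right R (B + 1)).trans (le_abs_self _)
    rw [Real.norm_eq_abs] at h1
    simp only at h1
    linarith
  · simp only [h, iff_true]
    refine isBounded_of_par_eq_one (P := P) fun z hz => ?_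
    rw [← h]
    exact par_eq_of_isPreconnected isPreconnected_connectedComponentIn
      (connectedComponentIn_subset _ _) hz (mem_connectedComponentIn hq)

end MCR

/-! ### Local structure of simple polygons and the Jordan theorem -/

namespace MCR
open Filter Topology Set

variable {m : ℕ}

theorem IsSimple.not_onEdge {P : Polygon (ℝ × ℝ) m} (hP : IsSimple P) {i j : Fin m} {z : ℝ × ℝ}
    (hz : z ∈ openSegment ℝ (P j) (P (finRotate m j))) (hij : i ≠ j) :
    ¬ OnEdge (P i) (P (finRotate m i)) z := by
  obtain ⟨-, hnd, hadj, hdis⟩ := hP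
  intro hi
  have hzj : z ∈ P.edgeSet ℝ j := mem_edgeSet.2 (onEdge_iff.2 (openSegment_subset_segment _ _ _ hz))
  rw [← mem_edgeSet] at hi
  by_cases h1 : i = finRotate m j
  · subst h1
    have : z ∈ ({P (finRotate m j)} : Set (ℝ × ℝ)) := hadj j ▸ ⟨hzj, hi⟩
    rw [mem_singleton_iff] at this
    rw [this, right_mem_openSegment_iff] at hz
    exact hnd j hz
  by_cases h2 : j = finRotate m i
  · have : z ∈ ({P (finRotate m i)} : Set (ℝ × ℝ)) := hadj i ▸ ⟨hi, h2 ▸ hzj⟩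
    rw [mem_singleton_iff, ← h2] at this
    rw [this, left_mem_openSegment_iff] at hz
    exact hnd j hz
  exact disjoint_left.1 (hdis j i hij.symm h1 h2) hzj hi

/-- Two segments leaving `x` in distinct directions look like two rays near `x`. A direction `g`
strictly between them is the sum of the directions if their cross product is positive; if it
vanishes, `hpar` forces opposite directions and a perpendicular one serves. -/
theorem IsSimple.isTame_of_segments {P : Polygon (ℝ × ℝ) m} (hP : IsSimple P) {x a b : ℝ × ℝ}
    (ha : a ≠ x) (hb : b ≠ x)
    (hloc : ∀ᶠ z in 𝓝 x, z ∈ P.boundary ℝ ↔ z ∈ segment ℝ x a ∪ segment ℝ x b)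
    (hpar : ∀ μ : ℝ, 0 < μ → b - x ≠ μ • (a - x))
    (Ha : ∃ j, ∃ c : ℝ, c ≠ 0 ∧ P (finRotate m j) - P j = c • (a - x) ∧
      openSegment ℝ x a ⊆ openSegment ℝ (P j) (P (finRotate m j)))
    (Hb : ∃ j, ∃ c : ℝ, c ≠ 0 ∧ P (finRotate m j) - P j = c • (b - x) ∧
      openSegment ℝ x b ⊆ openSegment ℝ (P j) (P (finRotate m j))) : IsTame P x := by
  wlog h : 0 ≤ cr (a - x) (b - x) generalizing a b with H
  · refine H hb ha (by simpa only [union_comm] using hloc) (fun μ hμ e => ?_) Hb Ha ?_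
    · refine hpar μ⁻¹ (inv_pos.2 hμ) ?_
      rw [e, smul_smul, inv_mul_cancel₀ hμ.ne', one_smul]
    · rw [cr_anti]; linarith
  obtain ⟨g, h1, h2⟩ : ∃ g, 0 < cr (a - x) g ∧ 0 < cr g (b - x) := by
    rcases h.eq_or_lt with h | h
    · set d := a - x with hd
      have hd0 : d ≠ 0 := sub_ne_zero.2 ha
      have hn : 0 < d.1 ^ 2 + d.2 ^ 2 := by
        by_contra hc
        have e1 : d.1 = 0 := by nlinarith [sq_nonneg d.1, sq_nonneg d.2]
        have e2 : d.2 = 0 := by nlinarith [sq_nonneg d.1, sq_nonneg d.2]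
        exact hd0 (Prod.ext e1 e2)
      set e := b - x with he
      have hμ : e = ((d.1 * e.1 + d.2 * e.2) / (d.1 ^ 2 + d.2 ^ 2)) • d := by
        simp only [cr] at h
        ext
        · simp only [Prod.smul_fst, smul_eq_mul]; field_simp; linear_combination d.2 * h
        · simp only [Prod.smul_snd, smul_eq_mul]; field_simp; linear_combination (-d.1) * h
      have hneg : (d.1 * e.1 + d.2 * e.2) / (d.1 ^ 2 + d.2 ^ 2) < 0 := by
        rcases lt_trichotomy ((d.1 * e.1 + d.2 * e.2) / (d.1 ^ 2 + d.2 ^ 2)) 0 with h3 | h3 | h3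
        · exact h3
        · rw [h3, zero_smul] at hμ
          exact absurd (sub_eq_zero.1 hμ) hb
        · exact absurd hμ (hpar _ h3)
      refine ⟨(-d.2, d.1), ?_, ?_⟩
      · simp only [cr]; nlinarith
      · rw [hμ, cr_smul_right]
        have : cr (-d.2, d.1) d = -(d.1 ^ 2 + d.2 ^ 2) := by simp only [cr]; ring
        rw [this]; nlinarith
    · refine ⟨(a - x) + (b - x), ?_, ?_⟩
      · rw [cr_add_right, cr_self, zero_add]; exact h
      · rw [cr_add_left, cr_self, add_zero]; exact h
  obtain ⟨ε, hε, hball⟩ := Metric.eventually_nhds_iff_ball.1 hloc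
  have na : 0 < ‖a - x‖ := norm_pos_iff.2 (sub_ne_zero.2 ha)
  have nb : 0 < ‖b - x‖ := norm_pos_iff.2 (sub_ne_zero.2 hb)
  -- Within this radius the segments coincide with the full rays.
  set δ := min ε (min ‖a - x‖ ‖b - x‖) with hδ
  have hδ0 : 0 < δ := lt_min hε (lt_min na nb)
  have small : ∀ (c : ℝ × ℝ) (s : ℝ), 0 ≤ s → δ ≤ ‖c - x‖ → x + s • (c - x) ∈ Metric.ball x δ →
      x + s • (c - x) ∈ segment ℝ x c := by
    intro c s hs hc hb
    rw [segment_eq_image']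
    refine ⟨s, ⟨hs, ?_⟩, rfl⟩
    rw [mem_ball_iff_norm, add_sub_cancel_left, norm_smul, Real.norm_of_nonneg hs] at hb
    by_contra hs1
    nlinarith [norm_nonneg (c - x)]
  have hray : ∀ z ∈ Metric.ball x δ, z ∈ P.boundary ℝ ↔ z ∈ rays x (a - x) (b - x) := by
    intro z hz
    rw [hball z (Metric.ball_subset_ball (min_le_left _ _) hz)]
    constructor
    · rintro (h | h) <;> rw [segment_eq_image'] at h <;> obtain ⟨s, hs, rfl⟩ := h
      · exact ⟨s, hs.1, Or.inl rfl⟩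
      · exact ⟨s, hs.1, Or.inr rfl⟩
    · rintro ⟨s, hs, rfl | rfl⟩
      · exact Or.inl (small a s hs ((min_le_right _ _).trans (min_le_left _ _)) hz)
      · exact Or.inr (small b s hs ((min_le_right _ _).trans (min_le_right _ _)) hz)
  obtain ⟨j, c, hc, hd, hsub⟩ := Ha
  obtain ⟨s, hs, hs0, hs1⟩ : ∃ s : ℝ, x + s • (a - x) ∈ Metric.ball x δ ∧ 0 < s ∧ s < 1 := by
    have e : ∀ᶠ s : ℝ in 𝓝[>] 0, s < 1 :=
      (eventually_lt_nhds one_pos).filter_mono nhdsWithin_le_nhds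
    have e' : ∀ᶠ s : ℝ in 𝓝[>] 0, 0 < s := self_mem_nhdsWithin
    obtain ⟨s, h3, h4, h5⟩ := (((exists_small_smul x (a - x) hδ0).filter_mono
      nhdsWithin_le_nhds).and (e'.and e)).exists
    exact ⟨s, h3, h4, h5⟩
  have hz : x + s • (a - x) ∈ openSegment ℝ (P j) (P (finRotate m j)) := by
    apply hsub
    rw [openSegment_eq_image']
    exact ⟨s, ⟨hs0, hs1⟩, rfl⟩
  refine isTame_of_rays hδ0 h h1 h2 hray hs0 hs (onEdge_iff.2 (openSegment_subset_segment _ _ _ hz))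
    (fun e => ?_) (fun e => ?_) (fun i hi => hP.not_onEdge hz hi) hc hd
  · rw [e, left_mem_openSegment_iff] at hz
    exact hP.2.1 j hz
  · rw [e, right_mem_openSegment_iff] at hz
    exact hP.2.1 j hz

theorem openSegment_subset_of_mem {v w x : ℝ × ℝ} (hx : x ∈ openSegment ℝ v w) :
    openSegment ℝ x w ⊆ openSegment ℝ v w := by
  rintro z ⟨c, d, hc, hd, hcd, rfl⟩
  obtain ⟨a, b, ha, hb, hab, rfl⟩ := hx
  refine ⟨c * a, c * b + d, by positivity, by positivity, ?_, ?_⟩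
  · linear_combination c * hab + hcd
  · rw [smul_add, smul_smul, smul_smul, add_smul, add_assoc]

theorem mem_segment_split {v w x z : ℝ × ℝ} (hx : x ∈ openSegment ℝ v w) :
    z ∈ segment ℝ v w ↔ z ∈ segment ℝ x w ∪ segment ℝ x v := by
  constructor
  · intro hz
    obtain ⟨t, ⟨ht0, ht1⟩, rfl⟩ := (openSegment_eq_image' ℝ v w) ▸ hx
    obtain ⟨τ, ⟨hτ0, hτ1⟩, rfl⟩ := (segment_eq_image' ℝ v w) ▸ hz
    rcases le_total t τ with h | h
    · left
      rw [segment_eq_image']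
      refine ⟨(τ - t) / (1 - t), ⟨div_nonneg (by linarith) (by linarith), ?_⟩, ?_⟩
      · rw [div_le_one (by linarith)]; linarith
      · have : 1 - t ≠ 0 := by linarith
        ext <;> simp <;> field_simp <;> ring
    · right
      rw [segment_eq_image']
      refine ⟨(t - τ) / t, ⟨div_nonneg (by linarith) (by linarith), ?_⟩, ?_⟩
      · rw [div_le_one (by linarith)]; linarith
      · ext <;> simp <;> field_simp <;> ring
  · have h := openSegment_subset_segment _ _ _ hx
    rintro (hz | hz)
    · exact (convex_segment v w).segment_subset h (right_mem_segment _ _ _) hz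
    · exact (convex_segment v w).segment_subset h (left_mem_segment _ _ _) hz

theorem eventually_not_mem_edges {P : Polygon (ℝ × ℝ) m} {x : ℝ × ℝ} {p : Fin m → Prop}
    (h : ∀ i, p i → ¬ OnEdge (P i) (P (finRotate m i)) x) :
    ∀ᶠ z in 𝓝 x, ∀ i, p i → ¬ OnEdge (P i) (P (finRotate m i)) z := by
  refine eventually_all.2 fun i => ?_
  by_cases hi : p i
  · have := (isClosed_edgeSet P i).isOpen_compl.mem_nhds (fun h' => h i hi (mem_edgeSet.1 h'))
    filter_upwards [this] with z hz _ h'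
    exact hz (mem_edgeSet.2 h')
  · simp [hi]

/-- At a vertex, the boundary is locally its two incident edges, which cannot overlap because they
share only the vertex. At any other point it is locally one edge, which the point divides into two
segments with opposite directions. -/
theorem IsSimple.isTame {P : Polygon (ℝ × ℝ) m} (hP : IsSimple P) {x : ℝ × ℝ}
    (hx : x ∈ P.boundary ℝ) : IsTame P x := by
  obtain ⟨-, hnd, hadj, hdis⟩ := id hP
  obtain ⟨j, hj⟩ := mem_boundary.1 hx
  rw [onEdge_iff] at hj
  have vertex : ∀ j, IsTame P (P j) := by
    intro j
    set k := (finRotate m).symm j with hk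
    have hkj : finRotate m k = j := Equiv.apply_symm_apply _ _
    have hkne : P k ≠ P j := by have := hnd k; rwa [hkj] at this
    have hjk : j ≠ k := fun e => hkne (by rw [← e])
    refine hP.isTame_of_segments (a := P (finRotate m j)) (b := P k) (hnd j).symm hkne ?_ ?_
      ⟨j, 1, one_ne_zero, by simp, subset_rfl⟩ ⟨k, -1, by simp, by simp [hkj], ?_⟩
    · have := eventually_not_mem_edges (P := P) (x := P j) (p := fun i => i ≠ j ∧ i ≠ k) (by
        rintro i ⟨h1, h2⟩ h
        by_cases h3 : i = finRotate m j
        · have h4 : P j ∈ ({P (finRotate m j)} : Set (ℝ × ℝ)) := hadj j ▸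
            ⟨mem_edgeSet.2 (onEdge_iff.2 (left_mem_segment _ _ _)), mem_edgeSet.2 (h3 ▸ h)⟩
          exact hnd j h4
        · refine disjoint_left.1 (hdis i j h1 (fun e => h2 ?_) h3) (mem_edgeSet.2 h)
            (mem_edgeSet.2 (onEdge_iff.2 (left_mem_segment _ _ _)))
          rw [hk, e, Equiv.symm_apply_apply])
      filter_upwards [this] with z hz
      rw [mem_boundary]
      constructor
      · rintro ⟨i, hi⟩
        by_cases h1 : i = j
        · left; rw [← onEdge_iff, ← h1]; exact hi
        by_cases h2 : i = k
        · right; rw [h2, hkj] at hi; rw [segment_symm, ← onEdge_iff]; exact hi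
        exact absurd hi (hz i ⟨h1, h2⟩)
      · rintro (h | h)
        · exact ⟨j, onEdge_iff.2 h⟩
        · exact ⟨k, by rw [hkj, onEdge_iff, segment_symm]; exact h⟩
    · -- the two edges do not overlap
      intro μ hμ e
      have hd : P (finRotate m j) - P j ≠ 0 := sub_ne_zero.2 (hnd j).symm
      -- If the directions agreed, the point at this parameter would lie on both edges and differ
      -- from the vertex.
      set s := min 1 μ with hs
      have hs0 : 0 < s := lt_min one_pos hμ
      have h1 : P j + s • (P (finRotate m j) - P j) ∈ segment ℝ (P j) (P (finRotate m j)) := by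
        rw [segment_eq_image']; exact ⟨s, ⟨hs0.le, min_le_left _ _⟩, rfl⟩
      have h2 : P j + s • (P (finRotate m j) - P j) ∈ segment ℝ (P j) (P k) := by
        rw [segment_eq_image']
        refine ⟨s / μ, ⟨by positivity, ?_⟩, ?_⟩
        · rw [div_le_one hμ]; exact min_le_right _ _
        · simp only [e, smul_smul, div_mul_cancel₀ s hμ.ne']
      have h3 : P j + s • (P (finRotate m j) - P j) ∈ ({P (finRotate m k)} : Set (ℝ × ℝ)) := by
        rw [← hadj k, hkj]
        refine ⟨mem_edgeSet.2 ?_, mem_edgeSet.2 (onEdge_iff.2 h1)⟩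
        rw [hkj, onEdge_iff, segment_symm]; exact h2
      rw [mem_singleton_iff, hkj, add_eq_left, smul_eq_zero] at h3
      exact h3.elim hs0.ne' hd
    · rw [hkj, openSegment_symm]
  by_cases h1 : x = P j
  · rw [h1]; exact vertex j
  by_cases h2 : x = P (finRotate m j)
  · rw [h2]; exact vertex _
  have ho : x ∈ openSegment ℝ (P j) (P (finRotate m j)) :=
    mem_openSegment_of_ne_left_right (Ne.symm h1) (Ne.symm h2) hj
  obtain ⟨t, ⟨ht0, ht1⟩, hxt⟩ := (openSegment_eq_image' ℝ (P j) (P (finRotate m j))) ▸ ho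
  have hd : P (finRotate m j) - P j ≠ 0 := sub_ne_zero.2 (hnd j).symm
  have ew : P (finRotate m j) - x = (1 - t) • (P (finRotate m j) - P j) := by
    rw [← hxt, sub_smul, one_smul]; simp only; abel
  have ev : P j - x = (-t) • (P (finRotate m j) - P j) := by
    rw [← hxt, neg_smul]; simp only; abel
  have h1t : 1 - t ≠ 0 := by linarith
  refine hP.isTame_of_segments (a := P (finRotate m j)) (b := P j) (Ne.symm h2) (Ne.symm h1) ?_ ?_
    ⟨j, (1 - t)⁻¹, inv_ne_zero h1t, ?_, openSegment_subset_of_mem ho⟩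
    ⟨j, (-t)⁻¹, inv_ne_zero (by linarith), ?_, ?_⟩
  · have := eventually_not_mem_edges (P := P) (x := x) (p := fun i => i ≠ j)
      fun i hi => hP.not_onEdge ho hi
    filter_upwards [this] with z hz
    rw [← mem_segment_split ho, ← onEdge_iff, mem_boundary]
    refine ⟨fun ⟨i, hi⟩ => ?_, fun h => ⟨j, h⟩⟩
    by_cases h : i = j
    · exact h ▸ hi
    · exact absurd hi (hz i h)
  · intro μ hμ e
    rw [ev, ew, smul_smul] at e
    have := smul_left_injective ℝ hd e
    nlinarith
  · rw [ew, smul_smul, inv_mul_cancel₀ h1t, one_smul]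
  · rw [ev, smul_smul, inv_mul_cancel₀ (by linarith), one_smul]
  · rw [openSegment_symm ℝ (P j)]
    exact openSegment_subset_of_mem (by rwa [openSegment_symm])

/-- The edges, enumerated by iterating the rotation from index `0`, form a chain in which neighbors
share a vertex. -/
theorem isPreconnected_boundary (P : Polygon (ℝ × ℝ) m) : IsPreconnected (P.boundary ℝ) := by
  rcases m with _ | k
  · rw [Polygon.boundary, iUnion_of_empty]; exact isPreconnected_empty
  have e : P.boundary ℝ = ⋃ n : ℕ, P.edgeSet ℝ ((finRotate (k + 1))^[n] 0) := by
    apply subset_antisymm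
    · refine iUnion_subset fun i => ?_
      have : ∀ n : ℕ, (finRotate (k + 1))^[n] 0 = Fin.ofNat (k + 1) n := by
        intro n
        induction n with
        | zero => simp
        | succ n ih =>
          rw [Function.iterate_succ_apply', ih, finRotate_apply]
          ext; simp [Fin.val_add]
      refine subset_trans ?_ (subset_iUnion _ (i : ℕ))
      rw [this]
      simp
    · exact iUnion_subset fun n => subset_iUnion (fun i => P.edgeSet ℝ i) _
  rw [e]
  refine IsPreconnected.iUnion_of_chain (fun n => ?_) fun n => ?_
  · rw [Polygon.edgeSet, affineSegment_eq_segment]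
    exact (convex_segment _ _).isPreconnected
  · refine ⟨P ((finRotate (k + 1))^[n + 1] 0), ?_, ?_⟩
    · rw [mem_edgeSet, onEdge_iff, Function.iterate_succ_apply']
      exact right_mem_segment _ _ _
    · rw [mem_edgeSet, onEdge_iff]
      exact left_mem_segment ℝ _ _

theorem IsSimple.mem_region_iff {P : Polygon (ℝ × ℝ) m} (hP : IsSimple P) (q : ℝ × ℝ) :
    q ∈ region P ↔ (∃ i, OnEdge (P i) (P (finRotate m i)) q) ∨ par P q = 1 := by
  rw [mem_region_iff_of_tame (isPreconnected_boundary P) ?_ (fun x hx => hP.isTame hx),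
    mem_boundary]
  have : 0 < m := by have := hP.1; omega
  exact ⟨P ⟨0, this⟩, mem_boundary.2 ⟨⟨0, this⟩, onEdge_iff.2 (left_mem_segment _ _ _)⟩⟩

/-- Boundedness is a property of the whole component, and components of the open complement are
open. Closedness is what lets an optimum be pushed onto a curve. -/
theorem isClosed_region (P : Polygon (ℝ × ℝ) m) : IsClosed (region P) := by
  rw [← isOpen_compl_iff, isOpen_iff_mem_nhds]
  intro q hq
  simp only [region, mem_compl_iff, mem_union, mem_ofPred_eq, not_or, not_and] at hq
  obtain ⟨h1, h2⟩ := hq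
  have hm : connectedComponentIn (P.boundary ℝ)ᶜ q ∈ 𝓝 q :=
    (isClosed_boundary P).isOpen_compl.connectedComponentIn.mem_nhds (mem_connectedComponentIn h1)
  filter_upwards [hm] with z hz
  rintro (h | ⟨-, h⟩)
  · exact connectedComponentIn_subset _ _ hz h
  · rw [← connectedComponentIn_eq hz] at h
    exact h2 h1 h

end MCR

/-! ### Hoare rules with time and space bounds -/

namespace RealRAM

instance : Add WExpr := ⟨WExpr.add⟩
instance : Sub WExpr := ⟨WExpr.sub⟩
instance : Mul WExpr := ⟨WExpr.mul⟩
instance : Div WExpr := ⟨WExpr.div⟩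
instance (k : ℕ) : OfNat WExpr k := ⟨WExpr.lit k⟩
instance : Add RExpr := ⟨RExpr.add⟩
instance : Sub RExpr := ⟨RExpr.sub⟩
instance : Mul RExpr := ⟨RExpr.mul⟩
instance : Div RExpr := ⟨RExpr.div⟩
instance (k : ℕ) : OfNat RExpr k := ⟨RExpr.lit k⟩

/-- The integer cell with the fixed address `k`. -/
def wvar (k : ℕ) : WExpr := .cell (.lit k)

section Eval
variable (s : State) (e f : WExpr) (a b : RExpr)

@[simp] theorem WExpr.eval_add : (e + f).eval s = e.eval s + f.eval s := rfl
@[simp] theorem WExpr.eval_sub : (e - f).eval s = e.eval s - f.eval s := rfl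
@[simp] theorem WExpr.eval_mul : (e * f).eval s = e.eval s * f.eval s := rfl
@[simp] theorem WExpr.eval_div : (e / f).eval s = e.eval s / f.eval s := rfl
@[simp] theorem WExpr.eval_cell : (WExpr.cell e).eval s = s.word (e.eval s) := rfl
@[simp] theorem WExpr.eval_lit (k : ℕ) : (WExpr.lit k).eval s = k := rfl
@[simp] theorem WExpr.eval_ofNat (k : ℕ) :
    (no_index (OfNat.ofNat k) : WExpr).eval s = OfNat.ofNat k := rfl
@[simp] theorem eval_wvar (k : ℕ) : (wvar k).eval s = s.word k := rfl
@[simp] theorem RExpr.eval_add : (a + b).eval s = a.eval s + b.eval s := rfl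
@[simp] theorem RExpr.eval_sub : (a - b).eval s = a.eval s - b.eval s := rfl
@[simp] theorem RExpr.eval_mul : (a * b).eval s = a.eval s * b.eval s := rfl
@[simp] theorem RExpr.eval_div : (a / b).eval s = a.eval s / b.eval s := rfl
@[simp] theorem RExpr.eval_cell : (RExpr.cell e).eval s = s.real (e.eval s) := rfl
@[simp] theorem RExpr.eval_arccos : (RExpr.arccos a).eval s = Real.arccos (a.eval s) := rfl
@[simp] theorem RExpr.eval_root (d : ℕ) (c : Fin (d + 1) → RExpr) (k : ℕ) :
    (RExpr.root d c k).eval s = kthRealRoot d (fun i => (c i).eval s) k := rfl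
@[simp] theorem RExpr.eval_ofNat (k : ℕ) :
    (no_index (OfNat.ofNat k) : RExpr).eval s = ((OfNat.ofNat k : ℕ) : ℝ) := by
  change (((k : ℕ) : ℚ) : ℝ) = _
  rw [Rat.cast_natCast]; rfl
@[simp] theorem RExpr.eval_lit (q : ℚ) : (RExpr.lit q).eval s = q := rfl
@[simp] theorem Test.eval_wlt : (Test.wlt e f).eval s ↔ e.eval s < f.eval s := Iff.rfl
@[simp] theorem Test.eval_rlt : (Test.rlt a b).eval s ↔ a.eval s < b.eval s := Iff.rfl
@[simp] theorem Test.eval_not (t : Test) : (Test.not t).eval s ↔ ¬ t.eval s := Iff.rfl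
@[simp] theorem Test.eval_and (t u : Test) : (Test.and t u).eval s ↔ t.eval s ∧ u.eval s := Iff.rfl

end Eval

namespace State
variable (s : State) (a b v : ℕ) (x : ℝ)

@[simp] theorem word_setWord_self : (s.setWord a v).word a = v := by simp [setWord]
theorem word_setWord_of_ne {a b : ℕ} (h : b ≠ a) : (s.setWord a v).word b = s.word b := by
  simp [setWord, h]
theorem word_setWord : (s.setWord a v).word b = if b = a then v else s.word b := by
  simp [setWord, Function.update_apply]
@[simp] theorem real_setWord : (s.setWord a v).real = s.real := rfl
@[simp] theorem word_setReal : (s.setReal a x).word = s.word := rfl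
@[simp] theorem real_setReal_self : (s.setReal a x).real a = x := by simp [setReal]
theorem real_setReal_of_ne {a b : ℕ} (h : b ≠ a) : (s.setReal a x).real b = s.real b := by
  simp [setReal, h]
theorem real_setReal : (s.setReal a x).real b = if b = a then x else s.real b := by
  simp [setReal, Function.update_apply]

variable {s}

theorem Fits.setWord {w : ℕ} (h : s.Fits w) {a v : ℕ} (ha : a < w) (hv : v ≤ w) :
    (s.setWord a v).Fits w := by
  refine ⟨fun j hj => ⟨?_, (h.1 j hj).2⟩, fun j => ?_⟩
  · rw [word_setWord_of_ne _ _ (by omega)]; exact (h.1 j hj).1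
  · rw [word_setWord]; split_ifs
    · exact hv
    · exact h.2 j

theorem Fits.setReal {w : ℕ} (h : s.Fits w) {a : ℕ} (ha : a < w) (x : ℝ) :
    (s.setReal a x).Fits w := by
  refine ⟨fun j hj => ⟨(h.1 j hj).1, ?_⟩, fun j => h.2 j⟩
  rw [real_setReal_of_ne _ _ (by omega)]; exact (h.1 j hj).2

end State

/-- Started in `s`, the program `c` halts within `T` time units and space `w` in a state with the
property `Q`. -/
def Ok (w : ℕ) (c : Program) (s : State) (T : ℕ) (Q : State → Prop) : Prop :=
  ∃ t s', Runs w c s t s' ∧ t ≤ T ∧ Q s'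

namespace Ok
variable {w T U : ℕ} {c d : Program} {s : State} {Q R : State → Prop}

theorem mono (h : Ok w c s T Q) (hT : T ≤ U) (hQ : ∀ s', Q s' → R s') : Ok w c s U R := by
  obtain ⟨t, s', h1, h2, h3⟩ := h
  exact ⟨t, s', h1, h2.trans hT, hQ _ h3⟩

theorem imp (h : Ok w c s T Q) (hQ : ∀ s', Q s' → R s') : Ok w c s T R := h.mono le_rfl hQ

theorem le (h : Ok w c s T Q) (hT : T ≤ U) : Ok w c s U Q := h.mono hT fun _ => id

theorem seq (h : Ok w c s T Q) (h' : ∀ s', Q s' → Ok w d s' U R) :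
    Ok w (.seq c d) s (T + U) R := by
  obtain ⟨t, s', h1, h2, h3⟩ := h
  obtain ⟨u, s'', h4, h5, h6⟩ := h' _ h3
  exact ⟨t + u, s'', .seq h1 h4, by omega, h6⟩

theorem skip (h : s.Fits w) (hQ : Q s) : Ok w .skip s 1 Q := ⟨1, s, .skip h, le_rfl, hQ⟩

theorem wset {e f : WExpr} (h : s.Fits w) (ha : e.eval s < w) (hv : f.eval s ≤ w)
    (hQ : (s.setWord (e.eval s) (f.eval s)).Fits w → Q (s.setWord (e.eval s) (f.eval s))) :
    Ok w (.wset e f) s (e.cost + f.cost + 1) Q :=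
  ⟨_, _, .wset h (h.setWord ha hv), le_rfl, hQ (h.setWord ha hv)⟩

theorem rset {e : WExpr} {f : RExpr} (h : s.Fits w) (ha : e.eval s < w)
    (hQ : (s.setReal (e.eval s) (f.eval s)).Fits w → Q (s.setReal (e.eval s) (f.eval s))) :
    Ok w (.rset e f) s (e.cost + f.cost + 1) Q :=
  ⟨_, _, .rset h (h.setReal ha _), le_rfl, hQ (h.setReal ha _)⟩

theorem ite {b : Test} (h : b.eval s → Ok w c s T Q) (h' : ¬ b.eval s → Ok w d s U Q) :
    Ok w (.ite b c d) s (b.cost + max T U) Q := by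
  by_cases hb : b.eval s
  · obtain ⟨t, s', h1, h2, h3⟩ := h hb
    exact ⟨_, s', .iteTrue hb h1, by omega, h3⟩
  · obtain ⟨t, s', h1, h2, h3⟩ := h' hb
    exact ⟨_, s', .iteFalse hb h1, by omega, h3⟩

/-- The invariant is indexed by the number of completed rounds. Since that number is prescribed, one
rule gives termination, the postcondition and the time bound; the final failing test accounts for
the last summand. -/
theorem loop {b : Test} {N : ℕ} {I : ℕ → State → Prop}
    (hstep : ∀ k < N, ∀ s, I k s → b.eval s ∧ Ok w c s T (I (k + 1)))
    (hend : ∀ s, I N s → ¬ b.eval s ∧ s.Fits w) (h : I 0 s) :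
    Ok w (.loop b c) s (N * (b.cost + T) + b.cost) (I N) := by
  suffices H : ∀ n k s, k + n = N → I k s → Ok w (.loop b c) s (n * (b.cost + T) + b.cost) (I N) from
    H N 0 s (by omega) h
  intro n
  induction n with
  | zero =>
    intro k s hk hs
    obtain rfl : k = N := by omega
    exact ⟨_, s, .loopFalse (hend s hs).1 (hend s hs).2, by omega, hs⟩
  | succ n ih =>
    intro k s hk hs
    obtain ⟨hb, t, s', h1, h2, h3⟩ := hstep k (by omega) s hs
    obtain ⟨u, s'', h4, h5, h6⟩ := ih (k + 1) s' (by omega) h3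
    refine ⟨_, s'', .loopTrue hb h1 h4, ?_, h6⟩
    rw [Nat.succ_mul]; omega

end Ok

/-- The running time of a program without loops. -/
def Program.time : Program → ℕ
  | skip => 1
  | wset e f => e.cost + f.cost + 1
  | rset e f => e.cost + f.cost + 1
  | seq c d => c.time + d.time
  | ite b c d => b.cost + max c.time d.time
  | loop b _ => b.cost

/-- A version of `Ok` for programs without loops. -/
def Straight (w : ℕ) (c : Program) (s : State) (Q : State → Prop) : Prop := Ok w c s c.time Q

namespace Straight
variable {w : ℕ} {c d : Program} {s : State} {Q R : State → Prop}

theorem ok (h : Straight w c s Q) : Ok w c s c.time Q := h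

theorem imp (h : Straight w c s Q) (hQ : ∀ s', Q s' → R s') : Straight w c s R := Ok.imp h hQ

theorem seq (h : Straight w c s fun s' => Straight w d s' Q) : Straight w (.seq c d) s Q :=
  Ok.seq h fun _ h' => h'

theorem skip (h : s.Fits w) (hQ : Q s) : Straight w .skip s Q := Ok.skip h hQ

theorem wset {e f : WExpr} (h : s.Fits w) (ha : e.eval s < w) (hv : f.eval s ≤ w)
    (hQ : (s.setWord (e.eval s) (f.eval s)).Fits w → Q (s.setWord (e.eval s) (f.eval s))) :
    Straight w (.wset e f) s Q := Ok.wset h ha hv hQ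

theorem rset {e : WExpr} {f : RExpr} (h : s.Fits w) (ha : e.eval s < w)
    (hQ : (s.setReal (e.eval s) (f.eval s)).Fits w → Q (s.setReal (e.eval s) (f.eval s))) :
    Straight w (.rset e f) s Q := Ok.rset h ha hQ

theorem ite {b : Test} (h : b.eval s → Straight w c s Q) (h' : ¬ b.eval s → Straight w d s Q) :
    Straight w (.ite b c d) s Q := Ok.ite h h'

end Straight

/-- `for x := 0, …, bound - 1 do c` -/
def Program.for (x : ℕ) (bound : WExpr) (c : Program) : Program :=
  .seq (.wset (.lit x) 0) (.loop (.wlt (wvar x) bound) (.seq c (.wset (.lit x) (wvar x + 1))))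

/-- The hypothesis `hx'` makes the invariant insensitive to the counter cell, so the invariant
survives its increment; the body has to preserve the counter. -/
theorem Ok.for {w T N x : ℕ} {bound : WExpr} {c : Program} {s : State} {I : ℕ → State → Prop}
    (hx : x < w) (hN : N ≤ w) (hF : s.Fits w) (hI : ∀ k s, I k s → s.Fits w ∧ bound.eval s = N)
    (hx' : ∀ k s v, I k s → v ≤ w → I k (s.setWord x v))
    (h0 : I 0 (s.setWord x 0))
    (hstep : ∀ k < N, ∀ s, I k s → s.word x = k →
      Ok w c s T (fun s' => s'.word x = k ∧ I (k + 1) s')) :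
    Ok w (.for x bound c) s ((bound.cost + T + 12) * (N + 1))
      (fun s' => s'.word x = N ∧ I N s') := by
  -- Clearing the counter costs 3, a test `bound.cost + 3`, and an increment 6.
  refine Ok.le (U := (bound.cost + T + 12) * (N + 1))
    (T := 3 + (N * (bound.cost + 9 + T) + (bound.cost + 3))) ?_ (by ring_nf; omega)
  refine Ok.seq (Q := fun s' => s'.word x = 0 ∧ I 0 s') (Ok.le (Ok.wset hF hx (Nat.zero_le _)
    fun _ => ⟨by simp, h0⟩) (by simp [WExpr.cost, OfNat.ofNat])) fun s' hs' => ?_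
  refine Ok.le (Ok.loop (N := N) (T := T + 6) (I := fun k s => s.word x = k ∧ I k s)
    (fun k hk s hs => ⟨by simp [(hI k s hs.2).2, hs.1, hk], ?_⟩)
    (fun s hs => ⟨by simp [(hI N s hs.2).2, hs.1], (hI N s hs.2).1⟩) hs') ?_
  · refine Ok.seq (hstep k hk s hs.2 hs.1) fun s1 h1 => ?_
    refine Ok.le (Ok.wset (hI _ _ h1.2).1 hx (by simp [h1.1]; omega) fun _ => ⟨by simp [h1.1], ?_⟩)
      (by simp [WExpr.cost, wvar, OfNat.ofNat])
    exact hx' _ _ _ h1.2 (by simp [h1.1]; omega)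
  · simp only [Test.cost, WExpr.cost, wvar]
    ring_nf; omega

end RealRAM

namespace RealRAM

/-! ### Merging -/

/-- `a` lists all of `0, …, L - 1`, and its blocks of length `W` are sorted by `key`. -/
structure BlockSorted (L W : ℕ) (key : ℕ → ℝ) (a : ℕ → ℕ) : Prop where
  range : ∀ x < L, a x < L
  surj : ∀ e < L, ∃ x < L, a x = e
  sorted : ∀ x, x + 1 < L → ¬ W ∣ x + 1 → key (a x) ≤ key (a (x + 1))

/-- The first `k` entries of `b` result from merging pairs of blocks of `a`. -/
structure Merged (L W : ℕ) (key : ℕ → ℝ) (a b : ℕ → ℕ) (k : ℕ) : Prop where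
  copied : ∀ x < k, ∃ y < k, b y = a x
  range : ∀ y < k, b y < L
  sorted : ∀ x, x + 1 < k → ¬ 2 * W ∣ x + 1 → key (b x) ≤ key (b (x + 1))
  aligned : 2 * W ∣ k ∨ k = L

/-- The first `k` entries of `b` are filled; the blocks from `lo` to `mid` and from `mid` to `hi`
are being merged, and their entries before `i` and `j` have been used. -/
structure Merging (L W : ℕ) (key : ℕ → ℝ) (a b : ℕ → ℕ) (k mid hi i j lo : ℕ) : Prop where
  copied : ∀ x, x < i ∨ (mid ≤ x ∧ x < j) → ∃ y < k, b y = a x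
  range : ∀ y < k, b y < L
  sorted : ∀ x, x + 1 < k → ¬ 2 * W ∣ x + 1 → key (b x) ≤ key (b (x + 1))
  dvd : 2 * W ∣ lo
  lo_le : lo ≤ k
  k_le : k ≤ hi
  mid_eq : mid = min (lo + W) L
  hi_eq : hi = min (lo + 2 * W) L
  lo_i : lo ≤ i
  i_mid : i ≤ mid
  mid_j : mid ≤ j
  j_hi : j ≤ hi
  total : i + j = k + mid
  last_i : lo < k → i < mid → key (b (k - 1)) ≤ key (a i)
  last_j : lo < k → j < hi → key (b (k - 1)) ≤ key (a j)

variable {L W : ℕ} {key : ℕ → ℝ} {a b b' : ℕ → ℕ} {k mid hi i j lo : ℕ}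

theorem Merged.start (h : Merged L W key a b k) (hk : k < L) :
    Merging L W key a b k (min (k + W) L) (min (k + 2 * W) L) k (min (k + W) L) k where
  copied x hx := h.copied x (by omega)
  range := h.range
  sorted := h.sorted
  dvd := h.aligned.resolve_right hk.ne
  lo_le := le_rfl
  k_le := by omega
  mid_eq := rfl
  hi_eq := rfl
  lo_i := le_rfl
  i_mid := by omega
  mid_j := le_rfl
  j_hi := by omega
  total := by omega
  last_i h := absurd h (lt_irrefl _)
  last_j h := absurd h (lt_irrefl _)

theorem Merging.finish (h : Merging L W key a b hi mid hi i j lo) : Merged L W key a b hi where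
  copied x hx := h.copied x (by have := h.total; have := h.i_mid; have := h.j_hi; omega)
  range := h.range
  sorted := h.sorted
  aligned := by
    have e := h.hi_eq
    rcases min_choice (lo + 2 * W) L with h' | h' <;> rw [h'] at e
    · left; rw [e]; exact (Nat.dvd_add h.dvd dvd_rfl)
    · right; exact e

theorem not_dvd_of_between {W lo x : ℕ} (h : W ∣ lo) (h1 : lo < x) (h2 : x < lo + W) : ¬ W ∣ x := by
  rintro ⟨d, rfl⟩
  obtain ⟨c, rfl⟩ := h
  have e1 : c < d := lt_of_mul_lt_mul_left h1 (Nat.zero_le _)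
  have e2 : W * (c + 1) ≤ W * d := Nat.mul_le_mul_left _ e1
  rw [Nat.mul_add, mul_one] at e2
  omega

/-- The output stays sorted because its last entry is at most the next entry of either run: for the
left run by sortedness inside the block, for the right run by the comparison just made. -/
theorem Merging.takeLeft (h : Merging L W key a b k mid hi i j lo) (ha : BlockSorted L W key a)
    (hi' : i < mid) (hc : j < hi → key (a i) ≤ key (a j)) (hb : b' k = a i)
    (hb' : ∀ y, y ≠ k → b' y = b y) : Merging L W key a b' (k + 1) mid hi (i + 1) j lo := by
  have h1 := h.lo_le; have h2 := h.k_le; have h3 := h.mid_eq; have h4 := h.hi_eq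
  have h5 := h.lo_i; have h6 := h.mid_j; have h7 := h.j_hi; have h8 := h.total
  have hd : W ∣ lo := dvd_trans (Dvd.intro_left 2 rfl) h.dvd
  constructor
  · intro x hx
    by_cases e : x = i
    · exact ⟨k, by omega, by rw [hb, e]⟩
    · obtain ⟨y, hy, hy'⟩ := h.copied x (by omega)
      exact ⟨y, by omega, by rw [hb' y (by omega), hy']⟩
  · intro y hy
    by_cases e : y = k
    · rw [e, hb]; exact ha.range i (by omega)
    · rw [hb' y e]; exact h.range y (by omega)
  · intro x hx hxd
    rw [hb' x (by omega)]
    by_cases e : x + 1 = k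
    · rw [e, hb]
      -- At `k = lo` a new output block starts, where no comparison with the predecessor is
      -- required.
      have : lo < k := by
        by_contra hlo
        exact hxd (by rw [e, show k = lo by omega]; exact h.dvd)
      have := h.last_i this hi'
      rwa [show k - 1 = x by omega] at this
    · rw [hb' _ e]; exact h.sorted x (by omega) hxd
  · exact h.dvd
  · omega
  · omega
  · exact h3
  · exact h4
  · omega
  · omega
  · omega
  · omega
  · omega
  · intro _ hm
    rw [Nat.add_sub_cancel, hb]
    exact ha.sorted i (by omega) (not_dvd_of_between hd (by omega) (by omega))
  · intro _ hm
    rw [Nat.add_sub_cancel, hb]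
    exact hc hm

theorem Merging.takeRight (h : Merging L W key a b k mid hi i j lo) (ha : BlockSorted L W key a)
    (hk : k < hi) (hc : i < mid → j < hi ∧ key (a j) ≤ key (a i)) (hb : b' k = a j)
    (hb' : ∀ y, y ≠ k → b' y = b y) : Merging L W key a b' (k + 1) mid hi i (j + 1) lo := by
  have h1 := h.lo_le; have h2 := h.k_le; have h3 := h.mid_eq; have h4 := h.hi_eq
  have h5 := h.lo_i; have h6 := h.mid_j; have h7 := h.j_hi; have h8 := h.total; have h9 := h.i_mid
  have hd : W ∣ lo := dvd_trans (Dvd.intro_left 2 rfl) h.dvd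
  have hj : j < hi := by
    by_cases e : i < mid
    · exact (hc e).1
    · omega
  constructor
  · intro x hx
    by_cases e : x = j
    · exact ⟨k, by omega, by rw [hb, e]⟩
    · obtain ⟨y, hy, hy'⟩ := h.copied x (by omega)
      exact ⟨y, by omega, by rw [hb' y (by omega), hy']⟩
  · intro y hy
    by_cases e : y = k
    · rw [e, hb]; exact ha.range j (by omega)
    · rw [hb' y e]; exact h.range y (by omega)
  · intro x hx hxd
    rw [hb' x (by omega)]
    by_cases e : x + 1 = k
    · rw [e, hb]
      have : lo < k := by
        by_contra hlo
        exact hxd (by rw [e, show k = lo by omega]; exact h.dvd)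
      have := h.last_j this hj
      rwa [show k - 1 = x by omega] at this
    · rw [hb' _ e]; exact h.sorted x (by omega) hxd
  · exact h.dvd
  · omega
  · omega
  · exact h3
  · exact h4
  · omega
  · omega
  · omega
  · omega
  · omega
  · intro _ hm
    rw [Nat.add_sub_cancel, hb]
    exact (hc hm).2
  · intro _ hm
    rw [Nat.add_sub_cancel, hb]
    -- A right run that continues is nonempty, so `mid` is not cut off by `L` and the run starts at
    -- a block boundary.
    have hmid : mid = lo + W := by omega
    exact ha.sorted j (by omega) (not_dvd_of_between (W := W) (lo := mid)
      (by rw [hmid]; exact Nat.dvd_add hd dvd_rfl) (by omega) (by omega))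

theorem Merged.blockSorted (h : Merged L W key a b L) (ha : BlockSorted L W key a) :
    BlockSorted L (2 * W) key b where
  range := h.range
  surj e he := by
    obtain ⟨x, hx, rfl⟩ := ha.surj e he
    exact h.copied x hx
  sorted := h.sorted

/-! ### The sorting program -/

namespace Prog

/-- The entry of the array of indices with index `e`. -/
def idx (e : WExpr) : WExpr := .cell (64 + 8 * e)
-- Integer cells below 64 are scalars. Above them eight arrays are interleaved, entry `x` of array
-- `r` being cell `64 + r + 8x`, so that no base address depends on the input. Array 1 is the buffer
-- of the merge.
def tmp (e : WExpr) : WExpr := .cell (65 + 8 * e)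
/-- The value with index `e`. -/
def val (e : WExpr) : RExpr := .cell (wvar 2 + 64 + e)

/-- One step of a merging pass; the cells are 10: length, 11: block length, 12: number of entries
written, 13: middle and 14: end of the current pair of blocks, 15 and 16: next entries to use. -/
def mergeStart : Program :=
  .ite (.wlt (wvar 12) (wvar 14)) .skip
    (.seq (.wset (.lit 13) (wvar 12 + wvar 11)) (.seq
      (.ite (.wlt (wvar 10) (wvar 13)) (.wset (.lit 13) (wvar 10)) .skip) (.seq
      (.wset (.lit 14) (wvar 12 + 2 * wvar 11)) (.seq
      (.ite (.wlt (wvar 10) (wvar 14)) (.wset (.lit 14) (wvar 10)) .skip) (.seq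
      (.wset (.lit 15) (wvar 12)) (.wset (.lit 16) (wvar 13)))))))

/-- The left entry is taken unless the right run has a strictly smaller one. Both parts of a
conjunction are evaluated, so a comparison may involve an entry past an exhausted run; its outcome
is then irrelevant. -/
def mergeTake : Program :=
  .ite (.and (.wlt (wvar 15) (wvar 13))
      (.not (.and (.wlt (wvar 16) (wvar 14)) (.rlt (val (idx (wvar 16))) (val (idx (wvar 15)))))))
    (.seq (.wset (65 + 8 * wvar 12) (idx (wvar 15))) (.wset (.lit 15) (wvar 15 + 1)))
    (.seq (.wset (65 + 8 * wvar 12) (idx (wvar 16))) (.wset (.lit 16) (wvar 16 + 1)))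

/-- A single loop writes one entry per round and opens a new pair of blocks whenever the previous
one is used up, so a pass is linear whatever the block length. The end marker `0` makes the first
round open a pair. -/
def mergePass : Program :=
  .seq (.wset (.lit 14) 0) (.for 12 (wvar 10) (.seq mergeStart mergeTake))

def copyBack : Program := .for 12 (wvar 10) (.wset (64 + 8 * wvar 12) (tmp (wvar 12)))

def initIdx : Program := .for 12 (wvar 10) (.wset (64 + 8 * wvar 12) (wvar 12))

/-- Sort the array of indices by value. -/
def sort : Program :=
  .seq initIdx (.seq (.wset (.lit 11) 1) (.loop (.wlt (wvar 11) (wvar 10))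
    (.seq mergePass (.seq copyBack (.wset (.lit 11) (2 * wvar 11))))))

end Prog

/-- The cells that sorting may change: the scalars 11 to 16, and the arrays 0 and 1. -/
def SortFrame (s s' : State) : Prop :=
  s'.real = s.real ∧ ∀ x, (x < 11 ∨ (16 < x ∧ x < 64) ∨ (64 ≤ x ∧ 2 ≤ x % 8)) → s'.word x = s.word x

theorem SortFrame.refl (s : State) : SortFrame s s := ⟨rfl, fun _ _ => rfl⟩

theorem SortFrame.trans {s s' s'' : State} (h : SortFrame s s') (h' : SortFrame s' s'') :
    SortFrame s s'' :=
  ⟨h'.1.trans h.1, fun x hx => (h'.2 x hx).trans (h.2 x hx)⟩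

theorem SortFrame.setWord {s s' : State} (h : SortFrame s s') {x v : ℕ}
    (hx : (11 ≤ x ∧ x ≤ 16) ∨ (64 ≤ x ∧ x % 8 < 2)) : SortFrame s (s'.setWord x v) :=
  ⟨h.1, fun y hy => by rw [State.word_setWord_of_ne _ _ (by omega)]; exact h.2 y hy⟩

def idxOf (s : State) (x : ℕ) : ℕ := s.word (64 + 8 * x)
def tmpOf (s : State) (x : ℕ) : ℕ := s.word (65 + 8 * x)
def valOf (s : State) (x : ℕ) : ℝ := s.real (s.word 2 + 64 + x)

@[simp] theorem eval_idx (s : State) (e : WExpr) : (Prog.idx e).eval s = idxOf s (e.eval s) := rfl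
@[simp] theorem eval_tmp (s : State) (e : WExpr) : (Prog.tmp e).eval s = tmpOf s (e.eval s) := rfl
@[simp] theorem eval_val (s : State) (e : WExpr) : (Prog.val e).eval s = valOf s (e.eval s) := rfl

theorem SortFrame.valOf {s s' : State} (h : SortFrame s s') : valOf s' = valOf s := by
  funext x; simp only [RealRAM.valOf, h.1, h.2 2 (by omega)]

theorem idxOf_setWord_scalar {s : State} {a v : ℕ} (h : a < 64) :
    idxOf (s.setWord a v) = idxOf s := by
  funext x; exact State.word_setWord_of_ne _ _ (by omega)

theorem tmpOf_setWord_scalar {s : State} {a v : ℕ} (h : a < 64) :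
    tmpOf (s.setWord a v) = tmpOf s := by
  funext x; exact State.word_setWord_of_ne _ _ (by omega)

theorem idxOf_setWord_tmp {s : State} {x v : ℕ} : idxOf (s.setWord (65 + 8 * x) v) = idxOf s := by
  funext x; exact State.word_setWord_of_ne _ _ (by omega)

theorem tmpOf_setWord_idx {s : State} {x v : ℕ} : tmpOf (s.setWord (64 + 8 * x) v) = tmpOf s := by
  funext x; exact State.word_setWord_of_ne _ _ (by omega)

/-- Here and later, `K` is quantified before everything else: it depends on the program text alone.
The placeholder for it is filled in by the bound in `Ok.for`. -/
theorem ok_initIdx : ∃ K, ∀ (w L : ℕ) (s : State), s.Fits w → s.word 10 = L → 64 + 8 * L + 8 ≤ w →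
    Ok w Prog.initIdx s (K * (L + 1)) (fun s' => s'.Fits w ∧ SortFrame s s' ∧
      BlockSorted L 1 (valOf s) (idxOf s')) := by
  refine ⟨_, fun w L s hs hL hw => ((Ok.for (N := L)
    (T := (Program.wset (64 + 8 * wvar 12) (wvar 12)).time)
    (I := fun k s' => s'.Fits w ∧ SortFrame s s' ∧ ∀ x < k, idxOf s' x = x) (by omega) (by omega) hs
    ?_ ?_ ?_ ?_).imp ?_)⟩
  · rintro k s' ⟨h1, h2, -⟩
    exact ⟨h1, by rw [eval_wvar, h2.2 10 (by omega), hL]⟩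
  · rintro k s' v ⟨h1, h2, h3⟩ hv
    exact ⟨h1.setWord (by omega) hv, h2.setWord (by omega), by
      rwa [idxOf_setWord_scalar (by omega)]⟩
  · exact ⟨hs.setWord (by omega) (by omega), (SortFrame.refl s).setWord (by omega), by simp⟩
  · rintro k hk s' ⟨h1, h2, h3⟩ hk'
    refine Ok.wset h1 (by simp [hk']; omega) (by simp [hk']; omega) fun hF => ?_
    simp only [WExpr.eval_add, WExpr.eval_mul, WExpr.eval_ofNat, eval_wvar, hk'] at hF ⊢
    refine ⟨by rw [State.word_setWord_of_ne _ _ (by omega), hk'], hF, h2.setWord (by omega), ?_⟩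
    intro x hx
    by_cases e : x = k
    · rw [e]; simp [idxOf]
    · rw [idxOf, State.word_setWord_of_ne _ _ (by omega)]; exact h3 x (by omega)
  · rintro s' ⟨-, h1, h2, h3⟩
    refine ⟨h1, h2, ⟨fun x hx => (h3 x hx).symm ▸ hx, fun e he => ⟨e, he, h3 e he⟩, ?_⟩⟩
    simp

theorem ok_copyBack : ∃ K, ∀ (w L W : ℕ) (key : ℕ → ℝ) (s : State), s.Fits w → s.word 10 = L →
    64 + 8 * L + 8 ≤ w → BlockSorted L W key (tmpOf s) →
    Ok w Prog.copyBack s (K * (L + 1)) (fun s' => s'.Fits w ∧ SortFrame s s' ∧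
      s'.word 11 = s.word 11 ∧ BlockSorted L W key (idxOf s')) := by
  refine ⟨_, fun w L W key s hs hL hw hB => ((Ok.for (N := L)
    (T := (Program.wset (64 + 8 * wvar 12) (Prog.tmp (wvar 12))).time)
    (I := fun k s' => s'.Fits w ∧ SortFrame s s' ∧ s'.word 11 = s.word 11 ∧ tmpOf s' = tmpOf s ∧
      ∀ x < k, idxOf s' x = tmpOf s x) (by omega) (by omega) hs
    ?_ ?_ ?_ ?_).imp ?_)⟩
  · rintro k s' ⟨h1, h2, -⟩
    exact ⟨h1, by rw [eval_wvar, h2.2 10 (by omega), hL]⟩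
  · rintro k s' v ⟨h1, h2, h3, h4, h5⟩ hv
    exact ⟨h1.setWord (by omega) hv, h2.setWord (by omega), by simp [State.word_setWord, h3], by
      rw [tmpOf_setWord_scalar (by omega), h4], by rwa [idxOf_setWord_scalar (by omega)]⟩
  · exact ⟨hs.setWord (by omega) (by omega), (SortFrame.refl s).setWord (by omega),
      by simp [State.word_setWord], tmpOf_setWord_scalar (by omega), by simp⟩
  · rintro k hk s' ⟨h1, h2, h3, h4, h5⟩ hk'
    have := hB.range k hk
    refine Ok.wset h1 (by simp [hk']; omega) (by simp [hk', h4]; omega) fun hF => ?_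
    simp only [WExpr.eval_add, WExpr.eval_mul, WExpr.eval_ofNat, eval_wvar, hk', eval_tmp, h4]
      at hF ⊢
    refine ⟨by rw [State.word_setWord_of_ne _ _ (by omega), hk'], hF, h2.setWord (by omega),
      by rw [State.word_setWord_of_ne _ _ (by omega), h3], by rw [tmpOf_setWord_idx, h4], ?_⟩
    intro x hx
    by_cases e : x = k
    · rw [e]; simp [idxOf]
    · rw [idxOf, State.word_setWord_of_ne _ _ (by omega)]; exact h5 x (by omega)
  · rintro s' ⟨-, h1, h2, h3, h4, h5⟩
    refine ⟨h1, h2, h3, ⟨fun x hx => by rw [h5 x hx]; exact hB.range x hx, fun e he => ?_, ?_⟩⟩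
    · obtain ⟨x, hx, rfl⟩ := hB.surj e he
      exact ⟨x, hx, h5 x hx⟩
    · intro x hx hd
      rw [h5 _ hx, h5 _ (by omega)]
      exact hB.sorted x hx hd

/-- The part of the memory that a step of a merging pass preserves. -/
structure MergeCtx (w L W : ℕ) (s₀ s : State) (k : ℕ) : Prop where
  fits : s.Fits w
  frame : SortFrame s₀ s
  idx : idxOf s = idxOf s₀
  width : s.word 11 = W
  pos : s.word 12 = k

/-- A pass is either between two pairs of blocks or in the middle of one. -/
def PassInv (L W : ℕ) (s₀ s : State) (k : ℕ) : Prop :=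
  (k = s.word 14 ∧ Merged L W (valOf s₀) (idxOf s₀) (tmpOf s) k) ∨
    (k < s.word 14 ∧ ∃ lo, Merging L W (valOf s₀) (idxOf s₀) (tmpOf s) k (s.word 13) (s.word 14)
      (s.word 15) (s.word 16) lo)

theorem straight_mergeStart {w L W : ℕ} {s₀ s : State} {k : ℕ} (hc : MergeCtx w L W s₀ s k)
    (hL : s₀.word 10 = L) (hw : 64 + 8 * L + 8 ≤ w) (hW0 : 0 < W) (hW : W < L) (hk : k < L)
    (h : PassInv L W s₀ s k) :
    Straight w Prog.mergeStart s (fun s' => MergeCtx w L W s₀ s' k ∧ k < s'.word 14 ∧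
      ∃ lo, Merging L W (valOf s₀) (idxOf s₀) (tmpOf s') k (s'.word 13) (s'.word 14)
        (s'.word 15) (s'.word 16) lo) := by
  obtain ⟨h1, h2, h3, h4, h5⟩ := hc
  have hL' : s.word 10 = L := by rw [h2.2 10 (by omega), hL]
  refine Straight.ite (fun hb => ?_) (fun hb => ?_)
  · simp only [Test.eval_wlt, eval_wvar, h5] at hb
    exact Straight.skip h1 ⟨⟨h1, h2, h3, h4, h5⟩, hb, (h.resolve_left (by omega)).2⟩
  · simp only [Test.eval_wlt, eval_wvar, h5] at hb
    obtain ⟨-, hM⟩ := h.resolve_right (by omega)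
    have hM' := hM.start hk
    have key : ∀ s' : State, s'.Fits w → SortFrame s₀ s' → idxOf s' = idxOf s₀ →
        tmpOf s' = tmpOf s → s'.word 11 = W → s'.word 12 = k → s'.word 13 = min (k + W) L →
        s'.word 14 = min (k + 2 * W) L → s'.word 15 = k → s'.word 16 = min (k + W) L →
        MergeCtx w L W s₀ s' k ∧ k < s'.word 14 ∧
      ∃ lo, Merging L W (valOf s₀) (idxOf s₀) (tmpOf s') k (s'.word 13) (s'.word 14)
        (s'.word 15) (s'.word 16) lo := by
      intro s' g1 g2 g3 g4 g5 g6 g7 g8 g9 g10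
      refine ⟨⟨g1, g2, g3, g5, g6⟩, by omega, k, ?_⟩
      rw [g4, g7, g8, g9, g10]; exact hM'
    have fr : ∀ {s' : State} {x v : ℕ}, 11 ≤ x → x ≤ 16 → SortFrame s₀ s' →
        SortFrame s₀ (s'.setWord x v) := fun a b h => h.setWord (Or.inl ⟨a, b⟩)
    refine Straight.seq (Straight.wset h1 (by simp; omega) (by simp [h4, h5]; omega) fun F1 => ?_)
    simp only [WExpr.eval_add, eval_wvar, WExpr.eval_lit, h4, h5] at F1 ⊢
    -- Both branches end in the same explicit state, in which the cell holds the minimum with the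
    -- length.
    refine Straight.seq (Straight.imp (Q := fun s' => s'.Fits w ∧
      s' = (s.setWord 13 (k + W)).setWord 13 (min (k + W) L)) (Straight.ite (fun hb => ?_)
      fun hb => ?_) ?_)
    · simp [State.word_setWord, hL'] at hb
      refine Straight.wset F1 (by simp; omega) (by simp [State.word_setWord, hL']; omega)
        fun F2 => ⟨F2, ?_⟩
      simp [State.word_setWord, hL', min_eq_right hb.le]
    · simp [State.word_setWord, hL'] at hb
      refine Straight.skip F1 ⟨F1, ?_⟩
      simp [State.setWord, hb]
    rintro _ ⟨F2, rfl⟩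
    refine Straight.seq (Straight.wset F2 (by simp; omega)
      (by simp [h4, h5, State.word_setWord]; omega) fun F3 => ?_)
    simp only [WExpr.eval_add, WExpr.eval_mul, WExpr.eval_ofNat, eval_wvar, WExpr.eval_lit,
      State.word_setWord, Nat.reduceEqDiff, if_false, h4, h5] at F3 ⊢
    refine Straight.seq (Straight.imp (Q := fun s' => s'.Fits w ∧
      s' = (((s.setWord 13 (k + W)).setWord 13 (min (k + W) L)).setWord 14
        (k + 2 * W)).setWord 14 (min (k + 2 * W) L)) (Straight.ite (fun hb => ?_)
      fun hb => ?_) ?_)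
    · simp [State.word_setWord, hL'] at hb
      refine Straight.wset F3 (by simp; omega) (by simp [State.word_setWord, hL']; omega)
        fun F2 => ⟨F2, ?_⟩
      simp [State.word_setWord, hL', min_eq_right hb.le]
    · simp [State.word_setWord, hL'] at hb
      refine Straight.skip F3 ⟨F3, ?_⟩
      simp [State.setWord, hb]
    rintro _ ⟨F4, rfl⟩
    refine Straight.seq (Straight.wset F4 (by simp; omega)
      (by simp [h5, State.word_setWord]; omega) fun F5 => ?_)
    refine Straight.wset F5 (by simp; omega)
      (by simp [h5, State.word_setWord]; omega) fun F6 => ?_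
    refine key _ F6 (fr (by simp) (by simp) (fr (by simp) (by simp) (fr (by simp) (by simp)
      (fr (by simp) (by simp) (fr (by simp) (by simp) (fr (by simp) (by simp) h2)))))) ?_ ?_
      ?_ ?_ ?_ ?_ ?_ ?_
    all_goals simp [idxOf_setWord_scalar, tmpOf_setWord_scalar, State.word_setWord, h3, h4, h5]

theorem straight_mergeTake {w L W : ℕ} {s₀ s : State} {k lo : ℕ} (hc : MergeCtx w L W s₀ s k)
    (hw : 64 + 8 * L + 8 ≤ w) (hB : BlockSorted L W (valOf s₀) (idxOf s₀))
    (hk : k < s.word 14)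
    (h : Merging L W (valOf s₀) (idxOf s₀) (tmpOf s) k (s.word 13) (s.word 14)
        (s.word 15) (s.word 16) lo) :
    Straight w Prog.mergeTake s (fun s' => MergeCtx w L W s₀ s' k ∧ PassInv L W s₀ s' (k + 1)) := by
  obtain ⟨h1, h2, h3, h4, h5⟩ := hc
  have hLhi : s.word 14 ≤ L := by rw [h.hi_eq]; exact min_le_right _ _
  have hmh : s.word 13 ≤ s.word 14 := h.mid_j.trans h.j_hi
  -- After the entry is written, the pair of blocks is either complete or still being merged.
  have fin : ∀ s', MergeCtx w L W s₀ s' k → k + 1 ≤ s'.word 14 → Merging L W (valOf s₀) (idxOf s₀)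
      (tmpOf s') (k + 1) (s'.word 13) (s'.word 14) (s'.word 15) (s'.word 16) lo →
      MergeCtx w L W s₀ s' k ∧ PassInv L W s₀ s' (k + 1) := by
    intro s' hc hle hM
    refine ⟨hc, ?_⟩
    rcases hle.eq_or_lt with e | e
    · rw [← e] at hM
      exact Or.inl ⟨e, hM.finish⟩
    · exact Or.inr ⟨e, lo, hM⟩
  refine Straight.ite (fun hb => ?_) (fun hb => ?_)
  all_goals simp only [Test.eval_and, Test.eval_not, Test.eval_wlt, eval_wvar, eval_val, eval_idx,
      h3, h2.valOf, Test.eval_rlt] at hb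
  · have ha := hB.range (s.word 15) (by omega)
    refine Straight.seq (Straight.wset h1 (by simp [h5]; omega) (by simp [h3]; omega) fun F1 => ?_)
    simp only [WExpr.eval_add, WExpr.eval_mul, WExpr.eval_ofNat, eval_wvar, h5, eval_idx, h3]
      at F1 ⊢
    have g : ∀ x, x < 64 → (s.setWord (65 + 8 * k) (idxOf s₀ (s.word 15))).word x = s.word x :=
      fun x hx => State.word_setWord_of_ne _ _ (by omega)
    refine Straight.wset F1 (by simp; omega) (by simp [g]; omega) fun F2 => ?_
    simp only [WExpr.eval_add, WExpr.eval_lit, WExpr.eval_ofNat, eval_wvar, g 15 (by omega)] at F2 ⊢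
    refine fin _ ⟨F2, (h2.setWord (by omega)).setWord (by omega), ?_, ?_, ?_⟩ ?_ ?_
    · rw [idxOf_setWord_scalar (by omega), idxOf_setWord_tmp, h3]
    · rw [State.word_setWord_of_ne _ _ (by omega), g _ (by omega), h4]
    · rw [State.word_setWord_of_ne _ _ (by omega), g _ (by omega), h5]
    · rw [State.word_setWord_of_ne _ _ (by omega), g _ (by omega)]; exact hk
    · rw [tmpOf_setWord_scalar (by omega)]
      have := h.takeLeft (b' := tmpOf (s.setWord (65 + 8 * k) (idxOf s₀ (s.word 15)))) hB hb.1
        (fun hj => not_lt.1 fun hlt => hb.2 ⟨hj, hlt⟩) (by simp [tmpOf])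
        (fun y hy => State.word_setWord_of_ne _ _ (by omega))
      convert this using 1 <;> simp [State.word_setWord_of_ne, g]
  · have ha := hB.range (s.word 16)
    have hj : s.word 15 < s.word 13 → s.word 16 < s.word 14 ∧
        valOf s₀ (idxOf s₀ (s.word 16)) ≤ valOf s₀ (idxOf s₀ (s.word 15)) := fun hi => by
      by_contra hc
      exact hb ⟨hi, fun h' => hc ⟨h'.1, h'.2.le⟩⟩
    have hj' : s.word 16 < s.word 14 := by
      have := h.total; have := h.i_mid
      by_cases e : s.word 15 < s.word 13
      · exact (hj e).1
      · omega
    have ha := hB.range (s.word 16) (by omega)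
    refine Straight.seq (Straight.wset h1 (by simp [h5]; omega) (by simp [h3]; omega) fun F1 => ?_)
    simp only [WExpr.eval_add, WExpr.eval_mul, WExpr.eval_ofNat, eval_wvar, h5, eval_idx, h3]
      at F1 ⊢
    have g : ∀ x, x < 64 → (s.setWord (65 + 8 * k) (idxOf s₀ (s.word 16))).word x = s.word x :=
      fun x hx => State.word_setWord_of_ne _ _ (by omega)
    refine Straight.wset F1 (by simp; omega) (by simp [g]; omega) fun F2 => ?_
    simp only [WExpr.eval_add, WExpr.eval_lit, WExpr.eval_ofNat, eval_wvar, g 16 (by omega)] at F2 ⊢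
    refine fin _ ⟨F2, (h2.setWord (by omega)).setWord (by omega), ?_, ?_, ?_⟩ ?_ ?_
    · rw [idxOf_setWord_scalar (by omega), idxOf_setWord_tmp, h3]
    · rw [State.word_setWord_of_ne _ _ (by omega), g _ (by omega), h4]
    · rw [State.word_setWord_of_ne _ _ (by omega), g _ (by omega), h5]
    · rw [State.word_setWord_of_ne _ _ (by omega), g _ (by omega)]; exact hk
    · rw [tmpOf_setWord_scalar (by omega)]
      have := h.takeRight (b' := tmpOf (s.setWord (65 + 8 * k) (idxOf s₀ (s.word 16)))) hB hk
        hj (by simp [tmpOf]) (fun y hy => State.word_setWord_of_ne _ _ (by omega))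
      convert this using 1 <;> simp [State.word_setWord_of_ne, g]

theorem ok_mergePass : ∃ K, ∀ (w L W : ℕ) (s : State), s.Fits w → s.word 10 = L →
    64 + 8 * L + 8 ≤ w → 0 < W → W < L → s.word 11 = W → BlockSorted L W (valOf s) (idxOf s) →
    Ok w Prog.mergePass s (K * (L + 1)) (fun s' => s'.Fits w ∧ SortFrame s s' ∧
      s'.word 11 = s.word 11 ∧ BlockSorted L (2 * W) (valOf s) (tmpOf s')) := by
  let T := (Program.seq Prog.mergeStart Prog.mergeTake).time
  let K := 6 + ((wvar 10).cost + T + 12)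
  refine ⟨K, fun w L W s hs hL hw hW0 hW h11 hB => ?_⟩
  refine Ok.le (T := 3 + ((wvar 10).cost + T + 12) * (L + 1)) ?_ (by
    simp only [K]; generalize (wvar 10).cost + T + 12 = X; nlinarith)
  refine Ok.seq (Q := fun s' => s' = s.setWord 14 0 ∧ s'.Fits w)
    (Ok.wset hs (by simp; omega) (by simp) fun F => ⟨rfl, F⟩) ?_
  rintro s1 ⟨rfl, F1⟩
  have f1 : SortFrame s (s.setWord 14 0) := (SortFrame.refl s).setWord (by omega)
  refine (Ok.for (N := L) (T := T)
    (I := fun k s' => s'.Fits w ∧ SortFrame s s' ∧ idxOf s' = idxOf s ∧ s'.word 11 = W ∧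
      PassInv L W s s' k) (by omega) (by omega) F1
    ?_ ?_ ?_ ?_).imp ?_
  · rintro k s' ⟨h1, h2, -⟩
    exact ⟨h1, by rw [eval_wvar, h2.2 10 (by omega), hL]⟩
  · rintro k s' v ⟨h1, h2, h3, h4, h5⟩ hv
    refine ⟨h1.setWord (by omega) hv, h2.setWord (by omega), by
      rwa [idxOf_setWord_scalar (by omega)], by rwa [State.word_setWord_of_ne _ _ (by omega)], ?_⟩
    simpa [PassInv, State.word_setWord_of_ne, tmpOf_setWord_scalar] using h5
  · refine ⟨F1.setWord (by omega) (by omega), f1.setWord (by omega), ?_, ?_, Or.inl ⟨?_, ?_⟩⟩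
    · simp [idxOf_setWord_scalar]
    · simp [State.word_setWord_of_ne, h11]
    · simp [State.word_setWord]
    · exact ⟨by simp, by simp, by simp, by simp⟩
  · rintro k hk s' ⟨h1, h2, h3, h4, h5⟩ hk'
    refine Ok.imp (Straight.seq ((straight_mergeStart ⟨h1, h2, h3, h4, hk'⟩ hL hw hW0 hW hk h5).imp
      ?_)) (Q := fun s' => MergeCtx w L W s s' k ∧ PassInv L W s s' (k + 1)) ?_
    · rintro s'' ⟨g1, g2, lo, g3⟩
      exact straight_mergeTake g1 hw hB g2 g3
    · rintro s'' ⟨⟨g1, g2, g3, g4, g5⟩, g6⟩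
      exact ⟨g5, g1, g2, g3, g4, g6⟩
  · rintro s' ⟨-, h1, h2, h3, h4, h5⟩
    refine ⟨h1, h2, h4.trans h11.symm, ?_⟩
    rcases h5 with ⟨e, h5⟩ | ⟨e, lo, h5⟩
    · exact h5.blockSorted hB
    -- The pass cannot stop in the middle of a pair, since the end of a pair is at most `L`.
    · have := h5.hi_eq; omega

/-- After `k` rounds the sorted blocks have length `2 ^ k`, so `Nat.clog 2 L` linear rounds suffice.
-/
theorem ok_sort : ∃ K, ∀ (w L : ℕ) (s : State), s.Fits w → s.word 10 = L →
    64 + 8 * L + 8 ≤ w →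
    Ok w Prog.sort s (K * ((L + 1) * (Nat.clog 2 L + 1))) (fun s' => s'.Fits w ∧ SortFrame s s' ∧
      (∀ x < L, idxOf s' x < L) ∧ (∀ e < L, ∃ x < L, idxOf s' x = e) ∧
      ∀ x, x + 1 < L → valOf s (idxOf s' x) ≤ valOf s (idxOf s' (x + 1))) := by
  obtain ⟨K1, H1⟩ := ok_initIdx
  obtain ⟨K2, H2⟩ := ok_mergePass
  obtain ⟨K3, H3⟩ := ok_copyBack
  let c0 := (Program.wset (.lit 11) 1).time
  let c1 := (Program.wset (.lit 11) (2 * wvar 11)).time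
  let c2 := (Test.wlt (wvar 11) (wvar 10)).cost
  refine ⟨K1 + c0 + c2 + (c2 + K2 + K3 + c1), fun w L s hs hL hw => ?_⟩
  refine Ok.le (T := K1 * (L + 1) + (c0 + (Nat.clog 2 L * (c2 + (K2 * (L + 1) + (K3 * (L + 1) + c1)))
    + c2))) ?_ ?_
  swap
  · have e1 : K1 * (L + 1) ≤ K1 * ((L + 1) * (Nat.clog 2 L + 1)) :=
      Nat.mul_le_mul_left _ (Nat.le_mul_of_pos_right _ (by omega))
    have e2 : ∀ c, c ≤ c * ((L + 1) * (Nat.clog 2 L + 1)) := fun c =>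
      Nat.le_mul_of_pos_right _ (by positivity)
    have e3 : Nat.clog 2 L * (c2 + (K2 * (L + 1) + (K3 * (L + 1) + c1))) ≤
        (c2 + K2 + K3 + c1) * ((L + 1) * (Nat.clog 2 L + 1)) := by
      have : c2 + (K2 * (L + 1) + (K3 * (L + 1) + c1)) ≤ (c2 + K2 + K3 + c1) * (L + 1) := by
        nlinarith [Nat.zero_le (c2 * L), Nat.zero_le (c1 * L)]
      calc _ ≤ (Nat.clog 2 L + 1) * ((c2 + K2 + K3 + c1) * (L + 1)) :=
            Nat.mul_le_mul (Nat.le_succ _) this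
        _ = _ := by ring
    have e4 := e2 c0
    have e5 := e2 c2
    rw [add_mul, add_mul, add_mul]
    omega
  refine Ok.seq (H1 w L s hs hL hw) ?_
  rintro s1 ⟨F1, f1, B1⟩
  have hL1 : s1.word 10 = L := by rw [f1.2 10 (by omega), hL]
  refine Ok.seq (Q := fun s2 => s2.Fits w ∧ SortFrame s s2 ∧ s2.word 11 = 1 ∧
    BlockSorted L 1 (valOf s) (idxOf s2)) (Ok.wset F1 (by simp; omega) (by simp; omega) fun F2 =>
      ⟨F2, f1.setWord (by simp), by simp, by rwa [idxOf_setWord_scalar (by simp)]⟩) ?_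
  rintro s2 ⟨F2, f2, w2, B2⟩
  refine (Ok.loop (N := Nat.clog 2 L) (I := fun k s' => s'.Fits w ∧ SortFrame s s' ∧
    s'.word 11 = 2 ^ k ∧ BlockSorted L (2 ^ k) (valOf s) (idxOf s')) ?_ ?_
    ⟨F2, f2, by simpa using w2, by simpa using B2⟩).imp ?_
  · rintro k hk s' ⟨h1, h2, h3, h4⟩
    have hkL : 2 ^ k < L := (Nat.lt_clog_iff_pow_lt (by omega)).1 hk
    have hL' : s'.word 10 = L := by rw [h2.2 10 (by omega), hL]
    refine ⟨by simp [h3, hL', hkL], ?_⟩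
    refine Ok.seq (H2 w L (2 ^ k) s' h1 hL' hw (by positivity) hkL h3 (by rwa [h2.valOf])) ?_
    rintro s3 ⟨g1, g2, g3, g4⟩
    have f3 := h2.trans g2
    rw [h2.valOf] at g4
    refine Ok.seq (H3 w L _ _ s3 g1 (by rw [f3.2 10 (by omega), hL]) hw g4) ?_
    rintro s4 ⟨k1, k2, k3, k4⟩
    have e : s4.word 11 = 2 ^ k := by rw [k3, g3, h3]
    refine Ok.wset k1 (by simp; omega) (by simp [e]; omega) fun F5 => ⟨F5, ?_, ?_, ?_⟩
    · exact (f3.trans k2).setWord (by simp)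
    · simp [e, pow_succ']
    · rwa [WExpr.eval_lit, idxOf_setWord_scalar (by simp), pow_succ']
  · rintro s' ⟨h1, h2, h3, h4⟩
    have hL' : s'.word 10 = L := by rw [h2.2 10 (by omega), hL]
    refine ⟨?_, h1⟩
    have := Nat.le_pow_clog (b := 2) (by omega) L
    simp [h3, hL', this]
  · rintro s' ⟨h1, h2, h3, h4⟩
    refine ⟨h1, h2, h4.range, h4.surj, fun x hx => h4.sorted x hx fun hd => ?_⟩
    -- The last block length is at least `L`, so no block boundary lies strictly inside the list.
    have := Nat.le_pow_clog (b := 2) (by omega) L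
    have := Nat.le_of_dvd (by omega) hd
    omega

end RealRAM

namespace MCR
open RealRAM

/-! ### Affine functionals along a motion -/

/-- The affine functional `(x, y) ↦ nx * x + ny * y + k`. -/
structure Lin (α : Type) where
  nx : α
  ny : α
  k : α

/-- The quadratic polynomial `c0 + c1 * u + c2 * u ^ 2`. -/
structure Quad (α : Type) where
  c0 : α
  c1 : α
  c2 : α

/-- The operations shared by the real numbers and the real expressions of the machine. -/
class Arith (α : Type) extends Add α, Sub α, Mul α where
  zero : α
  one : α
  two : α

instance : Arith RExpr := { zero := 0, one := 1, two := 2 }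
noncomputable instance : Arith ℝ := { zero := 0, one := 1, two := 2 }

section Generic
variable {α : Type} [Arith α]

/-- The functionals whose signs determine the position of a point relative to the edge from
`(vx, vy)` to `(wx, wy)`. -/
def edgeLin (vx vy wx wy : α) : Fin 5 → Lin α
  | 0 => ⟨vy - wy, wx - vx, (wy - vy) * vx - (wx - vx) * vy⟩
  | 1 => ⟨Arith.one, Arith.zero, Arith.zero - vx⟩
  | 2 => ⟨Arith.one, Arith.zero, Arith.zero - wx⟩
  | 3 => ⟨Arith.zero, Arith.one, Arith.zero - vy⟩
  | 4 => ⟨Arith.zero, Arith.one, Arith.zero - wy⟩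

/-- The factor of `t`, times `1 + u²`: moving the center by `d` moves the turned point by `d - R d`,
where `R` is the rotation, and the functional is linear in this displacement. -/
def quadA (σ dx dy : α) (h : Lin α) : Quad α :=
  ⟨(h.nx * dx + h.ny * dy) * (Arith.one - σ), Arith.two * σ * (h.nx * dy - h.ny * dx),
    (h.nx * dx + h.ny * dy) * (Arith.one + σ)⟩

/-- The part free of `t`, times `1 + u²`: the functional at `p` turned around the endpoint `a`. -/
def quadB (σ ax ay px py : α) (h : Lin α) : Quad α :=
  ⟨h.nx * (ax + σ * (px - ax)) + h.ny * (ay + σ * (py - ay)) + h.k,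
    Arith.two * σ * (h.ny * (px - ax) - h.nx * (py - ay)),
    h.nx * (ax - σ * (px - ax)) + h.ny * (ay - σ * (py - ay)) + h.k⟩

/-- The coefficients of `G * A - F * B`. -/
def crossCoef (A B F G : Quad α) : Fin 5 → α
  | 0 => G.c0 * A.c0 - F.c0 * B.c0
  | 1 => G.c0 * A.c1 + G.c1 * A.c0 - (F.c0 * B.c1 + F.c1 * B.c0)
  | 2 => G.c0 * A.c2 + G.c1 * A.c1 + G.c2 * A.c0 - (F.c0 * B.c2 + F.c1 * B.c1 + F.c2 * B.c0)
  | 3 => G.c1 * A.c2 + G.c2 * A.c1 - (F.c1 * B.c2 + F.c2 * B.c1)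
  | 4 => G.c2 * A.c2 - F.c2 * B.c2

def padCoef (A : Quad α) : Fin 5 → α
  | 0 => A.c0
  | 1 => A.c1
  | 2 => A.c2
  | 3 => Arith.zero
  | 4 => Arith.zero

/-- The coefficients of the polynomials whose roots are the critical parameters of one point and one
edge on the curve given by `A` and `B`. -/
def critCoef (σ ax ay dx dy px py vx vy wx wy : α) (A B : Quad α) (g : ℕ) : Fin 5 → α :=
  if h : g < 5 then
    crossCoef A B (quadA σ dx dy (edgeLin vx vy wx wy ⟨g, h⟩))
      (quadB σ ax ay px py (edgeLin vx vy wx wy ⟨g, h⟩))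
  -- The signs of `A`, `B` and `A + B` decide whether `t = -B/A` lies in `[0, 1]`.
  else if g = 5 then padCoef A
  else if g = 6 then padCoef B
  else padCoef ⟨A.c0 + B.c0, A.c1 + B.c1, A.c2 + B.c2⟩

end Generic

section Eval

/-- The formulas above are written once over `Arith`. The lemmas below say that building a machine
expression and then evaluating it agrees with computing with real numbers. -/
noncomputable def Quad.evalE (s : State) (A : Quad RExpr) : Quad ℝ := ⟨A.c0.eval s, A.c1.eval s, A.c2.eval s⟩

noncomputable def Lin.evalE (s : State) (A : Lin RExpr) : Lin ℝ := ⟨A.nx.eval s, A.ny.eval s, A.k.eval s⟩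

variable (s : State)

theorem eval_arith_zero : (Arith.zero : RExpr).eval s = (Arith.zero : ℝ) := by
  change (0 : RExpr).eval s = (0 : ℝ); simp
theorem eval_arith_one : (Arith.one : RExpr).eval s = (Arith.one : ℝ) := by
  change (1 : RExpr).eval s = (1 : ℝ); simp
theorem eval_arith_two : (Arith.two : RExpr).eval s = (Arith.two : ℝ) := by
  change (2 : RExpr).eval s = (2 : ℝ); simp

theorem evalE_edgeLin (vx vy wx wy : RExpr) (f : Fin 5) :
    (edgeLin vx vy wx wy f).evalE s =
      edgeLin (vx.eval s) (vy.eval s) (wx.eval s) (wy.eval s) f := by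
  fin_cases f <;> simp only [edgeLin, Lin.evalE, RExpr.eval_sub, RExpr.eval_mul,
    eval_arith_zero, eval_arith_one]

theorem evalE_quadA (σ dx dy : RExpr) (h : Lin RExpr) :
    (quadA σ dx dy h).evalE s = quadA (σ.eval s) (dx.eval s) (dy.eval s) (h.evalE s) := by
  simp only [quadA, Quad.evalE, Lin.evalE, RExpr.eval_add, RExpr.eval_sub, RExpr.eval_mul,
    eval_arith_two, eval_arith_one]

theorem evalE_quadB (σ ax ay px py : RExpr) (h : Lin RExpr) :
    (quadB σ ax ay px py h).evalE s =
      quadB (σ.eval s) (ax.eval s) (ay.eval s) (px.eval s) (py.eval s) (h.evalE s) := by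
  simp only [quadB, Quad.evalE, Lin.evalE, RExpr.eval_add, RExpr.eval_sub, RExpr.eval_mul,
    eval_arith_two]

theorem eval_crossCoef (A B F G : Quad RExpr) (i : Fin 5) :
    (crossCoef A B F G i).eval s =
      crossCoef (A.evalE s) (B.evalE s) (F.evalE s) (G.evalE s) i := by
  fin_cases i <;> simp only [crossCoef, Quad.evalE, RExpr.eval_add, RExpr.eval_sub,
    RExpr.eval_mul]

theorem eval_padCoef (A : Quad RExpr) (i : Fin 5) :
    (padCoef A i).eval s = padCoef (A.evalE s) i := by
  fin_cases i <;> simp only [padCoef, Quad.evalE, eval_arith_zero]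

theorem eval_critCoef (σ ax ay dx dy px py vx vy wx wy : RExpr) (A B : Quad RExpr) (g : ℕ)
    (i : Fin 5) :
    (critCoef σ ax ay dx dy px py vx vy wx wy A B g i).eval s =
      critCoef (σ.eval s) (ax.eval s) (ay.eval s) (dx.eval s) (dy.eval s) (px.eval s) (py.eval s)
        (vx.eval s) (vy.eval s) (wx.eval s) (wy.eval s) (A.evalE s) (B.evalE s) g i := by
  unfold critCoef
  split_ifs
  · rw [eval_crossCoef, evalE_quadA, evalE_quadB, evalE_edgeLin]
  · rw [eval_padCoef]
  · rw [eval_padCoef]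
  · rw [eval_padCoef]; rfl

end Eval

noncomputable def Quad.at (A : Quad ℝ) (u : ℝ) : ℝ := A.c0 + A.c1 * u + A.c2 * u ^ 2

def Lin.at (h : Lin ℝ) (q : ℝ × ℝ) : ℝ := h.nx * q.1 + h.ny * q.2 + h.k

/-- The functionals of the edge from `v` to `w`. -/
noncomputable def edgeFun (v w : ℝ × ℝ) (f : Fin 5) : Lin ℝ := edgeLin v.1 v.2 w.1 w.2 f

theorem edgeFun_at (v w q : ℝ × ℝ) :
    (edgeFun v w 0).at q = cr (w - v) (q - v) ∧ (edgeFun v w 1).at q = q.1 - v.1 ∧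
      (edgeFun v w 2).at q = q.1 - w.1 ∧ (edgeFun v w 3).at q = q.2 - v.2 ∧
        (edgeFun v w 4).at q = q.2 - w.2 := by
  refine ⟨?_, ?_, ?_, ?_, ?_⟩ <;> simp [edgeFun, edgeLin, Lin.at, cr, Arith.zero, Arith.one] <;>
    ring

/-- The point with parameter `t` of the segment from `a` in direction `d`. -/
def center (a d : ℝ × ℝ) (t : ℝ) : ℝ × ℝ := (a.1 + t * d.1, a.2 + t * d.2)

/-- The half-angle parametrization misses the angle `π`; negating both coordinates with `σ = -1`
gives a second chart that contains it. -/
noncomputable def cosU (σ u : ℝ) : ℝ := σ * (1 - u * u) / (1 + u * u)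
noncomputable def sinU (σ u : ℝ) : ℝ := σ * (2 * u) / (1 + u * u)

/-- The image of `p` under the counterclockwise rotation around `r` by the angle with cosine `c` and
sine `s`. -/
def turn (r : ℝ × ℝ) (c s : ℝ) (p : ℝ × ℝ) : ℝ × ℝ :=
  (r.1 + (c * (p.1 - r.1) - s * (p.2 - r.2)), r.2 + (s * (p.1 - r.1) + c * (p.2 - r.2)))

noncomputable def linA (σ : ℝ) (d : ℝ × ℝ) (h : Lin ℝ) : Quad ℝ := quadA σ d.1 d.2 h
noncomputable def linB (σ : ℝ) (a p : ℝ × ℝ) (h : Lin ℝ) : Quad ℝ := quadB σ a.1 a.2 p.1 p.2 h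

/-- The identity behind the algorithm: each condition is affine in `t` and, after clearing a
positive denominator, quadratic in `u`. -/
theorem lin_turn (σ u t : ℝ) (a d p : ℝ × ℝ) (h : Lin ℝ) :
    (1 + u * u) * h.at (turn (center a d t) (cosU σ u) (sinU σ u) p) =
      (linA σ d h).at u * t + (linB σ a p h).at u := by
  have : 1 + u * u ≠ 0 := by nlinarith [mul_self_nonneg u]
  simp only [Lin.at, turn, center, cosU, sinU, linA, linB, quadA, quadB, Quad.at, Arith.one,
    Arith.two]
  field_simp
  ring

/-- The position of `p` on the curve `t = - B u / A u`. -/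
noncomputable def onCurve (σ : ℝ) (a d : ℝ × ℝ) (A B : Quad ℝ) (p : ℝ × ℝ) (u : ℝ) : ℝ × ℝ :=
  turn (center a d ((0 - B.at u) / A.at u)) (cosU σ u) (sinU σ u) p

def evalPoly (c : Fin 5 → ℝ) (u : ℝ) : ℝ :=
  c 0 + c 1 * u + c 2 * u ^ 2 + c 3 * u ^ 3 + c 4 * u ^ 4

theorem evalPoly_crossCoef (A B F G : Quad ℝ) (u : ℝ) :
    evalPoly (crossCoef A B F G) u = G.at u * A.at u - F.at u * B.at u := by
  simp only [evalPoly, crossCoef, Quad.at]; ring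

theorem evalPoly_padCoef (A : Quad ℝ) (u : ℝ) : evalPoly (padCoef A) u = A.at u := by
  simp only [evalPoly, padCoef, Quad.at, Arith.zero]; ring

/-- Substituting `t = -B/A` and clearing denominators leaves a quartic, so up to the sign of `A` the
functional has the sign of that quartic. -/
theorem lin_onCurve {σ u : ℝ} {a d p : ℝ × ℝ} {A B : Quad ℝ} (h : Lin ℝ) (hA : A.at u ≠ 0) :
    (1 + u * u) * h.at (onCurve σ a d A B p u) * A.at u =
      evalPoly (crossCoef A B (linA σ d h) (linB σ a p h)) u := by
  rw [onCurve, lin_turn, evalPoly_crossCoef]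
  field_simp; ring

/-! ### Roots -/

noncomputable def toPoly (c : Fin 5 → ℝ) : Polynomial ℝ :=
  ∑ i : Fin (4 + 1), Polynomial.C (c i) * Polynomial.X ^ (i : ℕ)

theorem toPoly_eval (c : Fin 5 → ℝ) (u : ℝ) : (toPoly c).eval u = evalPoly c u := by
  simp [toPoly, Fin.sum_univ_five, evalPoly]

theorem toPoly_natDegree (c : Fin 5 → ℝ) : (toPoly c).natDegree ≤ 4 := by
  refine Polynomial.natDegree_sum_le_of_forall_le _ _ fun i _ => ?_
  exact (Polynomial.natDegree_C_mul_X_pow_le _ _).trans (by omega)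

theorem exists_kthRealRoot {c : Fin 5 → ℝ} {u x : ℝ} (hx : evalPoly c x ≠ 0)
    (hu : evalPoly c u = 0) : ∃ k < 4, kthRealRoot 4 c k = u := by
  have hne : toPoly c ≠ 0 := by
    intro h
    rw [← toPoly_eval, h] at hx
    simp at hx
  have hroot : u ∈ (toPoly c).roots := by
    rw [Polynomial.mem_roots hne, Polynomial.IsRoot, toPoly_eval, hu]
  set l := (toPoly c).roots.toFinset.sort (· ≤ ·) with hl
  have hmem : u ∈ l := by simp [hl, hne, Polynomial.IsRoot, toPoly_eval, hu]
  obtain ⟨k, hk, hk'⟩ := List.getElem_of_mem hmem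
  refine ⟨k, lt_of_lt_of_le hk ?_, ?_⟩
  · rw [hl, Finset.length_sort]
    exact (Multiset.toFinset_card_le _).trans ((Polynomial.card_roots' _).trans
      (toPoly_natDegree c))
  · change l.getD k 0 = u
    rw [List.getD_eq_getElem _ _ hk, hk']

theorem continuous_evalPoly (c : Fin 5 → ℝ) : Continuous (evalPoly c) := by
  unfold evalPoly; fun_prop

/-- A sign change would produce a root in the interval, and a nonzero quartic has at most four
distinct roots, all listed with `k < 4`. The zero polynomial, for which the root operation returns a
default, has constant sign anyway. -/
theorem sign_evalPoly {c : Fin 5 → ℝ} {x y : ℝ} (hxy : x ≤ y)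
    (h : ∀ k < 4, ¬ (x ≤ kthRealRoot 4 c k ∧ kthRealRoot 4 c k ≤ y)) :
    SignType.sign (evalPoly c x) = SignType.sign (evalPoly c y) := by
  by_cases h0 : ∀ u, evalPoly c u = 0
  · rw [h0, h0]
  push Not at h0
  obtain ⟨z, hz⟩ := h0
  have hne : ∀ u ∈ Set.Icc x y, evalPoly c u ≠ 0 := by
    intro u hu h0
    obtain ⟨k, hk, rfl⟩ := exists_kthRealRoot hz h0
    exact h k hk hu
  have hcont : ContinuousOn (evalPoly c) (Set.Icc x y) := (continuous_evalPoly c).continuousOn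
  have hx := hne x ⟨le_rfl, hxy⟩
  have hy := hne y ⟨hxy, le_rfl⟩
  rcases hx.lt_or_gt with h1 | h1 <;> rcases hy.lt_or_gt with h2 | h2
  · rw [sign_neg h1, sign_neg h2]
  · obtain ⟨u, hu, hu0⟩ := intermediate_value_Icc hxy hcont ⟨h1.le, h2.le⟩
    exact absurd hu0 (hne u hu)
  · obtain ⟨u, hu, hu0⟩ := intermediate_value_Icc' hxy hcont ⟨h2.le, h1.le⟩
    exact absurd hu0 (hne u hu)
  · rw [sign_pos h1, sign_pos h2]

/-! ### Contributions of edges -/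

open Classical in
noncomputable def chiN (v w q : ℝ × ℝ) : ℕ := if RayCross v w q then 1 else 0

open Classical in
noncomputable def psiN (v w q : ℝ × ℝ) : ℕ := if OnEdge v w q then 1 else 0

theorem contributions_congr {v w q q' : ℝ × ℝ}
    (h : ∀ f, SignType.sign ((edgeFun v w f).at q) = SignType.sign ((edgeFun v w f).at q')) :
    chiN v w q = chiN v w q' ∧ psiN v w q = psiN v w q' := by
  obtain ⟨e0, e1, e2, e3, e4⟩ := edgeFun_at v w q
  obtain ⟨f0, f1, f2, f3, f4⟩ := edgeFun_at v w q'
  have h0 := h 0; have h1 := h 1; have h2 := h 2; have h3 := h 3; have h4 := h 4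
  rw [e0, f0] at h0; rw [e1, f1] at h1; rw [e2, f2] at h2; rw [e3, f3] at h3; rw [e4, f4] at h4
  have neg : ∀ {a b : ℝ}, SignType.sign a = SignType.sign b → (a < 0 ↔ b < 0) := fun h => by
    rw [← sign_eq_neg_one_iff, h, sign_eq_neg_one_iff]
  have pos : ∀ {a b : ℝ}, SignType.sign a = SignType.sign b → (0 < a ↔ 0 < b) := fun h => by
    rw [← sign_eq_one_iff, h, sign_eq_one_iff]
  have zero : ∀ {a b : ℝ}, SignType.sign a = SignType.sign b → (a = 0 ↔ b = 0) := fun h => by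
    rw [← sign_eq_zero_iff, h, sign_eq_zero_iff]
  have nonneg : ∀ {a b : ℝ}, SignType.sign a = SignType.sign b → (0 ≤ a ↔ 0 ≤ b) := fun h => by
    rw [← not_lt, neg h, not_lt]
  have mul : ∀ {a b c d : ℝ}, SignType.sign a = SignType.sign b → SignType.sign c = SignType.sign d →
      (a * c ≤ 0 ↔ b * d ≤ 0) := fun {a b c d} h h' => by
    have : SignType.sign (a * c) = SignType.sign (b * d) := by rw [sign_mul, sign_mul, h, h']
    rw [← not_lt, pos this, not_lt]
  have H1 : RayCross v w q ↔ RayCross v w q' := by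
    simp only [RayCross, nonneg h1, neg h2, neg h0, nonneg h2, neg h1, pos h0]
  have H2 : OnEdge v w q ↔ OnEdge v w q' := by
    simp only [OnEdge, zero h0, mul h1 h2, mul h3 h4]
  unfold chiN psiN
  constructor
  · by_cases e : RayCross v w q
    · rw [if_pos e, if_pos (H1.1 e)]
    · rw [if_neg e, if_neg (mt H1.2 e)]
  · by_cases e : OnEdge v w q
    · rw [if_pos e, if_pos (H2.1 e)]
    · rw [if_neg e, if_neg (mt H2.2 e)]

/-- The critical parameters of the point `p` and the edge from `v` to `w`. -/
noncomputable def critVal (σ : ℝ) (a d : ℝ × ℝ) (A B : Quad ℝ) (p v w : ℝ × ℝ) (o : ℕ) : ℝ :=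
  -- The index is `o = 4g + k`: eight polynomials with four root slots each, hence 32 critical
  -- parameters.
  kthRealRoot 4 (critCoef σ a.1 a.2 d.1 d.2 p.1 p.2 v.1 v.2 w.1 w.2 A B (o / 4)) (o % 4)

theorem sign_critCoef {σ : ℝ} {a d p v w : ℝ × ℝ} {A B : Quad ℝ} {x y : ℝ} (hxy : x ≤ y)
    (h : ∀ o < 32, ¬ (x ≤ critVal σ a d A B p v w o ∧ critVal σ a d A B p v w o ≤ y)) {g : ℕ}
    (hg : g < 8) :
    SignType.sign (evalPoly (critCoef σ a.1 a.2 d.1 d.2 p.1 p.2 v.1 v.2 w.1 w.2 A B g) x) =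
      SignType.sign (evalPoly (critCoef σ a.1 a.2 d.1 d.2 p.1 p.2 v.1 v.2 w.1 w.2 A B g) y) := by
  refine sign_evalPoly hxy fun k hk => ?_
  have := h (4 * g + k) (by omega)
  rwa [critVal, show (4 * g + k) / 4 = g by omega, show (4 * g + k) % 4 = k by omega] at this

theorem sign_quads {σ : ℝ} {a d p v w : ℝ × ℝ} {A B : Quad ℝ} {x y : ℝ} (hxy : x ≤ y)
    (h : ∀ o < 32, ¬ (x ≤ critVal σ a d A B p v w o ∧ critVal σ a d A B p v w o ≤ y)) :
    SignType.sign (A.at x) = SignType.sign (A.at y) ∧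
      SignType.sign (B.at x) = SignType.sign (B.at y) ∧
        SignType.sign (A.at x + B.at x) = SignType.sign (A.at y + B.at y) := by
  have h5 := sign_critCoef hxy h (g := 5) (by omega)
  have h6 := sign_critCoef hxy h (g := 6) (by omega)
  have h7 := sign_critCoef hxy h (g := 7) (by omega)
  simp only [critCoef] at h5 h6 h7
  refine ⟨by simpa [evalPoly_padCoef] using h5, by simpa [evalPoly_padCoef] using h6, ?_⟩
  have e : ∀ u, (⟨A.c0 + B.c0, A.c1 + B.c1, A.c2 + B.c2⟩ : Quad ℝ).at u = A.at u + B.at u := by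
    intro u; simp only [Quad.at]; ring
  simpa [evalPoly_padCoef, e] using h7

/-- The sign of `A` is the same nonzero value at `x` and `y`, so it can be cancelled from the signs
of the quartics. -/
theorem contributions_onCurve {σ : ℝ} {a d p v w : ℝ × ℝ} {A B : Quad ℝ} {x y : ℝ} (hxy : x ≤ y)
    (h : ∀ o < 32, ¬ (x ≤ critVal σ a d A B p v w o ∧ critVal σ a d A B p v w o ≤ y))
    (hA : A.at y ≠ 0) :
    chiN v w (onCurve σ a d A B p x) = chiN v w (onCurve σ a d A B p y) ∧
      psiN v w (onCurve σ a d A B p x) = psiN v w (onCurve σ a d A B p y) := by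
  have hs := (sign_quads hxy h).1
  have hA' : A.at x ≠ 0 := fun e => hA (by rw [e, sign_zero, eq_comm, sign_eq_zero_iff] at hs; exact hs)
  refine contributions_congr fun f => ?_
  have hf := sign_critCoef hxy h (g := f) (by omega)
  simp only [critCoef, f.2, dif_pos, Fin.eta] at hf
  have e1 := lin_onCurve (σ := σ) (a := a) (d := d) (p := p) (B := B) (edgeFun v w f) hA
  have e2 := lin_onCurve (σ := σ) (a := a) (d := d) (p := p) (B := B) (edgeFun v w f) hA'
  simp only [linA, linB, edgeFun] at e1 e2
  rw [← e1, ← e2, sign_mul, sign_mul, sign_mul, sign_mul, hs,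
    sign_pos (show 0 < 1 + x * x by nlinarith [mul_self_nonneg x]),
    sign_pos (show 0 < 1 + y * y by nlinarith [mul_self_nonneg y]), one_mul, one_mul] at hf
  have hn : SignType.sign (A.at y) ≠ 0 := by rwa [Ne, sign_eq_zero_iff]
  exact mul_right_cancel₀ hn hf

/-- The parameter `u` corresponds to a point of the segment. -/
def ValidAt (A B : Quad ℝ) (u : ℝ) : Prop :=
  A.at u ≠ 0 ∧ 0 ≤ (0 - B.at u) / A.at u ∧ (0 - B.at u) / A.at u ≤ 1

/-- Clearing the denominator expresses validity by the signs of `A`, `B` and `A + B`. -/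
theorem validAt_iff (A B : Quad ℝ) (u : ℝ) : ValidAt A B u ↔
    (0 < A.at u ∧ B.at u ≤ 0 ∧ 0 ≤ A.at u + B.at u) ∨
      (A.at u < 0 ∧ 0 ≤ B.at u ∧ A.at u + B.at u ≤ 0) := by
  unfold ValidAt
  rcases lt_trichotomy (A.at u) 0 with h | h | h
  · rw [le_div_iff_of_neg h, div_le_one_of_neg h]
    constructor
    · rintro ⟨-, h1, h2⟩
      exact Or.inr ⟨h, by linarith, by linarith⟩
    · rintro (⟨h1, -⟩ | ⟨h1, h2, h3⟩)
      · linarith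
      · exact ⟨h.ne, by linarith, by linarith⟩
  · simp [h]
  · rw [div_le_one h, le_div_iff₀ h]
    constructor
    · rintro ⟨-, h1, h2⟩
      exact Or.inl ⟨h, by linarith, by linarith⟩
    · rintro (⟨h1, h2, h3⟩ | ⟨h1, -⟩)
      · exact ⟨h.ne', by linarith, by linarith⟩
      · linarith

theorem validAt_congr {σ : ℝ} {a d p v w : ℝ × ℝ} {A B : Quad ℝ} {x y : ℝ} (hxy : x ≤ y)
    (h : ∀ o < 32, ¬ (x ≤ critVal σ a d A B p v w o ∧ critVal σ a d A B p v w o ≤ y)) :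
    ValidAt A B x ↔ ValidAt A B y := by
  obtain ⟨h1, h2, h3⟩ := sign_quads hxy h
  have neg : ∀ {a b : ℝ}, SignType.sign a = SignType.sign b → (a < 0 ↔ b < 0) := fun h => by
    rw [← sign_eq_neg_one_iff, h, sign_eq_neg_one_iff]
  have pos : ∀ {a b : ℝ}, SignType.sign a = SignType.sign b → (0 < a ↔ 0 < b) := fun h => by
    rw [← sign_eq_one_iff, h, sign_eq_one_iff]
  rw [validAt_iff, validAt_iff, pos h1, neg h1, ← not_lt, ← not_lt, ← not_lt, ← not_lt, pos h2,
    neg h2, pos h3, neg h3, not_lt, not_lt, not_lt, not_lt]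

end MCR

namespace MCR
open Filter Topology
open RealRAM

/-! ### Counting covered points -/

/-- Whether a point with given numbers of crossings and incidences belongs to the region. -/
def statusOf (x y : ℕ) : ℕ := if 0 < y then 1 else x % 2

theorem statusOf_le (x y : ℕ) : statusOf x y ≤ 1 := by
  unfold statusOf; split_ifs <;> omega

namespace Instance

variable {n m : ℕ} (I : Instance n m)

noncomputable def pt (i : ℕ) : ℝ × ℝ := if h : i < n then I.points ⟨i, h⟩ else 0
noncomputable def vert (j : ℕ) : ℝ × ℝ := if h : j < m then I.polygon ⟨j, h⟩ else 0
def dir : ℝ × ℝ := I.b - I.a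

noncomputable def status (q : ℝ × ℝ) : ℕ :=
  statusOf (∑ j ∈ Finset.range m, chiN (I.vert j) (I.vert ((j + 1) % m)) q)
    (∑ j ∈ Finset.range m, psiN (I.vert j) (I.vert ((j + 1) % m)) q)

theorem vert_next (j : Fin m) : I.vert ((j + 1) % m) = I.polygon (finRotate m j) := by
  have hm : 0 < m := j.pos
  obtain ⟨k, rfl⟩ := Nat.exists_eq_succ_of_ne_zero hm.ne'
  rw [vert, dif_pos (Nat.mod_lt _ hm)]
  congr 1
  ext
  rw [finRotate_apply]
  simp [Fin.val_add]

theorem vert_val (j : Fin m) : I.vert j = I.polygon j := by simp [vert]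

variable {I}

theorem status_le (q : ℝ × ℝ) : I.status q ≤ 1 := statusOf_le _ _

theorem mem_region_iff_status (hP : IsSimple I.polygon) (q : ℝ × ℝ) :
    q ∈ region I.polygon ↔ I.status q = 1 := by
  rw [hP.mem_region_iff, status, statusOf, Finset.sum_range, Finset.sum_range]
  simp only [vert_next, vert_val]
  have h1 : (0 < ∑ j : Fin m, psiN (I.polygon j) (I.polygon (finRotate m j)) q) ↔
      ∃ i, OnEdge (I.polygon i) (I.polygon (finRotate m i)) q := by
    rw [Nat.pos_iff_ne_zero, Ne, Finset.sum_eq_zero_iff]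
    simp [psiN]
  have h2 : par I.polygon q =
      ((∑ j : Fin m, chiN (I.polygon j) (I.polygon (finRotate m j)) q : ℕ) : ZMod 2) := by
    rw [par, Nat.cast_sum]
    refine Finset.sum_congr rfl fun i _ => ?_
    by_cases h : RayCross (I.polygon i) (I.polygon (finRotate m i)) q <;> simp [chiP, chiN]
  rw [← h1, h2]
  generalize (∑ j : Fin m, chiN (I.polygon j) (I.polygon (finRotate m j)) q) = x
  have h3 : ((x : ℕ) : ZMod 2) = 1 ↔ x % 2 = 1 := by
    have := ZMod.natCast_eq_natCast_iff' x 1 2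
    simpa using this
  rw [h3]
  generalize (∑ j : Fin m, psiN (I.polygon j) (I.polygon (finRotate m j)) q) = y
  by_cases h : 0 < y <;> simp [h]

variable (I)

/-- The number of points that are covered when the rotation center is `r` and the angle has cosine
`c` and sine `s`. -/
noncomputable def cov (r : ℝ × ℝ) (c s : ℝ) : ℕ :=
  ∑ i ∈ Finset.range n, I.status (turn r c s (I.pt i))

variable {I}

/-- The inverse rotation is applied to the point, so that the polygon stays fixed. -/
theorem mem_rotateCW_image {r : ℝ × ℝ} {θ : ℝ} {S : Set (ℝ × ℝ)} {p : ℝ × ℝ} :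
    p ∈ rotateCW r θ '' S ↔ turn r (Real.cos θ) (Real.sin θ) p ∈ S := by
  have h := Real.sin_sq_add_cos_sq θ
  constructor
  · rintro ⟨z, hz, rfl⟩
    convert hz using 1
    ext <;> simp only [turn, rotateCW]
    · linear_combination (z.1 - r.1) * h
    · linear_combination (z.2 - r.2) * h
  · intro hz
    refine ⟨_, hz, ?_⟩
    ext <;> simp only [turn, rotateCW]
    · linear_combination (p.1 - r.1) * h
    · linear_combination (p.2 - r.2) * h

theorem covered_eq (hI : I.Valid) (r : ℝ × ℝ) (θ : ℝ) :
    I.covered r θ = I.cov r (Real.cos θ) (Real.sin θ) := by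
  classical
  obtain ⟨-, -, hinj, hP⟩ := hI
  have e : Set.range I.points ∩ rotateCW r θ '' region I.polygon =
      I.points '' {i | I.status (turn r (Real.cos θ) (Real.sin θ) (I.points i)) = 1} := by
    ext p
    rw [Set.mem_inter_iff, mem_rotateCW_image, mem_region_iff_status hP]
    constructor
    · rintro ⟨⟨i, rfl⟩, h⟩; exact ⟨i, h, rfl⟩
    · rintro ⟨i, h, rfl⟩; exact ⟨⟨i, rfl⟩, h⟩
  rw [covered, e, Set.ncard_image_of_injective _ hinj, cov, Finset.sum_range]
  have hs : ∀ i : Fin n, I.status (turn r (Real.cos θ) (Real.sin θ) (I.pt i)) =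
      if I.status (turn r (Real.cos θ) (Real.sin θ) (I.points i)) = 1 then 1 else 0 := by
    intro i
    have := status_le (I := I) (turn r (Real.cos θ) (Real.sin θ) (I.points i))
    simp only [pt, i.2, dif_pos, Fin.eta]
    split_ifs <;> omega
  simp only [hs]
  rw [Finset.sum_boole, Set.ncard_eq_toFinset_card']
  simp

end Instance

/-! ### The angle -/

/-- The tangent of the half angle is `s / (1 + c)`; the exceptional case `c = -1` is `u = 0` in the
second chart. -/
theorem exists_param {c s : ℝ} (h : c ^ 2 + s ^ 2 = 1) :
    ∃ σ u, (σ = 1 ∨ σ = -1) ∧ cosU σ u = c ∧ sinU σ u = s := by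
  by_cases hc : c = -1
  · have hs : s = 0 := by rw [hc] at h; nlinarith
    exact ⟨-1, 0, Or.inr rfl, by simp [cosU, hc], by simp [sinU, hs]⟩
  · have hc' : 1 + c ≠ 0 := fun e => hc (by linarith)
    have e : 1 + s / (1 + c) * (s / (1 + c)) = 2 / (1 + c) := by
      field_simp; linear_combination h
    refine ⟨1, s / (1 + c), Or.inl rfl, ?_, ?_⟩
    · rw [cosU, e]; field_simp; linear_combination -h
    · rw [sinU, e]; field_simp

theorem cosU_sq_add_sinU_sq {σ : ℝ} (hσ : σ = 1 ∨ σ = -1) (u : ℝ) :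
    cosU σ u ^ 2 + sinU σ u ^ 2 = 1 := by
  have : 1 + u * u ≠ 0 := by nlinarith [mul_self_nonneg u]
  have h2 : σ ^ 2 = 1 := by rcases hσ with rfl | rfl <;> norm_num
  simp only [cosU, sinU]; field_simp; linear_combination (1 + u ^ 2) ^ 2 * h2

/-- The angle in `[0, 2π)` with cosine `c` and sine `s`. -/
noncomputable def angleOf (c s : ℝ) : ℝ :=
  -- The machine has only rational constants, so `π` is obtained as `arccos (-1)`.
  if s < 0 then 2 * Real.arccos (0 - 1) - Real.arccos c else Real.arccos c

theorem angleOf_spec {c s : ℝ} (h : c ^ 2 + s ^ 2 = 1) :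
    angleOf c s ∈ Set.Ico 0 (2 * Real.pi) ∧ Real.cos (angleOf c s) = c ∧
      Real.sin (angleOf c s) = s := by
  have h1 : -1 ≤ c := by nlinarith [sq_nonneg s]
  have h2 : c ≤ 1 := by nlinarith [sq_nonneg s]
  have e1 := Real.cos_arccos h1 h2
  have e2 : Real.sin (Real.arccos c) = |s| := by
    rw [Real.sin_arccos, ← Real.sqrt_sq_eq_abs]; congr 1; linarith
  have p1 := Real.arccos_nonneg c
  have p2 := Real.arccos_le_pi c
  have hpi := Real.pi_pos
  have e0 : Real.arccos (0 - 1) = Real.pi := by rw [zero_sub, Real.arccos_neg_one]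
  unfold angleOf
  split_ifs with hs
  · rw [e0]
    have : Real.arccos c ≠ 0 := by
      intro h0
      rw [h0, Real.sin_zero, eq_comm, abs_eq_zero] at e2
      linarith
    have : 0 < Real.arccos c := lt_of_le_of_ne p1 (Ne.symm this)
    refine ⟨⟨by linarith, by linarith⟩, ?_, ?_⟩
    · rw [Real.cos_two_pi_sub, e1]
    · rw [Real.sin_two_pi_sub, e2, abs_of_neg hs, neg_neg]
  · exact ⟨⟨p1, by linarith⟩, e1, by rw [e2, abs_of_nonneg (not_lt.1 hs)]⟩

/-! ### Moving an optimal solution to a curve -/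

namespace Instance

variable {n m : ℕ} (I : Instance n m)

/-- The curves to be searched: the one with `t = 0`, and, for each point and edge, those on which
the point lies on a line that bounds the edge or its bounding box. -/
def IsCurve (σ : ℝ) (A B : Quad ℝ) : Prop :=
  (A = ⟨1, 0, 0⟩ ∧ B = ⟨0, 0, 0⟩) ∨ ∃ i < n, ∃ j < m, ∃ f,
    A = linA σ I.dir (edgeFun (I.vert j) (I.vert ((j + 1) % m)) f) ∧
    B = linB σ I.a (I.pt i) (edgeFun (I.vert j) (I.vert ((j + 1) % m)) f)

/-- The number of points covered at the parameter `u` of a curve. -/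
noncomputable def covAt (σ : ℝ) (A B : Quad ℝ) (u : ℝ) : ℕ :=
  I.cov (center I.a I.dir ((0 - B.at u) / A.at u)) (cosU σ u) (sinU σ u)

variable {I}

theorem status_congr {q q' : ℝ × ℝ} (h : ∀ j < m, ∀ f,
    SignType.sign ((edgeFun (I.vert j) (I.vert ((j + 1) % m)) f).at q) =
      SignType.sign ((edgeFun (I.vert j) (I.vert ((j + 1) % m)) f).at q')) :
    I.status q = I.status q' := by
  unfold status
  congr 1 <;> refine Finset.sum_congr rfl fun j hj => ?_
  · exact (contributions_congr (h j (Finset.mem_range.1 hj))).1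
  · exact (contributions_congr (h j (Finset.mem_range.1 hj))).2

/-- Keep the angle and lower `t` to the last value `t'` at which some functional vanishes, or to
`0`. All signs, and hence the covered set, are constant on `(t', t]`; in the limit `t'` covered
points stay covered because the region is closed. -/
theorem exists_curve (hI : I.Valid) {σ t u : ℝ} (ht0 : 0 ≤ t) (ht1 : t ≤ 1) :
    ∃ A B, I.IsCurve σ A B ∧ ValidAt A B u ∧
      I.cov (center I.a I.dir t) (cosU σ u) (sinU σ u) ≤ I.covAt σ A B u := by
  let α : Fin n × Fin m × Fin 5 → ℝ := fun x =>
    (linA σ I.dir (edgeFun (I.vert x.2.1) (I.vert ((x.2.1 + 1) % m)) x.2.2)).at u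
  let β : Fin n × Fin m × Fin 5 → ℝ := fun x =>
    (linB σ I.a (I.pt x.1) (edgeFun (I.vert x.2.1) (I.vert ((x.2.1 + 1) % m)) x.2.2)).at u
  let Z : Set ℝ := insert 0 ((fun x => (0 - β x) / α x) ''
    {x | α x ≠ 0 ∧ 0 ≤ (0 - β x) / α x ∧ (0 - β x) / α x ≤ t})
  have hfin : Z.Finite := ((Set.toFinite _).image _).insert _
  obtain ⟨t', ht'Z, hmax⟩ := Set.exists_max_image Z id hfin ⟨0, Set.mem_insert _ _⟩
  have hmax : ∀ z ∈ Z, z ≤ t' := hmax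
  have ht'0 : 0 ≤ t' := hmax 0 (Set.mem_insert _ _)
  have ht't : t' ≤ t := by
    rcases ht'Z with rfl | ⟨x, hx, rfl⟩
    · exact ht0
    · exact hx.2.2
  have pos : ∀ u : ℝ, 0 < 1 + u * u := fun u => by nlinarith [mul_self_nonneg u]
  have hstat : ∀ τ, t' < τ → τ ≤ t → ∀ i < n,
      I.status (turn (center I.a I.dir τ) (cosU σ u) (sinU σ u) (I.pt i)) =
        I.status (turn (center I.a I.dir t) (cosU σ u) (sinU σ u) (I.pt i)) := by
    intro τ h1 h2 i hi
    refine status_congr fun j hj f => ?_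
    have e := fun t => congrArg SignType.sign (lin_turn σ u t I.a I.dir (I.pt i)
      (edgeFun (I.vert j) (I.vert ((j + 1) % m)) f))
    simp only [sign_mul, sign_pos (pos u), one_mul] at e
    rw [e, e]
    change SignType.sign (α (⟨i, hi⟩, ⟨j, hj⟩, f) * τ + β (⟨i, hi⟩, ⟨j, hj⟩, f)) =
      SignType.sign (α (⟨i, hi⟩, ⟨j, hj⟩, f) * t + β (⟨i, hi⟩, ⟨j, hj⟩, f))
    set x : Fin n × Fin m × Fin 5 := (⟨i, hi⟩, ⟨j, hj⟩, f)
    by_cases h0 : α x = 0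
    · rw [h0, zero_mul, zero_mul]
    -- Factoring out `α x` shows that the sign changes only at the zero, which is beyond `t` or at
    -- most `t'`.
    have e' : ∀ t, α x * t + β x = α x * (t - (0 - β x) / α x) := fun t => by field_simp; ring
    rw [e', e', sign_mul, sign_mul]
    congr 1
    rcases lt_or_ge t ((0 - β x) / α x) with h3 | h3
    · rw [sign_neg (by linarith), sign_neg (by linarith)]
    · have : (0 - β x) / α x ≤ t' := by
        rcases lt_or_ge ((0 - β x) / α x) 0 with h4 | h4
        · linarith
        · exact hmax _ (Set.mem_insert_of_mem _ ⟨x, ⟨h0, h4, h3⟩, rfl⟩)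
      rw [sign_pos (by linarith), sign_pos (by linarith)]
  have hcov : I.cov (center I.a I.dir t) (cosU σ u) (sinU σ u) ≤
      I.cov (center I.a I.dir t') (cosU σ u) (sinU σ u) := by
    rcases ht't.eq_or_lt with e | hlt
    · rw [e]
    refine Finset.sum_le_sum fun i hi => ?_
    by_cases h1 : I.status (turn (center I.a I.dir t) (cosU σ u) (sinU σ u) (I.pt i)) = 1
    · rw [h1]
      have hcl := isClosed_region I.polygon
      have hc : Continuous fun τ : ℝ =>
          turn (center I.a I.dir τ) (cosU σ u) (sinU σ u) (I.pt i) := by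
        unfold turn center; fun_prop
      have hmem : turn (center I.a I.dir t') (cosU σ u) (sinU σ u) (I.pt i) ∈ region I.polygon := by
        refine hcl.mem_of_tendsto ((hc.tendsto t').mono_left
          (nhdsWithin_le_nhds (s := Set.Ioi t'))) ?_
        have e1 : ∀ᶠ τ in 𝓝[>] t', τ ≤ t :=
          (eventually_le_nhds hlt).filter_mono nhdsWithin_le_nhds
        filter_upwards [self_mem_nhdsWithin, e1] with τ h2 h3
        rw [mem_region_iff_status hI.2.2.2, hstat τ h2 h3 i (Finset.mem_range.1 hi), h1]
      rw [mem_region_iff_status hI.2.2.2] at hmem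
      rw [hmem]
    · have := status_le (I := I) (turn (center I.a I.dir t) (cosU σ u) (sinU σ u) (I.pt i))
      omega
  rcases ht'Z with rfl | ⟨x, ⟨hx0, hx1, hx2⟩, rfl⟩
  · refine ⟨⟨1, 0, 0⟩, ⟨0, 0, 0⟩, Or.inl ⟨rfl, rfl⟩, by simp [ValidAt, Quad.at], ?_⟩
    have : I.covAt σ ⟨1, 0, 0⟩ ⟨0, 0, 0⟩ u = I.cov (center I.a I.dir 0) (cosU σ u) (sinU σ u) := by
      simp [covAt, Quad.at]
    rwa [this]
  · exact ⟨_, _, Or.inr ⟨x.1, x.1.2, x.2.1, x.2.1.2, x.2.2, rfl, rfl⟩,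
      ⟨hx0, hx1, hx2.trans ht1⟩, hcov⟩

theorem isSolution_of_forall (hI : I.Valid) {r : ℝ × ℝ} {θ : ℝ} (hr : r ∈ segment ℝ I.a I.b)
    (hθ : θ ∈ Set.Ico 0 (2 * Real.pi))
    (h : ∀ σ : ℝ, σ = 1 ∨ σ = -1 → ∀ A B, I.IsCurve σ A B → ∀ u, ValidAt A B u →
      I.covAt σ A B u ≤ I.cov r (Real.cos θ) (Real.sin θ)) : I.IsSolution r θ := by
  refine ⟨hr, hθ, fun r' hr' θ' _ => ?_⟩
  rw [covered_eq hI, covered_eq hI]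
  rw [segment_eq_image'] at hr'
  obtain ⟨t, ⟨ht0, ht1⟩, rfl⟩ := hr'
  obtain ⟨σ, u, hσ, hc, hs⟩ := exists_param (Real.cos_sq_add_sin_sq θ')
  have e : I.a + t • (I.b - I.a) = center I.a I.dir t := by
    ext <;> simp [center, dir]
  change I.cov (I.a + t • (I.b - I.a)) _ _ ≤ _
  rw [e, ← hc, ← hs]
  obtain ⟨A, B, hAB, hv, hle⟩ := exists_curve hI (σ := σ) (u := u) ht0 ht1
  exact hle.trans (h σ hσ A B hAB u hv)

theorem center_mem_segment {t : ℝ} (h0 : 0 ≤ t) (h1 : t ≤ 1) :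
    center I.a I.dir t ∈ segment ℝ I.a I.b := by
  rw [segment_eq_image']
  exact ⟨t, ⟨h0, h1⟩, by ext <;> simp [center, dir]⟩

end Instance

end MCR

namespace MCR
open RealRAM

/-! ### Sample parameters -/

/-- The midpoint between `τ` and the next larger element of `S`. -/
noncomputable def nextMid (S : Finset ℝ) (τ : ℝ) : ℝ :=
  if h : (S.filter (τ < ·)).Nonempty then (τ + (S.filter (τ < ·)).min' h) / 2 else τ + 1

theorem lt_nextMid (S : Finset ℝ) (τ : ℝ) : τ < nextMid S τ := by
  unfold nextMid
  split_ifs with h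
  · have := (Finset.mem_filter.1 (Finset.min'_mem _ h)).2
    linarith
  · linarith

theorem nextMid_lt {S : Finset ℝ} {τ x : ℝ} (hx : x ∈ S) (h : τ < x) : nextMid S τ < x := by
  have hm : x ∈ S.filter (τ < ·) := Finset.mem_filter.2 ⟨hx, h⟩
  rw [nextMid, dif_pos ⟨x, hm⟩]
  have := Finset.min'_le _ _ hm
  linarith

theorem nextMid_of_forall_le {S : Finset ℝ} {τ : ℝ} (h : ∀ x ∈ S, x ≤ τ) :
    nextMid S τ = τ + 1 := by
  rw [nextMid, dif_neg]
  rintro ⟨x, hx⟩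
  rw [Finset.mem_filter] at hx
  exact absurd (h x hx.1) (not_le.2 hx.2)

theorem nextMid_of_isLeast {S : Finset ℝ} {τ x : ℝ} (hx : x ∈ S) (h : τ < x)
    (hmin : ∀ y ∈ S, τ < y → x ≤ y) : nextMid S τ = (τ + x) / 2 := by
  have hm : x ∈ S.filter (τ < ·) := Finset.mem_filter.2 ⟨hx, h⟩
  rw [nextMid, dif_pos ⟨x, hm⟩]
  congr 2
  refine le_antisymm (Finset.min'_le _ _ hm) (Finset.le_min' _ _ _ fun y hy => ?_)
  rw [Finset.mem_filter] at hy
  exact hmin y hy.1 hy.2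

/-- The pair of a point and an edge that is responsible for the sample with index `e`. -/
def pairOf (M e : ℕ) : ℕ := e / 32 % M

/-- The first `N` samples are critical parameters, the next `N` ones follow them immediately, and
the last `N` ones precede all of them. -/
structure Samples (N : ℕ) (val : ℕ → ℝ) : Prop where
  mid : ∀ e < N, val (N + e) = nextMid ((Finset.range N).image val) (val e)
  start : ∀ e < N, ∀ e' < N, val (2 * N + e) < val e'

namespace Samples
variable {N M : ℕ} {val : ℕ → ℝ}

theorem val_mem {e : ℕ} (he : e < N) : val e ∈ (Finset.range N).image val :=
  Finset.mem_image_of_mem _ (Finset.mem_range.2 he)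

/-- Let `e₁` be the last sample of pair `p` up to `e₀`. A critical value of `p` in between must
equal `val e₁`, and its midpoint sample belongs to `p` too, so it comes after `e₀`. But no sample
lies strictly between a critical value and the midpoint following it. -/
theorem no_crit_between (h : Samples N val) (hN : N = 32 * M) {e₀ e₁ p : ℕ} (h0 : e₀ < 3 * N)
    (hle : val e₁ ≤ val e₀)
    (hlast : ∀ e < 3 * N, pairOf M e = p → ¬ (val e₁ < val e ∧ val e ≤ val e₀))
    (hne : val e₁ ≠ val e₀) {e : ℕ} (he : e < N) (hp : pairOf M e = p) :
    ¬ (val e₁ ≤ val e ∧ val e ≤ val e₀) := by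
  rintro ⟨h1, h2⟩
  have e1 : val e = val e₁ := by
    by_contra hc
    exact hlast e (by omega) hp ⟨lt_of_le_of_ne h1 (Ne.symm hc), h2⟩
  have hlt : val e < val e₀ := by rw [e1]; exact lt_of_le_of_ne hle hne
  have hp' : pairOf M (N + e) = p := by
    rw [← hp, pairOf, pairOf, hN, Nat.mul_add_div (by omega), Nat.add_mod_left]
  have hm := lt_nextMid ((Finset.range N).image val) (val e)
  have h3 : val e₀ < nextMid ((Finset.range N).image val) (val e) := by
    have := hlast (N + e) (by omega) hp'
    rw [h.mid e he, ← e1] at this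
    by_contra hc
    exact this ⟨hm, not_lt.1 hc⟩
  rcases lt_or_ge e₀ N with h4 | h4
  · exact absurd (nextMid_lt (val_mem h4) hlt) (not_lt.2 h3.le)
  obtain ⟨e₂, rfl⟩ := Nat.exists_eq_add_of_le h4
  rcases lt_or_ge e₂ N with h5 | h5
  · rw [h.mid e₂ h5] at h3 hlt
    rcases lt_trichotomy (val e₂) (val e) with h6 | h6 | h6
    · exact absurd (nextMid_lt (val_mem he) h6) (not_lt.2 hlt.le)
    · rw [h6] at h3; exact lt_irrefl _ h3
    · have := nextMid_lt (val_mem h5) h6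
      have := lt_nextMid ((Finset.range N).image val) (val e₂)
      linarith
  · obtain ⟨e₃, rfl⟩ := Nat.exists_eq_add_of_le h5
    have := h.start e₃ (by omega) e he
    rw [two_mul, add_assoc] at this
    linarith

/-- A noncritical `u` shares its gap with the midpoint sample of the largest critical value below
it, or with a starting sample if there is none. -/
theorem exists_sample (h : Samples N val) (hN : 0 < N) (u : ℝ) : ∃ e₀ < 3 * N, val e₀ = u ∨
    ∀ e < N, ¬ (min u (val e₀) ≤ val e ∧ val e ≤ max u (val e₀)) := by
  by_cases h1 : ∃ e < N, val e = u
  · obtain ⟨e, he, hu⟩ := h1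
    exact ⟨e, by omega, Or.inl hu⟩
  push Not at h1
  by_cases h2 : ∃ e < N, val e < u
  · obtain ⟨e, he, hmax⟩ := Finset.exists_max_image ((Finset.range N).filter fun e => val e < u) val
      (by obtain ⟨e, he, hu⟩ := h2; exact ⟨e, by simp [he, hu]⟩)
    simp only [Finset.mem_filter, Finset.mem_range, and_imp] at he hmax
    refine ⟨N + e, by omega, Or.inr fun e' he' => ?_⟩
    rw [h.mid e he.1]
    rintro ⟨h3, h4⟩
    have hm := lt_nextMid ((Finset.range N).image val) (val e)
    rcases lt_or_ge (val e') u with h5 | h5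
    · have := hmax e' he' h5
      rcases min_le_iff.1 h3 with h6 | h6 <;> linarith
    · have h6 : u < val e' := lt_of_le_of_ne h5 (Ne.symm (h1 e' he'))
      have := nextMid_lt (val_mem he') (he.2.trans h6)
      rcases le_max_iff.1 h4 with h7 | h7 <;> linarith
  · push Not at h2
    refine ⟨2 * N + 0, by omega, Or.inr fun e' he' => ?_⟩
    have := h.start 0 hN e' he'
    have h5 : u < val e' := lt_of_le_of_ne (h2 e' he') (Ne.symm (h1 e' he'))
    rintro ⟨-, h4⟩
    rcases le_max_iff.1 h4 with h7 | h7 <;> linarith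

end Samples

namespace Instance
variable {n m : ℕ} (I : Instance n m) (σ : ℝ) (A B : Quad ℝ)

/-- The vertices of the edge of a pair. -/
noncomputable def tail (p : ℕ) : ℝ × ℝ := I.vert (p % m)
noncomputable def head (p : ℕ) : ℝ × ℝ := I.vert ((p % m + 1) % m)

noncomputable def pairCrit (p o : ℕ) : ℝ :=
  critVal σ I.a I.dir A B (I.pt (p / m)) (I.tail p) (I.head p) o

noncomputable def pairPos (p : ℕ) (u : ℝ) : ℝ × ℝ := onCurve σ I.a I.dir A B (I.pt (p / m)) u

noncomputable def pairChi (p : ℕ) (u : ℝ) : ℕ := chiN (I.tail p) (I.head p) (I.pairPos σ A B p u)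
noncomputable def pairPsi (p : ℕ) (u : ℝ) : ℕ := psiN (I.tail p) (I.head p) (I.pairPos σ A B p u)

theorem covAt_eq (u : ℝ) : I.covAt σ A B u = ∑ i ∈ Finset.range n,
    statusOf (∑ j ∈ Finset.range m, I.pairChi σ A B (i * m + j) u)
      (∑ j ∈ Finset.range m, I.pairPsi σ A B (i * m + j) u) := by
  unfold covAt cov
  refine Finset.sum_congr rfl fun i hi => ?_
  rw [status]
  have h1 : ∀ j ∈ Finset.range m, (i * m + j) % m = j := fun j hj => by
    rw [mul_comm, Nat.mul_add_mod, Nat.mod_eq_of_lt (Finset.mem_range.1 hj)]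
  have h2 : ∀ j ∈ Finset.range m, (i * m + j) / m = i := fun j hj => by
    have := Finset.mem_range.1 hj
    rw [mul_comm, Nat.mul_add_div (by omega), Nat.div_eq_of_lt this, add_zero]
  congr 1 <;> refine Finset.sum_congr rfl fun j hj => ?_
  · rw [pairChi, tail, head, pairPos, h1 j hj, h2 j hj, onCurve]
  · rw [pairPsi, tail, head, pairPos, h1 j hj, h2 j hj, onCurve]

variable {I σ A B} {val : ℕ → ℝ}

/-- This justifies the lazy sweep: contributions stored at the last sample of a pair are still
correct at the current parameter. -/
theorem contributions_at_sample (h : Samples (32 * (n * m)) val)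
    (hval : ∀ e < 32 * (n * m), val e = I.pairCrit σ A B (e / 32) (e % 32)) {e₀ e₁ p : ℕ}
    (hp : p < n * m) (h0 : e₀ < 3 * (32 * (n * m)))
    (hle : val e₁ ≤ val e₀)
    (hlast : ∀ e < 3 * (32 * (n * m)), pairOf (n * m) e = p → ¬ (val e₁ < val e ∧ val e ≤ val e₀))
    (hA : A.at (val e₀) ≠ 0) :
    I.pairChi σ A B p (val e₁) = I.pairChi σ A B p (val e₀) ∧
      I.pairPsi σ A B p (val e₁) = I.pairPsi σ A B p (val e₀) := by
  by_cases hne : val e₁ = val e₀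
  · rw [hne]; exact ⟨rfl, rfl⟩
  refine contributions_onCurve hle (fun o ho => ?_) hA
  have := h.no_crit_between (M := n * m) rfl h0 hle hlast hne (e := 32 * p + o) (by omega)
    (by rw [pairOf, show (32 * p + o) / 32 = p by omega, Nat.mod_eq_of_lt hp])
  rwa [hval (32 * p + o) (by omega), show (32 * p + o) / 32 = p by omega,
    show (32 * p + o) % 32 = o by omega] at this

theorem exists_sample_covAt (h : Samples (32 * (n * m)) val) (hnm : 0 < n * m)
    (hval : ∀ e < 32 * (n * m), val e = I.pairCrit σ A B (e / 32) (e % 32)) {u : ℝ}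
    (hu : ValidAt A B u) : ∃ e₀ < 3 * (32 * (n * m)), ValidAt A B (val e₀) ∧
      I.covAt σ A B (val e₀) = I.covAt σ A B u := by
  obtain ⟨e₀, h0, h1⟩ := h.exists_sample (by omega) u
  refine ⟨e₀, h0, ?_⟩
  rcases h1 with rfl | h1
  · exact ⟨hu, rfl⟩
  have hcrit : ∀ p < n * m, ∀ o < 32, ¬ (min u (val e₀) ≤ I.pairCrit σ A B p o ∧
      I.pairCrit σ A B p o ≤ max u (val e₀)) := fun p hp o ho => by
    have := h1 (32 * p + o) (by omega)
    rwa [hval (32 * p + o) (by omega), show (32 * p + o) / 32 = p by omega,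
      show (32 * p + o) % 32 = o by omega] at this
  have hv : ValidAt A B (val e₀) := by
    have := validAt_congr (A := A) (B := B) min_le_max (hcrit 0 hnm)
    rcases le_total u (val e₀) with h2 | h2
    · rw [min_eq_left h2, max_eq_right h2] at this; exact this.1 hu
    · rw [min_eq_right h2, max_eq_left h2] at this; exact this.2 hu
  refine ⟨hv, ?_⟩
  have key : ∀ p < n * m, I.pairChi σ A B p (val e₀) = I.pairChi σ A B p u ∧
      I.pairPsi σ A B p (val e₀) = I.pairPsi σ A B p u := by
    intro p hp
    have hc := hcrit p hp
    rcases le_total u (val e₀) with h2 | h2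
    · rw [min_eq_left h2, max_eq_right h2] at hc
      have := contributions_onCurve (p := I.pt (p / m)) h2 hc hv.1
      exact ⟨this.1.symm, this.2.symm⟩
    · rw [min_eq_right h2, max_eq_left h2] at hc
      exact contributions_onCurve (p := I.pt (p / m)) h2 hc hu.1
  rw [covAt_eq, covAt_eq]
  refine Finset.sum_congr rfl fun i hi => ?_
  have hlt : ∀ j ∈ Finset.range m, i * m + j < n * m := fun j hj => by
    have h1 := Finset.mem_range.1 hi
    have h2 := Finset.mem_range.1 hj
    have := Nat.mul_le_mul_right m (Nat.succ_le_of_lt h1)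
    rw [Nat.succ_mul] at this
    omega
  congr 1 <;> refine Finset.sum_congr rfl fun j hj => ?_
  · exact (key _ (hlt j hj)).1
  · exact (key _ (hlt j hj)).2

end Instance

end MCR

/-! ### Derived program constructs -/

namespace RealRAM

/-- The remainder of `e` modulo `f`. -/
def WExpr.mod (e f : WExpr) : WExpr := e - e / f * f

@[simp] theorem WExpr.eval_mod (s : State) (e f : WExpr) :
    (e.mod f).eval s = e.eval s % f.eval s := by
  simp [WExpr.mod, Nat.mod_eq_sub_div_mul]

def Test.or (a b : Test) : Test := .not (.and (.not a) (.not b))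

@[simp] theorem Test.eval_or (s : State) (a b : Test) :
    (a.or b).eval s ↔ a.eval s ∨ b.eval s := by
  simp only [Test.or, Test.eval_not, Test.eval_and]; tauto

/-- `f 0; f 1; …; f (k - 1)` -/
def Program.unroll (f : ℕ → Program) : ℕ → Program
  | 0 => .skip
  | k + 1 => .seq (unroll f k) (f k)

/-- The rank of a root is part of the program text, so the 32 critical parameters of a pair come
from unrolled code and not from a loop. -/
theorem Straight.unroll {w : ℕ} {f : ℕ → Program} {s : State} {I : ℕ → State → Prop} {k : ℕ}
    (hs : s.Fits w) (h0 : I 0 s) (hstep : ∀ o < k, ∀ s, I o s → Straight w (f o) s (I (o + 1))) :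
    Straight w (.unroll f k) s (I k) := by
  induction k with
  | zero => exact .skip hs h0
  | succ k ih =>
    exact .seq ((ih fun o ho => hstep o (by omega)).imp fun s' => hstep k (by omega) s')

/-- The value of a pair of expressions. -/
noncomputable def evalPair (s : State) (e : RExpr × RExpr) : ℝ × ℝ := (e.1.eval s, e.2.eval s)

end RealRAM

namespace MCR
open RealRAM

/-! ### The memory -/

/-- The space suffices for `n` points and `m` vertices. -/
structure Room (n m w : ℕ) : Prop where
  n_pos : 0 < n
  m_pos : 0 < m
  n_le : n ≤ n * m
  m_le : m ≤ n * m
  space : 1000 * (n * m) ≤ w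

/-- The number of real cells used for the input. -/
def inputLen (n m : ℕ) : ℕ := 4 + 2 * n + 2 * m

theorem inputLen_eq (n m : ℕ) : inputLen n m = 4 + 2 * n + 2 * m := rfl

/-- The memory holds the input and the basic parameters. -/
structure Ctx {n m : ℕ} (I : Instance n m) (s : State) : Prop where
  n_eq : s.word 0 = n
  m_eq : s.word 1 = m
  base : s.word 2 = inputLen n m
  pairs : s.word 3 = n * m
  crits : s.word 4 = 32 * (n * m)
  a1 : s.real 0 = I.a.1
  a2 : s.real 1 = I.a.2
  b1 : s.real 2 = I.b.1
  b2 : s.real 3 = I.b.2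
  pt1 : ∀ i < n, s.real (4 + 2 * i) = (I.pt i).1
  pt2 : ∀ i < n, s.real (5 + 2 * i) = (I.pt i).2
  vert1 : ∀ j < m, s.real (4 + 2 * n + 2 * j) = (I.vert j).1
  vert2 : ∀ j < m, s.real (5 + 2 * n + 2 * j) = (I.vert j).2

/-- The memory holds the curve given by `σ`, `A` and `B`. -/
structure OnCurve (n m : ℕ) (σ : ℝ) (A B : Quad ℝ) (s : State) : Prop where
  sig : s.real (inputLen n m) = σ
  A0 : s.real (inputLen n m + 1) = A.c0
  A1 : s.real (inputLen n m + 2) = A.c1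
  A2 : s.real (inputLen n m + 3) = A.c2
  B0 : s.real (inputLen n m + 4) = B.c0
  B1 : s.real (inputLen n m + 5) = B.c1
  B2 : s.real (inputLen n m + 6) = B.c2

variable {n m w : ℕ} {I : Instance n m} {σ : ℝ} {A B : Quad ℝ} {s s' : State}

theorem Ctx.congr (h : Ctx I s) (hw : ∀ x < 5, s'.word x = s.word x)
    (hr : ∀ x < inputLen n m, s'.real x = s.real x) : Ctx I s' := by
  have e := inputLen_eq n m
  constructor
  · rw [hw 0 (by omega), h.n_eq]
  · rw [hw 1 (by omega), h.m_eq]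
  · rw [hw 2 (by omega), h.base]
  · rw [hw 3 (by omega), h.pairs]
  · rw [hw 4 (by omega), h.crits]
  · rw [hr 0 (by omega), h.a1]
  · rw [hr 1 (by omega), h.a2]
  · rw [hr 2 (by omega), h.b1]
  · rw [hr 3 (by omega), h.b2]
  · intro i hi; rw [hr _ (by omega), h.pt1 i hi]
  · intro i hi; rw [hr _ (by omega), h.pt2 i hi]
  · intro j hj; rw [hr _ (by omega), h.vert1 j hj]
  · intro j hj; rw [hr _ (by omega), h.vert2 j hj]

theorem OnCurve.congr (h : OnCurve n m σ A B s)
    (hr : ∀ c < 7, s'.real (inputLen n m + c) = s.real (inputLen n m + c)) :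
    OnCurve n m σ A B s' := by
  constructor
  · rw [← h.sig]; exact hr 0 (by omega)
  · rw [← h.A0]; exact hr 1 (by omega)
  · rw [← h.A1]; exact hr 2 (by omega)
  · rw [← h.A2]; exact hr 3 (by omega)
  · rw [← h.B0]; exact hr 4 (by omega)
  · rw [← h.B1]; exact hr 5 (by omega)
  · rw [← h.B2]; exact hr 6 (by omega)

/-! ### Expressions -/

namespace Code

def aE : RExpr × RExpr := (.cell 0, .cell 1)
def dirE : RExpr × RExpr := (.cell 2 - .cell 0, .cell 3 - .cell 1)
def ptE (i : WExpr) : RExpr × RExpr := (.cell (4 + 2 * i), .cell (5 + 2 * i))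
def vertE (j : WExpr) : RExpr × RExpr :=
  (.cell (4 + 2 * wvar 0 + 2 * j), .cell (5 + 2 * wvar 0 + 2 * j))
def tailE (p : WExpr) : RExpr × RExpr := vertE (p.mod (wvar 1))
def headE (p : WExpr) : RExpr × RExpr := vertE ((p.mod (wvar 1) + 1).mod (wvar 1))
-- Real cells beyond the input, relative to the base in integer cell 2: offset 0 holds `σ`, 1 to 3
-- hold `A`, 4 to 6 hold `B`, 11 to 13 hold the best center and angle, and the sample parameters
-- start at 64.
def sigE : RExpr := .cell (wvar 2)
def coefA : Quad RExpr := ⟨.cell (wvar 2 + 1), .cell (wvar 2 + 2), .cell (wvar 2 + 3)⟩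
def coefB : Quad RExpr := ⟨.cell (wvar 2 + 4), .cell (wvar 2 + 5), .cell (wvar 2 + 6)⟩
def atE (A : Quad RExpr) (u : RExpr) : RExpr := A.c0 + A.c1 * u + A.c2 * (u * u)
def timeE (u : RExpr) : RExpr := (0 - atE coefB u) / atE coefA u
def cosE (u : RExpr) : RExpr := sigE * (1 - u * u) / (1 + u * u)
def sinE (u : RExpr) : RExpr := sigE * (2 * u) / (1 + u * u)
def centerE (u : RExpr) : RExpr × RExpr :=
  (aE.1 + timeE u * dirE.1, aE.2 + timeE u * dirE.2)
def turnE (r : RExpr × RExpr) (c s : RExpr) (p : RExpr × RExpr) : RExpr × RExpr :=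
  (r.1 + (c * (p.1 - r.1) - s * (p.2 - r.2)), r.2 + (s * (p.1 - r.1) + c * (p.2 - r.2)))
def posE (p : WExpr) (u : RExpr) : RExpr × RExpr :=
  turnE (centerE u) (cosE u) (sinE u) (ptE (p / wvar 1))
def critE (p : WExpr) (o : ℕ) : RExpr :=
  .root 4 (critCoef sigE aE.1 aE.2 dirE.1 dirE.2 (ptE (p / wvar 1)).1 (ptE (p / wvar 1)).2
    (tailE p).1 (tailE p).2 (headE p).1 (headE p).2 coefA coefB (o / 4)) (o % 4)

def crE (v w q : RExpr × RExpr) : RExpr :=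
  (w.1 - v.1) * (q.2 - v.2) - (w.2 - v.2) * (q.1 - v.1)

def rayTest (v w q : RExpr × RExpr) : Test :=
  .or (.and (.not (.rlt (q.1 - v.1) 0)) (.and (.rlt (q.1 - w.1) 0) (.rlt (crE v w q) 0)))
    (.and (.not (.rlt (q.1 - w.1) 0)) (.and (.rlt (q.1 - v.1) 0) (.rlt 0 (crE v w q))))

def edgeTest (v w q : RExpr × RExpr) : Test :=
  .and (.and (.not (.rlt (crE v w q) 0)) (.not (.rlt 0 (crE v w q))))
    (.and (.not (.rlt 0 ((q.1 - v.1) * (q.1 - w.1)))) (.not (.rlt 0 ((q.2 - v.2) * (q.2 - w.2)))))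

/-- The condition that the parameter `u` corresponds to a point of the segment. -/
def validTest (u : RExpr) : Test :=
  .and (.or (.rlt (atE coefA u) 0) (.rlt 0 (atE coefA u)))
    (.and (.not (.rlt (timeE u) 0)) (.not (.rlt 1 (timeE u))))

end Code

open Code

theorem eval_crE (s : State) (v w q : RExpr × RExpr) : (crE v w q).eval s =
    cr (evalPair s w - evalPair s v) (evalPair s q - evalPair s v) := by
  simp [crE, cr, evalPair]

theorem eval_rayTest (s : State) (v w q : RExpr × RExpr) : (rayTest v w q).eval s ↔
    RayCross (evalPair s v) (evalPair s w) (evalPair s q) := by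
  simp only [rayTest, RayCross, Test.eval_or, Test.eval_and, Test.eval_not, Test.eval_rlt, eval_crE,
    RExpr.eval_sub, RExpr.eval_ofNat, evalPair, not_lt]
  simp

theorem eval_edgeTest (s : State) (v w q : RExpr × RExpr) : (edgeTest v w q).eval s ↔
    OnEdge (evalPair s v) (evalPair s w) (evalPair s q) := by
  simp only [edgeTest, OnEdge, Test.eval_and, Test.eval_not, Test.eval_rlt, eval_crE,
    RExpr.eval_sub, RExpr.eval_mul, RExpr.eval_ofNat, evalPair, not_lt]
  simp [le_antisymm_iff, and_comm]

namespace Ctx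
variable (h : Ctx I s)
include h

theorem evalPair_aE : evalPair s aE = I.a := by
  ext <;> simp [evalPair, aE, h.a1, h.a2]

theorem evalPair_dirE : evalPair s dirE = I.dir := by
  ext <;> simp [evalPair, dirE, Instance.dir, h.a1, h.a2, h.b1, h.b2]

theorem evalPair_ptE {i : WExpr} (hi : i.eval s < n) : evalPair s (ptE i) = I.pt (i.eval s) := by
  ext <;> simp [evalPair, ptE, h.pt1 _ hi, h.pt2 _ hi]

theorem evalPair_vertE {j : WExpr} (hj : j.eval s < m) :
    evalPair s (vertE j) = I.vert (j.eval s) := by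
  ext <;> simp [evalPair, vertE, h.n_eq, h.vert1 _ hj, h.vert2 _ hj]

theorem evalPair_tailE (hm : 0 < m) (p : WExpr) : evalPair s (tailE p) = I.tail (p.eval s) := by
  rw [tailE, h.evalPair_vertE] <;> simp [h.m_eq, Instance.tail, Nat.mod_lt _ hm]

theorem evalPair_headE (hm : 0 < m) (p : WExpr) : evalPair s (headE p) = I.head (p.eval s) := by
  rw [headE, h.evalPair_vertE]
  · simp [h.m_eq, Instance.head]
  · simp only [WExpr.eval_mod, eval_wvar, h.m_eq]; exact Nat.mod_lt _ hm

variable (hc : OnCurve n m σ A B s)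
include hc

theorem eval_sigE : sigE.eval s = σ := by simp [sigE, h.base, hc.sig]

theorem evalE_coefA : coefA.evalE s = A := by
  simp [coefA, Quad.evalE, h.base, hc.A0, hc.A1, hc.A2]

theorem evalE_coefB : coefB.evalE s = B := by
  simp [coefB, Quad.evalE, h.base, hc.B0, hc.B1, hc.B2]

theorem eval_atA (u : RExpr) : (atE coefA u).eval s = A.at (u.eval s) := by
  simp [atE, Quad.at, coefA, h.base, hc.A0, hc.A1, hc.A2, sq]

theorem eval_timeE (u : RExpr) :
    (timeE u).eval s = (0 - B.at (u.eval s)) / A.at (u.eval s) := by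
  simp [timeE, atE, Quad.at, coefA, coefB, h.base, hc.A0, hc.A1, hc.A2, hc.B0, hc.B1, hc.B2, sq]

theorem eval_cosE (u : RExpr) : (cosE u).eval s = cosU σ (u.eval s) := by
  simp [cosE, cosU, h.eval_sigE hc]

theorem eval_sinE (u : RExpr) : (sinE u).eval s = sinU σ (u.eval s) := by
  simp [sinE, sinU, h.eval_sigE hc]

theorem evalPair_centerE (u : RExpr) : evalPair s (centerE u) =
    center I.a I.dir ((0 - B.at (u.eval s)) / A.at (u.eval s)) := by
  have h1 := h.evalPair_aE
  have h2 := h.evalPair_dirE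
  rw [evalPair] at h1 h2 ⊢
  simp only [centerE, RExpr.eval_add, RExpr.eval_mul, h.eval_timeE hc, center, ← h1, ← h2]

theorem evalPair_posE {p : WExpr} (hp : p.eval s < n * m) (u : RExpr) :
    evalPair s (posE p u) = I.pairPos σ A B (p.eval s) (u.eval s) := by
  have hd : (p / wvar 1).eval s < n := by
    simp only [WExpr.eval_div, eval_wvar, h.m_eq]
    exact Nat.div_lt_of_lt_mul (by rwa [mul_comm])
  have h1 := h.evalPair_ptE hd
  have h2 := h.evalPair_centerE hc u
  simp only [WExpr.eval_div, eval_wvar, h.m_eq] at h1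
  rw [Instance.pairPos, onCurve, ← h2, ← h1]
  simp only [evalPair, posE, turnE, turn, RExpr.eval_add, RExpr.eval_sub, RExpr.eval_mul,
    h.eval_cosE hc, h.eval_sinE hc]

theorem eval_critE (hm : 0 < m) {p : WExpr} (hp : p.eval s < n * m) (o : ℕ) :
    (critE p o).eval s = I.pairCrit σ A B (p.eval s) o := by
  have hd : (p / wvar 1).eval s < n := by
    simp only [WExpr.eval_div, eval_wvar, h.m_eq]
    exact Nat.div_lt_of_lt_mul (by rwa [mul_comm])
  have h1 := h.evalPair_ptE hd
  simp only [WExpr.eval_div, eval_wvar, h.m_eq] at h1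
  rw [critE, RExpr.eval_root, Instance.pairCrit, critVal]
  simp only [eval_critCoef, h.eval_sigE hc, h.evalE_coefA hc, h.evalE_coefB hc, ← h1,
    ← h.evalPair_aE, ← h.evalPair_dirE, ← h.evalPair_tailE hm p, ← h.evalPair_headE hm p, evalPair]

theorem eval_validTest (u : RExpr) : (validTest u).eval s ↔ ValidAt A B (u.eval s) := by
  simp only [validTest, Test.eval_or, Test.eval_and, Test.eval_not, Test.eval_rlt,
    h.eval_timeE hc, h.eval_atA hc, ValidAt]
  simp [lt_or_lt_iff_ne]

end Ctx

end MCR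

namespace MCR
open RealRAM Code

/-! ### Generating and sorting the sample parameters -/

/-- Everything is unchanged but the working space of the generation of the samples. -/
structure PrepFrame (n m : ℕ) (s s' : State) : Prop where
  word_low : ∀ x < 10, s'.word x = s.word x
  word_high : ∀ x, 64 ≤ x → 2 ≤ x % 8 → s'.word x = s.word x
  real_low : ∀ x < inputLen n m + 64, s'.real x = s.real x

namespace PrepFrame
variable {n m w : ℕ} {I : Instance n m} {σ : ℝ} {A B : Quad ℝ} {s s' s'' : State}

theorem refl : PrepFrame n m s s := ⟨fun _ _ => rfl, fun _ _ _ => rfl, fun _ _ => rfl⟩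

theorem trans (h : PrepFrame n m s s') (h' : PrepFrame n m s' s'') : PrepFrame n m s s'' :=
  ⟨fun x hx => (h'.1 x hx).trans (h.1 x hx), fun x hx hx' => (h'.2 x hx hx').trans (h.2 x hx hx'),
    fun x hx => (h'.3 x hx).trans (h.3 x hx)⟩

theorem setWord (h : PrepFrame n m s s') {a v : ℕ} (h1 : 10 ≤ a) (h2 : a < 64) :
    PrepFrame n m s (s'.setWord a v) :=
  ⟨fun x hx => by rw [State.word_setWord_of_ne _ _ (by omega)]; exact h.1 x hx,
    fun x hx hx' => by rw [State.word_setWord_of_ne _ _ (by omega)]; exact h.2 x hx hx', h.3⟩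

theorem setReal (h : PrepFrame n m s s') {a : ℕ} {v : ℝ} (h1 : inputLen n m + 64 ≤ a) :
    PrepFrame n m s (s'.setReal a v) :=
  ⟨h.1, h.2, fun x hx => by rw [State.real_setReal_of_ne _ _ (by omega)]; exact h.3 x hx⟩

theorem ctx (h : PrepFrame n m s s') (hc : Ctx I s) : Ctx I s' :=
  hc.congr (fun x hx => h.1 x (by omega)) fun x hx => h.3 x (by omega)

theorem onCurve (h : PrepFrame n m s s') (hc : OnCurve n m σ A B s) : OnCurve n m σ A B s' :=
  hc.congr fun c hc => h.3 _ (by omega)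

end PrepFrame

theorem _root_.RealRAM.SortFrame.prepFrame {n m : ℕ} {s s' : State} (h : SortFrame s s') :
    PrepFrame n m s s' :=
  ⟨fun x hx => h.2 x (by omega), fun x hx hx' => h.2 x (by omega), fun x _ => by rw [h.1]⟩

theorem Ctx.valOf_eq {n m : ℕ} {I : Instance n m} {s : State} (h : Ctx I s) (x : ℕ) :
    valOf s x = s.real (inputLen n m + 64 + x) := by rw [valOf, h.base]

theorem Ctx.valOf_setReal {n m : ℕ} {I : Instance n m} {s : State} (h : Ctx I s) (e x : ℕ) (v : ℝ) :
    valOf (s.setReal (inputLen n m + 64 + e) v) x = if x = e then v else valOf s x := by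
  simp [valOf, h.base, State.real_setReal]

@[simp] theorem valOf_setWord {s : State} {a v : ℕ} (h : 64 ≤ a ∨ (2 < a)) :
    valOf (s.setWord a v) = valOf s := by
  funext x
  rw [valOf, valOf, State.word_setWord_of_ne _ _ (by omega), State.real_setWord]

namespace Code

/-- The address of the parameter with index `e`. -/
def valAddr (e : WExpr) : WExpr := wvar 2 + 64 + e

def gen : Program :=
  .for 20 (wvar 3) (.unroll (fun o =>
    .rset (valAddr (32 * wvar 20 + .lit o)) (critE (wvar 20) o)) 32)

/-- The sorted critical parameters are visited from the largest down. A parameter strictly below its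
successor gets their midpoint, a tie copies the sample already computed for the successor, and the
last one gets its value plus one. -/
def midStep : Program :=
  .seq (.wset 24 (Prog.idx (wvar 4 - 1 - wvar 21)))
  (.seq (.wset 25 (Prog.idx (wvar 4 - 1 - wvar 21 + 1)))
  (.ite (.wlt 0 (wvar 21))
    (.ite (.rlt (Prog.val (wvar 24)) (Prog.val (wvar 25)))
      (.rset (valAddr (wvar 4 + wvar 24)) ((Prog.val (wvar 24) + Prog.val (wvar 25)) / 2))
      (.rset (valAddr (wvar 4 + wvar 24)) (Prog.val (wvar 4 + wvar 25))))
    (.rset (valAddr (wvar 4 + wvar 24)) (Prog.val (wvar 24) + 1))))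

def mid : Program := .for 21 (wvar 4) midStep

/-- There are `32nm` equal starting samples so that, by the indexing rule of `pairOf`, every pair
owns some of them. -/
def start : Program :=
  .for 22 (wvar 4) (.rset (valAddr (2 * wvar 4 + wvar 22)) (Prog.val (Prog.idx 0) - 1))

def prepare : Program :=
  .seq gen (.seq (.seq (.wset (.lit 10) (wvar 4)) Prog.sort) (.seq mid (.seq start
    (.seq (.wset (.lit 10) (3 * wvar 4)) Prog.sort))))

end Code

@[simp] theorem eval_valAddr (s : State) (e : WExpr) :
    (valAddr e).eval s = s.word 2 + 64 + e.eval s := rfl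

theorem Room.cells {n m w : ℕ} (h : Room n m w) : inputLen n m + 64 + 96 * (n * m) < w ∧
    64 + 8 * (96 * (n * m)) + 72 < w := by
  have := h.n_pos; have := h.m_pos; have := h.n_le; have := h.m_le; have := h.space
  have := inputLen_eq n m
  omega

theorem ok_gen : ∃ K, ∀ (n m w : ℕ) (I : Instance n m) (σ : ℝ) (A B : Quad ℝ) (s : State),
    Room n m w → Ctx I s → OnCurve n m σ A B s → s.Fits w →
    Ok w gen s (K * (n * m + 1)) (fun s' => s'.Fits w ∧ PrepFrame n m s s' ∧
      ∀ e < 32 * (n * m), valOf s' e = I.pairCrit σ A B (e / 32) (e % 32)) := by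
  refine ⟨_, fun n m w I σ A B s hw hc hu hs => (Ok.for (N := n * m) (T := Program.time (.unroll (fun o =>
    .rset (valAddr (32 * wvar 20 + .lit o)) (critE (wvar 20) o)) 32))
    (I := fun p s' => s'.Fits w ∧ PrepFrame n m s s' ∧
      ∀ e < 32 * p, valOf s' e = I.pairCrit σ A B (e / 32) (e % 32))
    (by have := hw.cells; omega) (by have := hw.cells; omega) hs ?_ ?_ ?_ ?_).imp ?_⟩
  · rintro k s' ⟨h1, h2, -⟩
    exact ⟨h1, by rw [eval_wvar, (h2.ctx hc).pairs]⟩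
  · rintro k s' v ⟨h1, h2, h3⟩ hv
    exact ⟨h1.setWord (by have := hw.cells; omega) hv, h2.setWord (by omega) (by omega),
      by rwa [valOf_setWord (by omega)]⟩
  · exact ⟨hs.setWord (by have := hw.cells; omega) (by omega), PrepFrame.refl.setWord (by omega) (by omega),
      by simp⟩
  · rintro k hk s' ⟨h1, h2, h3⟩ hk'
    refine Ok.imp (Straight.unroll (I := fun o s'' => s''.Fits w ∧ PrepFrame n m s s'' ∧
      s''.word 20 = k ∧ ∀ e < 32 * k + o, valOf s'' e = I.pairCrit σ A B (e / 32) (e % 32))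
      h1 ⟨h1, h2, hk', h3⟩ ?_) ?_
    · rintro o ho s1 ⟨g1, g2, g3, g4⟩
      have c1 := g2.ctx hc
      have hcr := c1.eval_critE (g2.onCurve hu) hw.m_pos (p := wvar 20) (by simpa [g3] using hk) o
      have ha : (valAddr (32 * wvar 20 + .lit o)).eval s1 =
          inputLen n m + 64 + (32 * k + o) := by simp [c1.base, g3]
      refine Straight.rset g1 (by have := hw.cells; omega) fun F => ⟨F, ?_, g3, ?_⟩
      · exact g2.setReal (by omega)
      · intro e he
        rw [ha, c1.valOf_setReal, hcr]
        split_ifs with h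
        · rw [h, show (32 * k + o) / 32 = k by omega, show (32 * k + o) % 32 = o by omega,
            eval_wvar, g3]
        · exact g4 e (by omega)
    · rintro s1 ⟨g1, g2, g3, g4⟩
      exact ⟨g3, g1, g2, fun e he => g4 e (by omega)⟩
  · rintro s' ⟨-, h⟩
    exact h

theorem sorted_of_adjacent {N : ℕ} {key : ℕ → ℝ} {f : ℕ → ℕ}
    (h : ∀ x, x + 1 < N → key (f x) ≤ key (f (x + 1))) {x y : ℕ} (hxy : x ≤ y) (hy : y < N) :
    key (f x) ≤ key (f y) := by
  induction y, hxy using Nat.le_induction with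
  | base => exact le_rfl
  | succ y hxy ih => exact (ih (by omega)).trans (h y hy)

/-- The index array lists `0, …, L - 1` by increasing parameters. -/
structure Ordered (L : ℕ) (s : State) : Prop where
  range : ∀ x < L, idxOf s x < L
  surj : ∀ e < L, ∃ x < L, idxOf s x = e
  sorted : ∀ x, x + 1 < L → valOf s (idxOf s x) ≤ valOf s (idxOf s (x + 1))

end MCR

namespace MCR
open RealRAM Code

namespace Ordered
variable {N : ℕ} {s : State} (h : Ordered N s)
include h

theorem mono {x y : ℕ} (hxy : x ≤ y) (hy : y < N) : valOf s (idxOf s x) ≤ valOf s (idxOf s y) :=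
  sorted_of_adjacent h.sorted hxy hy

theorem mem_image {x : ℕ} (hx : x < N) :
    valOf s (idxOf s x) ∈ (Finset.range N).image (valOf s) :=
  Finset.mem_image_of_mem _ (Finset.mem_range.2 (h.range x hx))

theorem forall_image {P : ℝ → Prop} (hP : ∀ y < N, P (valOf s (idxOf s y))) :
    ∀ z ∈ (Finset.range N).image (valOf s), P z := by
  intro z hz
  obtain ⟨e, he, rfl⟩ := Finset.mem_image.1 hz
  obtain ⟨y, hy, rfl⟩ := h.surj e (Finset.mem_range.1 he)
  exact hP y hy

theorem nextMid_last {x : ℕ} (hx : x + 1 = N) :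
    nextMid ((Finset.range N).image (valOf s)) (valOf s (idxOf s x)) =
      valOf s (idxOf s x) + 1 :=
  nextMid_of_forall_le (h.forall_image fun y hy => h.mono (by omega) (by omega))

theorem nextMid_lt {x : ℕ} (hx : x + 1 < N)
    (hlt : valOf s (idxOf s x) < valOf s (idxOf s (x + 1))) :
    nextMid ((Finset.range N).image (valOf s)) (valOf s (idxOf s x)) =
      (valOf s (idxOf s x) + valOf s (idxOf s (x + 1))) / 2 := by
  refine nextMid_of_isLeast (h.mem_image hx) hlt (h.forall_image fun y hy hxy => ?_)
  refine h.mono ?_ hy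
  by_contra hc
  exact absurd (h.mono (show y ≤ x by omega) (by omega)) (not_le.2 hxy)

end Ordered

theorem ok_mid : ∃ K, ∀ (n m w : ℕ) (I : Instance n m) (s : State),
    Room n m w → Ctx I s → s.Fits w → Ordered (32 * (n * m)) s →
    Ok w mid s (K * (32 * (n * m) + 1)) (fun s' => s'.Fits w ∧ PrepFrame n m s s' ∧
      (∀ e < 32 * (n * m), valOf s' e = valOf s e) ∧ idxOf s' = idxOf s ∧
      ∀ e < 32 * (n * m), valOf s' (32 * (n * m) + e) =
        nextMid ((Finset.range (32 * (n * m))).image (valOf s)) (valOf s e)) := by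
  refine ⟨(wvar 4).cost + Program.time midStep + 12, fun n m w I s hw hc hs ho => ?_⟩
  obtain ⟨r1, r2⟩ := hw.cells
  set N := 32 * (n * m) with hN
  refine (Ok.for (N := N) (T := Program.time midStep)
    (I := fun k s' => s'.Fits w ∧ PrepFrame n m s s' ∧ (∀ e < N, valOf s' e = valOf s e) ∧
      idxOf s' = idxOf s ∧ ∀ x < N, N ≤ x + k → valOf s' (N + idxOf s x) =
        nextMid ((Finset.range N).image (valOf s)) (valOf s (idxOf s x)))
    (by omega) (by omega) hs ?_ ?_ ?_ ?_).imp ?_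
  · rintro k s' ⟨h1, h2, -⟩
    exact ⟨h1, by rw [eval_wvar, (h2.ctx hc).crits]⟩
  · rintro k s' v ⟨h1, h2, h3, h4, h5⟩ hv
    refine ⟨h1.setWord (by omega) hv, h2.setWord (by omega) (by omega), ?_, ?_, ?_⟩
    · rwa [valOf_setWord (by omega)]
    · rwa [idxOf_setWord_scalar (by omega)]
    · rwa [valOf_setWord (by omega)]
  · refine ⟨hs.setWord (by omega) (by omega), PrepFrame.refl.setWord (by omega) (by omega), ?_, ?_, ?_⟩
    · intro e _; rw [valOf_setWord (by omega)]
    · rw [idxOf_setWord_scalar (by omega)]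
    · intro x hx hx'; omega
  · rintro k hk s0 ⟨h1, h2, h3, h4, h5⟩ hk'
    have c0 := h2.ctx hc
    have hx : N - 1 - k < N := by omega
    have he := ho.range _ hx
    set x := N - 1 - k with hxk
    refine Straight.seq (Straight.wset h1 (by simp; omega) (h1.2 _) fun F1 => ?_)
    simp only [eval_idx, WExpr.eval_sub, eval_wvar, WExpr.eval_ofNat, h4, hk',
      c0.crits, ← hN, ← hxk] at F1 ⊢
    -- In the first round this reads one entry past the list. The content is not used then, and like
    -- every integer cell it is at most `w`.
    refine Straight.seq (Straight.wset F1 (by simp; omega) (F1.2 _) fun F2 => ?_)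
    simp only [eval_idx, WExpr.eval_sub, WExpr.eval_add, eval_wvar,
      WExpr.eval_ofNat, idxOf_setWord_scalar (show 24 < 64 by omega),
      State.word_setWord_of_ne _ _ (show 4 ≠ 24 by omega),
      State.word_setWord_of_ne _ _ (show 21 ≠ 24 by omega), h4, hk',
      c0.crits, ← hN, ← hxk] at F2 ⊢
    set s1 := (s0.setWord 24 (idxOf s x)).setWord 25 (idxOf s (x + 1)) with hs1
    have p1 : PrepFrame n m s s1 := (h2.setWord (by omega) (by omega)).setWord (by omega) (by omega)
    have c1 := p1.ctx hc
    have v1 : valOf s1 = valOf s0 := by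
      rw [hs1, valOf_setWord (by omega), valOf_setWord (by omega)]
    have i1 : idxOf s1 = idxOf s := by
      rw [hs1, idxOf_setWord_scalar (by omega), idxOf_setWord_scalar (by omega), h4]
    have w24 : s1.word 24 = idxOf s x := by simp [hs1, State.word_setWord]
    have w25 : s1.word 25 = idxOf s (x + 1) := by simp [hs1, State.word_setWord]
    have w21 : s1.word 21 = k := by simp [hs1, State.word_setWord, hk']
    have ha : (valAddr (wvar 4 + wvar 24)).eval s1 = inputLen n m + 64 + (N + idxOf s x) := by
      simp [c1.base, c1.crits, w24, hN]
    have hw4 : s1.word 4 = N := c1.crits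
    clear_value s1
    have store : ∀ f : RExpr, f.eval s1 = nextMid ((Finset.range N).image (valOf s))
        (valOf s (idxOf s x)) → Straight w (.rset (valAddr (wvar 4 + wvar 24)) f) s1 (fun s' =>
          s'.word 21 = k ∧ s'.Fits w ∧ PrepFrame n m s s' ∧ (∀ e < N, valOf s' e = valOf s e) ∧
          idxOf s' = idxOf s ∧ ∀ x < N, N ≤ x + (k + 1) → valOf s' (N + idxOf s x) =
            nextMid ((Finset.range N).image (valOf s)) (valOf s (idxOf s x))) := by
      intro f hf
      refine Straight.rset F2 (by omega) fun F3 => ?_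
      rw [ha] at F3 ⊢
      rw [hf] at F3 ⊢
      refine ⟨w21, F3, p1.setReal (by omega), ?_, i1, ?_⟩
      · intro e he'
        rw [c1.valOf_setReal, if_neg (by omega), v1, h3 e he']
      · intro y hy hy'
        rw [c1.valOf_setReal]
        split_ifs with e
        · rw [Nat.add_left_cancel e]
        · rw [v1]
          refine h5 y hy ?_
          by_contra hc'
          exact e (by rw [show y = x by omega])
    refine Straight.ite (fun hb => ?_) fun hb => ?_
    · simp only [Test.eval_wlt, WExpr.eval_ofNat, eval_wvar, w21] at hb
      have hx1 : x + 1 < N := by omega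
      have he1 := ho.range _ hx1
      refine Straight.ite (fun hb => store _ ?_) fun hb => store _ ?_
      · simp only [Test.eval_rlt, eval_val, eval_wvar, w24, w25, v1, h3 _ he, h3 _ he1] at hb
        rw [ho.nextMid_lt hx1 hb]
        simp [w24, w25, v1, h3 _ he, h3 _ he1]
      -- Equal parameters have equal next midpoints, so the invariant for position `x + 1` gives the
      -- value.
      · simp only [Test.eval_rlt, eval_val, eval_wvar, w24, w25, v1, h3 _ he, h3 _ he1] at hb
        rw [le_antisymm (ho.sorted x hx1) (not_lt.1 hb), eval_val, WExpr.eval_add, eval_wvar,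
          eval_wvar, hw4, w25, v1]
        exact h5 (x + 1) hx1 (by omega)
    · simp only [Test.eval_wlt, WExpr.eval_ofNat, eval_wvar, w21] at hb
      refine store _ ?_
      rw [ho.nextMid_last (by omega)]
      simp [w24, v1, h3 _ he]
  · rintro s' ⟨-, h1, h2, h3, h4, h5⟩
    refine ⟨h1, h2, h3, h4, fun e he => ?_⟩
    obtain ⟨x, hx, rfl⟩ := ho.surj e he
    exact h5 x hx (by omega)

theorem ok_start : ∃ K, ∀ (n m w : ℕ) (I : Instance n m) (s : State),
    Room n m w → Ctx I s → s.Fits w → Ordered (32 * (n * m)) s →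
    Ok w start s (K * (32 * (n * m) + 1)) (fun s' => s'.Fits w ∧ PrepFrame n m s s' ∧
      (∀ e < 2 * (32 * (n * m)), valOf s' e = valOf s e) ∧
      ∀ e < 32 * (n * m), valOf s' (2 * (32 * (n * m)) + e) = valOf s (idxOf s 0) - 1) := by
  refine ⟨(wvar 4).cost + Program.time
    (.rset (valAddr (2 * wvar 4 + wvar 22)) (Prog.val (Prog.idx 0) - 1)) + 12,
    fun n m w I s hw hc hs ho => ?_⟩
  obtain ⟨r1, r2⟩ := hw.cells
  set N := 32 * (n * m) with hN
  refine (Ok.for (N := N)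
    (T := Program.time (.rset (valAddr (2 * wvar 4 + wvar 22)) (Prog.val (Prog.idx 0) - 1)))
    (I := fun k s' => s'.Fits w ∧ PrepFrame n m s s' ∧ (∀ e < 2 * N, valOf s' e = valOf s e) ∧
      idxOf s' = idxOf s ∧ ∀ e < k, valOf s' (2 * N + e) = valOf s (idxOf s 0) - 1)
    (by omega) (by omega) hs ?_ ?_ ?_ ?_).imp ?_
  · rintro k s' ⟨h1, h2, -⟩
    exact ⟨h1, by rw [eval_wvar, (h2.ctx hc).crits]⟩
  · rintro k s' v ⟨h1, h2, h3, h4, h5⟩ hv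
    refine ⟨h1.setWord (by omega) hv, h2.setWord (by omega) (by omega), ?_, ?_, ?_⟩
    · rwa [valOf_setWord (by omega)]
    · rwa [idxOf_setWord_scalar (by omega)]
    · rwa [valOf_setWord (by omega)]
  · refine ⟨hs.setWord (by omega) (by omega), PrepFrame.refl.setWord (by omega) (by omega), ?_, ?_, ?_⟩
    · intro e _; rw [valOf_setWord (by omega)]
    · rw [idxOf_setWord_scalar (by omega)]
    · intro x hx; omega
  · rintro k hk s1 ⟨h1, h2, h3, h4, h5⟩ hk'
    have c1 := h2.ctx hc
    have h0 := ho.range 0 (by omega)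
    have ha : (valAddr (2 * wvar 4 + wvar 22)).eval s1 = inputLen n m + 64 + (2 * N + k) := by
      simp [c1.base, c1.crits, hk', hN]
    have hv : (Prog.val (Prog.idx 0) - 1).eval s1 = valOf s (idxOf s 0) - 1 := by
      simp [h4, h3 _ (show idxOf s 0 < 2 * N by omega)]
    refine Straight.rset h1 (by omega) fun F => ?_
    rw [ha, hv] at F ⊢
    refine ⟨hk', F, h2.setReal (by omega), ?_, h4, ?_⟩
    · intro e he
      rw [c1.valOf_setReal, if_neg (by omega), h3 e he]
    · intro e he
      rw [c1.valOf_setReal]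
      split_ifs with h
      · rfl
      · exact h5 e (by omega)
  · rintro s' ⟨-, h1, h2, h3, h4, h5⟩
    exact ⟨h1, h2, h3, h5⟩

/-- The samples of a curve are generated and sorted. -/
structure Prepared {n m : ℕ} (I : Instance n m) (σ : ℝ) (A B : Quad ℝ) (s : State) : Prop where
  samples : Samples (32 * (n * m)) (valOf s)
  crit : ∀ e < 32 * (n * m), valOf s e = I.pairCrit σ A B (e / 32) (e % 32)
  start_eq : ∀ e < 32 * (n * m), ∀ e' < 32 * (n * m),
    valOf s (2 * (32 * (n * m)) + e) = valOf s (2 * (32 * (n * m)) + e')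
  ordered : Ordered (3 * (32 * (n * m))) s

theorem ok_sort_ordered : ∃ K, ∀ (w c L : ℕ) (s : State), s.Fits w → (e : WExpr) → e.eval s = L →
    e.cost ≤ c → 64 + 8 * L + 8 ≤ w →
    Ok w (.seq (.wset (.lit 10) e) Prog.sort) s ((K + c) * ((L + 1) * (Nat.clog 2 L + 1)))
      (fun s' => s'.Fits w ∧ (∀ n m, PrepFrame n m s s') ∧ valOf s' = valOf s ∧ Ordered L s') := by
  obtain ⟨K, H⟩ := ok_sort
  refine ⟨K + 2, fun w c L s hs e he hec hw => ?_⟩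
  refine Ok.le (T := e.cost + 2 + K * ((L + 1) * (Nat.clog 2 L + 1))) (Ok.seq (Q := fun s1 =>
    s1 = s.setWord 10 L ∧ s1.Fits w) (Ok.le (Ok.wset hs (by simp; omega) (by omega) fun F =>
      ⟨by rw [he]; rfl, F⟩) (by simp [WExpr.cost]; omega)) ?_) ?_
  · rintro s1 ⟨rfl, F1⟩
    refine (H w L _ F1 (by simp) hw).imp ?_
    rintro s' ⟨h1, h2, h3, h4, h5⟩
    have hv : valOf s' = valOf s := by rw [h2.valOf, valOf_setWord (by omega)]
    refine ⟨h1, fun n m => (PrepFrame.refl.setWord (by omega) (by omega)).trans h2.prepFrame, hv,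
      h3, h4, ?_⟩
    rw [hv]
    rwa [valOf_setWord (by omega)] at h5
  · have : 1 ≤ (L + 1) * (Nat.clog 2 L + 1) := Nat.mul_pos (by omega) (by omega)
    generalize (L + 1) * (Nat.clog 2 L + 1) = X at this ⊢
    nlinarith

end MCR

namespace MCR
open RealRAM Code

theorem ok_prepare : ∃ K, ∀ (n m w : ℕ) (I : Instance n m) (σ : ℝ) (A B : Quad ℝ) (s : State),
    Room n m w → Ctx I s → OnCurve n m σ A B s → s.Fits w →
    Ok w prepare s (K * ((3 * (32 * (n * m)) + 1) * (Nat.clog 2 (3 * (32 * (n * m))) + 1)))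
      (fun s' => s'.Fits w ∧ PrepFrame n m s s' ∧ Prepared I σ A B s') := by
  obtain ⟨K1, H1⟩ := ok_gen
  obtain ⟨K2, H2⟩ := ok_sort_ordered
  obtain ⟨K3, H3⟩ := ok_mid
  obtain ⟨K4, H4⟩ := ok_start
  refine ⟨K1 + (K2 + (3 * wvar 4).cost) + K3 + K4 + (K2 + (3 * wvar 4).cost),
    fun n m w I σ A B s hw hc hu hs => ?_⟩
  obtain ⟨r1, r2⟩ := hw.cells
  refine Ok.le (T := K1 * (n * m + 1) + ((K2 + (3 * wvar 4).cost) *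
    ((32 * (n * m) + 1) * (Nat.clog 2 (32 * (n * m)) + 1)) + (K3 * (32 * (n * m) + 1) +
    (K4 * (32 * (n * m) + 1) + (K2 + (3 * wvar 4).cost) * ((3 * (32 * (n * m)) + 1) *
      (Nat.clog 2 (3 * (32 * (n * m))) + 1)))))) ?_ ?_
  · refine Ok.seq (H1 n m w I σ A B s hw hc hu hs) ?_
    rintro s1 ⟨F1, f1, v1⟩
    refine Ok.seq (H2 w _ (32 * (n * m)) s1 F1 (wvar 4) (f1.ctx hc).crits
      (by simp only [WExpr.cost, wvar]; exact Nat.le_of_lt_succ (by change 2 < 1 + 2 + 1 + 1; omega))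
      (by omega)) ?_
    rintro s2 ⟨F2, f2, v2, o2⟩
    have f2 := f1.trans (f2 n m)
    refine Ok.seq (H3 n m w I s2 hw (f2.ctx hc) F2 o2) ?_
    rintro s3 ⟨F3, f3, v3, i3, m3⟩
    have f3 := f2.trans f3
    have o3 : Ordered (32 * (n * m)) s3 := by
      obtain ⟨q1, q2, q3⟩ := o2
      refine ⟨by rwa [i3], by rwa [i3], fun x hx => ?_⟩
      rw [i3, v3 _ (q1 _ (by omega)), v3 _ (q1 _ hx)]
      exact q3 x hx
    refine Ok.seq (H4 n m w I s3 hw (f3.ctx hc) F3 o3) ?_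
    rintro s4 ⟨F4, f4, v4, m4⟩
    have f4 := f3.trans f4
    refine (H2 w _ (3 * (32 * (n * m))) s4 F4 (3 * wvar 4) (by simp [(f4.ctx hc).crits]) le_rfl
      (by omega)).imp ?_
    rintro s5 ⟨F5, f5, v5, o5⟩
    refine ⟨F5, f4.trans (f5 n m), ?_⟩
    have hv : ∀ e < 32 * (n * m), valOf s5 e = valOf s2 e := fun e he => by
      rw [v5, v4 e (by omega), v3 e he]
    have himg : (Finset.range (32 * (n * m))).image (valOf s5) =
        (Finset.range (32 * (n * m))).image (valOf s2) :=
      Finset.image_congr fun e he => hv e (by simpa using he)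
    refine ⟨⟨fun e he => ?_, fun e he e' he' => ?_⟩, fun e he => ?_, fun e he e' he' => ?_, o5⟩
    · rw [himg, hv e he, v5, v4 _ (by omega), m3 e he]
    -- The starting value is one less than the smallest critical parameter.
    · rw [v5, m4 e he, v4 e' (by omega)]
      obtain ⟨x, hx, rfl⟩ := o3.surj e' he'
      have := o3.mono (Nat.zero_le x) hx
      linarith
    · rw [hv e he, v2, v1 e he]
    · rw [v5, m4 e he, m4 e' he']
  · set M := n * m
    have hcl : Nat.clog 2 (32 * M) ≤ Nat.clog 2 (3 * (32 * M)) := Nat.clog_mono_right 2 (by omega)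
    set X := (3 * (32 * M) + 1) * (Nat.clog 2 (3 * (32 * M)) + 1) with hX
    have e1 : 32 * M + 1 ≤ X := by
      rw [hX]; exact le_trans (by omega) (Nat.le_mul_of_pos_right _ (by omega))
    have e2 : M + 1 ≤ X := by omega
    have e3 : (32 * M + 1) * (Nat.clog 2 (32 * M) + 1) ≤ X := Nat.mul_le_mul (by omega) (by omega)
    generalize K2 + (3 * wvar 4).cost = K5
    have f1 := Nat.mul_le_mul_left K1 e2
    have f2 := Nat.mul_le_mul_left K5 e3
    have f3 := Nat.mul_le_mul_left K3 e1
    have f4 := Nat.mul_le_mul_left K4 e1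
    calc _ ≤ K1 * X + (K5 * X + (K3 * X + (K4 * X + K5 * X))) := by omega
      _ = _ := by ring

/-! ### Updating the counters -/

/-- The address of entry `x` of the array `r`. -/
def addr (r x : ℕ) : ℕ := 64 + r + 8 * x

def cellOf (r : ℕ) (s : State) (x : ℕ) : ℕ := s.word (addr r x)

section Cells
variable {s : State} {r r' a x y v : ℕ}

theorem cellOf_setWord :
    cellOf r (s.setWord (addr r y) v) = Function.update (cellOf r s) y v := by
  funext x
  simp only [cellOf, State.word_setWord, Function.update_apply, addr]
  by_cases h : x = y
  · simp [h]
  · rw [if_neg (by omega), if_neg h]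

theorem cellOf_setWord_of_ne (h : r ≠ r') (hr : r < 8) (hr' : r' < 8) :
    cellOf r (s.setWord (addr r' y) v) = cellOf r s := by
  funext x
  exact State.word_setWord_of_ne _ _ (by simp only [addr]; omega)

theorem cellOf_setWord_scalar (h : a < 64) : cellOf r (s.setWord a v) = cellOf r s := by
  funext x
  exact State.word_setWord_of_ne _ _ (by simp only [addr]; omega)

theorem word_setWord_addr (h : a < 64) : (s.setWord (addr r y) v).word a = s.word a :=
  State.word_setWord_of_ne _ _ (by simp only [addr]; omega)

theorem idxOf_setWord_addr (hr : 0 < r) (hr' : r < 8) :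
    idxOf (s.setWord (addr r y) v) = idxOf s := by
  funext x
  exact State.word_setWord_of_ne _ _ (by simp only [addr]; omega)

end Cells

/-- The counters are consistent. -/
structure Acc (n m : ℕ) (s : State) : Prop where
  chi_le : ∀ p < n * m, cellOf 2 s p ≤ 1
  psi_le : ∀ p < n * m, cellOf 3 s p ≤ 1
  crossings : ∀ i < n, cellOf 4 s i = ∑ j ∈ Finset.range m, cellOf 2 s (i * m + j)
  incidences : ∀ i < n, cellOf 5 s i = ∑ j ∈ Finset.range m, cellOf 3 s (i * m + j)
  status : ∀ i < n, cellOf 6 s i = statusOf (cellOf 4 s i) (cellOf 5 s i)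
  count : s.word 7 = ∑ i ∈ Finset.range n, cellOf 6 s i

theorem add_mul_lt {n m i j : ℕ} (hi : i < n) (hj : j < m) : i * m + j < n * m := by
  have := Nat.mul_le_mul_right m (Nat.succ_le_of_lt hi)
  rw [Nat.succ_mul] at this
  omega

theorem Acc.congr {n m : ℕ} {s s' : State} (h : Acc n m s) (h7 : s'.word 7 = s.word 7)
    (hc : ∀ r, 2 ≤ r → r < 8 → cellOf r s' = cellOf r s) : Acc n m s' := by
  obtain ⟨h1, h2, h3, h4, h5, h6⟩ := h
  constructor
  · rwa [hc 2 (by omega) (by omega)]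
  · rwa [hc 3 (by omega) (by omega)]
  · rwa [hc 2 (by omega) (by omega), hc 4 (by omega) (by omega)]
  · rwa [hc 3 (by omega) (by omega), hc 5 (by omega) (by omega)]
  · rwa [hc 4 (by omega) (by omega), hc 5 (by omega) (by omega), hc 6 (by omega) (by omega)]
  · rwa [h7, hc 6 (by omega) (by omega)]

/-- Only the row of the point owning pair `p` changes. The new value is added before the old one is
removed, so the subtraction of natural numbers is not truncated. -/
theorem sum_update_row {m i p v : ℕ} {f : ℕ → ℕ} (hm : 0 < m) :
    ∑ j ∈ Finset.range m, Function.update f p v (i * m + j) =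
      if i = p / m then ∑ j ∈ Finset.range m, f (i * m + j) + v - f p
      else ∑ j ∈ Finset.range m, f (i * m + j) := by
  split_ifs with h
  · have hp : i * m + p % m = p := by rw [h, mul_comm]; exact Nat.div_add_mod p m
    have hmem : p % m ∈ Finset.range m := Finset.mem_range.2 (Nat.mod_lt _ hm)
    have e : ∀ j ∈ Finset.range m, Function.update f p v (i * m + j) =
        Function.update (fun j => f (i * m + j)) (p % m) v j := fun j _ => by
      simp only [Function.update_apply]
      by_cases hj : j = p % m
      · rw [if_pos hj, if_pos (by omega)]
      · rw [if_neg hj, if_neg (by omega)]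
    rw [Finset.sum_congr rfl e, Finset.sum_update_of_mem hmem,
      Finset.sum_eq_add_sum_sdiff_singleton_of_mem hmem (fun j => f (i * m + j)), hp]
    omega
  · refine Finset.sum_congr rfl fun j hj => Function.update_of_ne ?_ _ _
    rintro rfl
    have := Finset.mem_range.1 hj
    exact h (by rw [mul_comm, Nat.mul_add_div hm, Nat.div_eq_of_lt this, add_zero])

namespace Code

def arr (r : ℕ) (e : WExpr) : WExpr := .cell (.lit (64 + r) + 8 * e)
def arrAddr (r : ℕ) (e : WExpr) : WExpr := .lit (64 + r) + 8 * e

/-- Replace the contributions of the pair in cell 25 by those in the cells 27 and 28. -/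
def update : Program :=
  .seq (.wset (arrAddr 4 (wvar 25 / wvar 1))
    (arr 4 (wvar 25 / wvar 1) + wvar 27 - arr 2 (wvar 25)))
  (.seq (.wset (arrAddr 5 (wvar 25 / wvar 1))
    (arr 5 (wvar 25 / wvar 1) + wvar 28 - arr 3 (wvar 25)))
  (.seq (.wset (arrAddr 2 (wvar 25)) (wvar 27))
  (.seq (.wset (arrAddr 3 (wvar 25)) (wvar 28))
  (.seq (.wset (.lit 7) (wvar 7 - arr 6 (wvar 25 / wvar 1)))
  (.seq (.ite (.wlt 0 (arr 5 (wvar 25 / wvar 1))) (.wset (arrAddr 6 (wvar 25 / wvar 1)) 1)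
    (.wset (arrAddr 6 (wvar 25 / wvar 1)) ((arr 4 (wvar 25 / wvar 1)).mod 2)))
  (.wset (.lit 7) (wvar 7 + arr 6 (wvar 25 / wvar 1))))))))

end Code

@[simp] theorem eval_arr (s : State) (r : ℕ) (e : WExpr) :
    (arr r e).eval s = cellOf r s (e.eval s) := rfl
@[simp] theorem eval_arrAddr (s : State) (r : ℕ) (e : WExpr) :
    (arrAddr r e).eval s = addr r (e.eval s) := rfl

theorem Acc.cell_four_le {n m : ℕ} {s : State} (h : Acc n m s) {i : ℕ} (hi : i < n) :
    cellOf 4 s i ≤ m := by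
  rw [h.crossings i hi]
  exact (Finset.sum_le_card_nsmul _ _ 1 fun j hj =>
    h.chi_le _ (add_mul_lt hi (Finset.mem_range.1 hj))).trans (by simp)

theorem Acc.cell_five_le {n m : ℕ} {s : State} (h : Acc n m s) {i : ℕ} (hi : i < n) :
    cellOf 5 s i ≤ m := by
  rw [h.incidences i hi]
  exact (Finset.sum_le_card_nsmul _ _ 1 fun j hj =>
    h.psi_le _ (add_mul_lt hi (Finset.mem_range.1 hj))).trans (by simp)

theorem Acc.count_le {n m : ℕ} {s : State} (h : Acc n m s) : s.word 7 ≤ n := by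
  rw [h.count]
  refine (Finset.sum_le_card_nsmul _ _ 1 fun i hi => ?_).trans (by simp)
  rw [h.status i (Finset.mem_range.1 hi)]; exact statusOf_le _ _

/-- The row sums are corrected before the entries are overwritten, since they need the old
contributions. Then the old status of the point is taken out of the total and the new one put in, so
one pair costs constant time. -/
theorem straight_update {n m w p : ℕ} {s : State} (hw : Room n m w) (hs : s.Fits w)
    (hacc : Acc n m s) (hm : s.word 1 = m) (hp : s.word 25 = p) (hpn : p < n * m)
    (h27 : s.word 27 ≤ 1) (h28 : s.word 28 ≤ 1) :
    Straight w update s (fun s' => s'.Fits w ∧ Acc n m s' ∧ s'.real = s.real ∧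
      idxOf s' = idxOf s ∧ (∀ x < 64, x ≠ 7 → s'.word x = s.word x) ∧
      cellOf 2 s' = Function.update (cellOf 2 s) p (s.word 27) ∧
      cellOf 3 s' = Function.update (cellOf 3 s) p (s.word 28)) := by
  obtain ⟨r1, r2⟩ := hw.cells
  have hmpos := hw.m_pos
  have hi : p / m < n := Nat.div_lt_of_lt_mul (by rwa [mul_comm])
  set i := p / m with hidef
  have hn := hw.n_le
  have hm' := hw.m_le
  have b4 := hacc.cell_four_le hi
  have b5 := hacc.cell_five_le hi
  have b7 := hacc.count_le
  have ha : ∀ r < 8, ∀ x < n * m, addr r x < w := fun r hr x hx => by simp only [addr]; omega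
  have hin : i < n * m := by omega
  set x4 := cellOf 4 s i + s.word 27 - cellOf 2 s p with hx4
  set x5 := cellOf 5 s i + s.word 28 - cellOf 3 s p with hx5
  refine Straight.seq (Straight.wset hs ?_ ?_ fun F1 => ?_)
  · simp only [eval_arrAddr, WExpr.eval_div, eval_wvar, hp, hm]; exact ha 4 (by omega) _ hin
  · simp only [WExpr.eval_sub, WExpr.eval_add, eval_arr, WExpr.eval_div, eval_wvar, hp, hm, ← hidef]; omega
  simp only [eval_arrAddr, WExpr.eval_sub, WExpr.eval_add, eval_arr, WExpr.eval_div, eval_wvar, hp,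
    hm, ← hidef, ← hx4] at F1 ⊢
  refine Straight.seq (Straight.wset F1 ?_ ?_ fun F2 => ?_)
  · simp [word_setWord_addr, hp, hm]; exact ha 5 (by omega) _ hin
  · simp [word_setWord_addr, hp, hm, cellOf_setWord_of_ne, ← hidef]; omega
  simp only [eval_arrAddr, WExpr.eval_sub, WExpr.eval_add, eval_arr, WExpr.eval_div, eval_wvar, hp,
    hm, ← hidef, word_setWord_addr, cellOf_setWord_of_ne, Nat.reduceLT, ne_eq, Nat.reduceEqDiff,
    not_false_eq_true, ← hx5] at F2 ⊢
  refine Straight.seq (Straight.wset F2 ?_ ?_ fun F3 => ?_)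
  · simp [word_setWord_addr, hp]; exact ha 2 (by omega) _ hpn
  · simp [word_setWord_addr]; omega
  simp only [eval_arrAddr, eval_wvar, hp, word_setWord_addr, Nat.reduceLT] at F3 ⊢
  refine Straight.seq (Straight.wset F3 ?_ ?_ fun F4 => ?_)
  · simp [word_setWord_addr, hp]; exact ha 3 (by omega) _ hpn
  · simp [word_setWord_addr]; omega
  simp only [eval_arrAddr, eval_wvar, hp, word_setWord_addr, Nat.reduceLT] at F4 ⊢
  refine Straight.seq (Straight.wset F4 ?_ ?_ fun F5 => ?_)
  · simp; omega
  · simp [word_setWord_addr, hp, hm, cellOf_setWord_of_ne, ← hidef]; omega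
  simp only [WExpr.eval_lit, WExpr.eval_sub, eval_arr, WExpr.eval_div, eval_wvar, hp,
    hm, ← hidef, word_setWord_addr, cellOf_setWord_of_ne, Nat.reduceLT, ne_eq, Nat.reduceEqDiff,
    not_false_eq_true] at F5 ⊢
  set s5 := ((((s.setWord (addr 4 i) x4).setWord (addr 5 i) x5).setWord (addr 2 p)
    (s.word 27)).setWord (addr 3 p) (s.word 28)).setWord 7 (s.word 7 - cellOf 6 s i) with hs5
  have c2 : cellOf 2 s5 = Function.update (cellOf 2 s) p (s.word 27) := by
    simp [hs5, cellOf_setWord, cellOf_setWord_of_ne, cellOf_setWord_scalar]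
  have c3 : cellOf 3 s5 = Function.update (cellOf 3 s) p (s.word 28) := by
    simp [hs5, cellOf_setWord, cellOf_setWord_of_ne, cellOf_setWord_scalar]
  have c4 : cellOf 4 s5 = Function.update (cellOf 4 s) i x4 := by
    simp [hs5, cellOf_setWord, cellOf_setWord_of_ne, cellOf_setWord_scalar]
  have c5 : cellOf 5 s5 = Function.update (cellOf 5 s) i x5 := by
    simp [hs5, cellOf_setWord, cellOf_setWord_of_ne, cellOf_setWord_scalar]
  have c6 : cellOf 6 s5 = cellOf 6 s := by
    simp [hs5, cellOf_setWord_of_ne, cellOf_setWord_scalar]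
  have c0 : idxOf s5 = idxOf s := by
    simp [hs5, idxOf_setWord_addr, idxOf_setWord_scalar]
  have cr : s5.real = s.real := by simp [hs5]
  have cw : ∀ x < 64, x ≠ 7 → s5.word x = s.word x := fun x hx h7 => by
    rw [hs5, State.word_setWord_of_ne _ _ h7]; simp [word_setWord_addr, hx]
  have c7 : s5.word 7 = s.word 7 - cellOf 6 s i := by simp [hs5]
  clear_value s5
  have w25 : s5.word 25 = p := by rw [cw 25 (by omega) (by omega), hp]
  have w1 : s5.word 1 = m := by rw [cw 1 (by omega) (by omega), hm]
  have d4 : cellOf 4 s5 i = x4 := by rw [c4, Function.update_self]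
  have d5 : cellOf 5 s5 i = x5 := by rw [c5, Function.update_self]
  refine Straight.seq (Straight.imp (Q := fun s6 => s6 = s5.setWord (addr 6 i) (statusOf x4 x5) ∧
    s6.Fits w) (Straight.ite (fun hb => ?_) fun hb => ?_) ?_)
  · simp only [Test.eval_wlt, WExpr.eval_ofNat, eval_arr, WExpr.eval_div, eval_wvar, w25, w1,
      ← hidef, d5] at hb
    refine Straight.wset F5 ?_ (by simp; omega) fun F6 => ⟨?_, F6⟩
    · simp [w25, w1]; exact ha 6 (by omega) _ hin
    · simp only [eval_arrAddr, WExpr.eval_div, eval_wvar, w25, w1, ← hidef, WExpr.eval_ofNat,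
        statusOf, if_pos hb]
  · simp only [Test.eval_wlt, WExpr.eval_ofNat, eval_arr, WExpr.eval_div, eval_wvar, w25, w1,
      ← hidef, d5] at hb
    refine Straight.wset F5 ?_ ?_ fun F6 => ⟨?_, F6⟩
    · simp [w25, w1]; exact ha 6 (by omega) _ hin
    · simp only [WExpr.eval_mod, WExpr.eval_ofNat]; omega
    · simp only [eval_arrAddr, WExpr.eval_div, eval_wvar, w25, w1, ← hidef, WExpr.eval_mod, eval_arr,
        d4, WExpr.eval_ofNat, statusOf, if_neg hb]
  rintro s6 ⟨rfl, F6⟩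
  have hst : statusOf x4 x5 ≤ 1 := statusOf_le _ _
  refine Straight.wset F6 (by simp; omega) ?_ fun F7 => ?_
  · simp [word_setWord_addr, w25, w1, ← hidef, cellOf_setWord, c7]; omega
  simp only [WExpr.eval_lit, WExpr.eval_add, eval_arr, WExpr.eval_div, eval_wvar, w25, w1, ← hidef,
    word_setWord_addr, cellOf_setWord, Nat.reduceLT, Function.update_self, c7] at F7 ⊢
  refine ⟨F7, ⟨?_, ?_, ?_, ?_, ?_, ?_⟩, by simpa using cr, ?_, ?_, ?_, ?_⟩
  · simp only [cellOf_setWord_scalar, cellOf_setWord_of_ne, Nat.reduceLT, ne_eq, Nat.reduceEqDiff,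
      not_false_eq_true, c2, Function.update_apply]
    intro q hq; split_ifs
    · exact h27
    · exact hacc.chi_le q hq
  · simp only [cellOf_setWord_scalar, cellOf_setWord_of_ne, Nat.reduceLT, ne_eq, Nat.reduceEqDiff,
      not_false_eq_true, c3, Function.update_apply]
    intro q hq; split_ifs
    · exact h28
    · exact hacc.psi_le q hq
  · intro k hk
    simp only [cellOf_setWord_scalar, cellOf_setWord_of_ne, Nat.reduceLT, ne_eq, Nat.reduceEqDiff,
      not_false_eq_true, c2, c4]
    rw [sum_update_row hmpos, Function.update_apply]
    simp only [← hidef]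
    split_ifs with e
    · rw [hx4, e, hacc.crossings i hi]
    · exact hacc.crossings k hk
  · intro k hk
    simp only [cellOf_setWord_scalar, cellOf_setWord_of_ne, Nat.reduceLT, ne_eq, Nat.reduceEqDiff,
      not_false_eq_true, c3, c5]
    rw [sum_update_row hmpos, Function.update_apply]
    simp only [← hidef]
    split_ifs with e
    · rw [hx5, e, hacc.incidences i hi]
    · exact hacc.incidences k hk
  · intro k hk
    simp only [cellOf_setWord_scalar, cellOf_setWord, cellOf_setWord_of_ne, Nat.reduceLT, ne_eq,
      Nat.reduceEqDiff, not_false_eq_true, c4, c5, c6, Function.update_apply]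
    split_ifs with e
    · rfl
    · exact hacc.status k hk
  · simp only [State.word_setWord_self, cellOf_setWord_scalar, cellOf_setWord, Nat.reduceLT, c6]
    have hmem : i ∈ Finset.range n := Finset.mem_range.2 hi
    rw [Finset.sum_update_of_mem hmem, hacc.count,
      Finset.sum_eq_add_sum_sdiff_singleton_of_mem hmem (cellOf 6 s)]
    omega
  · rw [idxOf_setWord_scalar (by omega), idxOf_setWord_addr (by omega) (by omega), c0]
  · intro x hx h7
    rw [State.word_setWord_of_ne _ _ h7, word_setWord_addr hx, cw x hx h7]
  · rw [cellOf_setWord_scalar (by omega), cellOf_setWord_of_ne (by omega) (by omega) (by omega), c2]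
  · rw [cellOf_setWord_scalar (by omega), cellOf_setWord_of_ne (by omega) (by omega) (by omega), c3]

end MCR

namespace MCR
open RealRAM Code

/-! ### The sweep along a curve -/

namespace Code

def sweepParam : RExpr := Prog.val (Prog.idx (wvar 23))

/-- Compute the contributions of the pair that is responsible for the current sample. -/
def evaluate : Program :=
  .seq (.wset (.lit 25) ((Prog.idx (wvar 23) / 32).mod (wvar 3)))
  (.seq (.ite (rayTest (tailE (wvar 25)) (headE (wvar 25)) (posE (wvar 25) sweepParam))
    (.wset (.lit 27) 1) (.wset (.lit 27) 0))
  (.ite (edgeTest (tailE (wvar 25)) (headE (wvar 25)) (posE (wvar 25) sweepParam))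
    (.wset (.lit 28) 1) (.wset (.lit 28) 0)))

/-- A position is recorded only after the last sample of a group of equal parameters, when the
counters are trustworthy. Cell 6 holds one more than the best coverage, so that `0` means that
nothing has been recorded. -/
def recordTest : Test :=
  .and (.not (.and (.wlt (wvar 23 + 1) (3 * wvar 4))
      (.not (.rlt sweepParam (Prog.val (Prog.idx (wvar 23 + 1)))))))
    (.and (validTest sweepParam) (.wlt (wvar 6) (wvar 7 + 1)))

def angleCode (u : RExpr) : Program :=
  .ite (.rlt (sinE u) 0)
    (.rset (wvar 2 + 13) (2 * .arccos (0 - 1) - .arccos (cosE u)))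
    (.rset (wvar 2 + 13) (.arccos (cosE u)))

/-- Record the current position if it is better than those found before. -/
def record : Program :=
  .ite recordTest
    (.seq (.wset (.lit 6) (wvar 7 + 1)) (.seq (.rset (wvar 2 + 11) (centerE sweepParam).1)
      (.seq (.rset (wvar 2 + 12) (centerE sweepParam).2) (angleCode sweepParam))))
    .skip

def sweepStep : Program := .seq evaluate (.seq update record)

def sweep : Program := .for 23 (3 * wvar 4) sweepStep

end Code

section
variable {n m w k L : ℕ} {I : Instance n m} {σ : ℝ} {A B : Quad ℝ} {s s' : State}

/-- The best position found so far is stored. -/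
def BestOk (I : Instance n m) (s : State) : Prop :=
  s.word 6 = 0 ∨
    ((s.real (inputLen n m + 11), s.real (inputLen n m + 12)) ∈ segment ℝ I.a I.b ∧
      s.real (inputLen n m + 13) ∈ Set.Ico 0 (2 * Real.pi) ∧
      s.word 6 = I.cov (s.real (inputLen n m + 11), s.real (inputLen n m + 12))
        (Real.cos (s.real (inputLen n m + 13))) (Real.sin (s.real (inputLen n m + 13))) + 1)

theorem BestOk.congr (h : BestOk I s) (h6 : s'.word 6 = s.word 6)
    (hr : ∀ c, 11 ≤ c → c < 14 → s'.real (inputLen n m + c) = s.real (inputLen n m + c)) :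
    BestOk I s' := by
  rwa [BestOk, h6, hr 11 (by omega) (by omega), hr 12 (by omega) (by omega),
    hr 13 (by omega) (by omega)]

/-- The contributions of each pair are those at its last sample among the first `k` ones in `s`. -/
def Tracks (I : Instance n m) (σ : ℝ) (A B : Quad ℝ) (s : State) (k : ℕ) (s' : State) : Prop :=
  ∀ x < k, (∀ y, x < y → y < k →
      pairOf (n * m) (idxOf s y) ≠ pairOf (n * m) (idxOf s x)) →
    cellOf 2 s' (pairOf (n * m) (idxOf s x)) =
      I.pairChi σ A B (pairOf (n * m) (idxOf s x)) (valOf s (idxOf s x)) ∧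
    cellOf 3 s' (pairOf (n * m) (idxOf s x)) =
      I.pairPsi σ A B (pairOf (n * m) (idxOf s x)) (valOf s (idxOf s x))

/-- All samples with the same parameter as number `k` of the sorted list have been seen. -/
def GroupEnd (L : ℕ) (s : State) (k : ℕ) : Prop :=
  k + 1 < L → valOf s (idxOf s k) < valOf s (idxOf s (k + 1))

/-- Each pair has been evaluated, because its starting samples come first. At the end of a group,
the last seen sample of a pair is the last one with parameter at most the current one, so
`Instance.contributions_at_sample` applies to every pair. -/
theorem Prepared.count_eq (h : Prepared I σ A B s)
    (hk : k < 3 * (32 * (n * m))) (ht : Tracks I σ A B s (k + 1) s') (hacc : Acc n m s')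
    (hg : GroupEnd (3 * (32 * (n * m))) s k) (hA : A.at (valOf s (idxOf s k)) ≠ 0) :
    s'.word 7 = I.covAt σ A B (valOf s (idxOf s k)) := by
  have hpos : ∀ y < 3 * (32 * (n * m)), valOf s (idxOf s y) ≤ valOf s (idxOf s k) → y ≤ k := by
    intro y hy hle
    by_contra hc
    have h1 := hg (by omega)
    have h2 := h.ordered.mono (show k + 1 ≤ y by omega) hy
    linarith
  have key : ∀ p < n * m, cellOf 2 s' p = I.pairChi σ A B p (valOf s (idxOf s k)) ∧
      cellOf 3 s' p = I.pairPsi σ A B p (valOf s (idxOf s k)) := by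
    intro p hp
    have hex : ∃ x, x ≤ k ∧ pairOf (n * m) (idxOf s x) = p := by
      -- This index is a starting sample owned by pair `p`.
      obtain ⟨x, hx, hxe⟩ := h.ordered.surj (2 * (32 * (n * m)) + 32 * p) (by omega)
      refine ⟨x, hpos x hx ?_, ?_⟩
      · rw [hxe]
        have hr := h.ordered.range k hk
        rcases lt_or_ge (idxOf s k) (32 * (n * m)) with h1 | h1
        · exact (h.samples.start _ (by omega) _ h1).le
        rcases lt_or_ge (idxOf s k) (2 * (32 * (n * m))) with h2 | h2
        · obtain ⟨e, he⟩ := Nat.exists_eq_add_of_le h1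
          rw [he, h.samples.mid e (by omega)]
          exact (h.samples.start _ (by omega) e (by omega)).le.trans (lt_nextMid _ _).le
        · obtain ⟨e, he⟩ := Nat.exists_eq_add_of_le h2
          rw [he]
          exact (h.start_eq _ (by omega) e (by omega)).le
      · rw [hxe, pairOf, show (2 * (32 * (n * m)) + 32 * p) / 32 = (n * m) * 2 + p by omega,
          Nat.mul_add_mod, Nat.mod_eq_of_lt hp]
    classical
    obtain ⟨x, ⟨hx, hxp⟩, hmax⟩ : ∃ x, (x ≤ k ∧ pairOf (n * m) (idxOf s x) = p) ∧
        ∀ y, y ≤ k ∧ pairOf (n * m) (idxOf s y) = p → y ≤ x := by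
      obtain ⟨x₀, hx₀⟩ := hex
      exact ⟨Nat.findGreatest (fun x => x ≤ k ∧ pairOf (n * m) (idxOf s x) = p) k,
        Nat.findGreatest_spec (P := fun x => x ≤ k ∧ pairOf (n * m) (idxOf s x) = p) hx₀.1 hx₀,
        fun y hy => Nat.le_findGreatest hy.1 hy⟩
    have h1 := ht x (by omega) fun y hy hyk hyp => by
      have := hmax y ⟨by omega, hyp.trans hxp⟩
      omega
    rw [hxp] at h1
    have h2 := Instance.contributions_at_sample h.samples h.crit hp (h.ordered.range k hk)
      (h.ordered.mono hx hk) (fun e he hep => by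
        rintro ⟨h3, h4⟩
        obtain ⟨y, hy, rfl⟩ := h.ordered.surj e he
        have h5 := hmax y ⟨hpos y hy h4, hep⟩
        have h6 := h.ordered.mono h5 (by omega)
        linarith) hA
    rw [h1.1, h1.2]
    exact h2
  rw [hacc.count, Instance.covAt_eq]
  refine Finset.sum_congr rfl fun i hi => ?_
  have hi := Finset.mem_range.1 hi
  rw [hacc.status i hi, hacc.crossings i hi, hacc.incidences i hi]
  congr 1 <;> refine Finset.sum_congr rfl fun j hj => ?_
  · exact (key _ (add_mul_lt hi (Finset.mem_range.1 hj))).1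
  · exact (key _ (add_mul_lt hi (Finset.mem_range.1 hj))).2

/-- What the sweep does not change. -/
structure SweepFrame (n m : ℕ) (s s' : State) : Prop where
  real : ∀ x, ¬ (inputLen n m + 11 ≤ x ∧ x < inputLen n m + 14) → s'.real x = s.real x
  idx : idxOf s' = idxOf s
  word : ∀ x < 10, x ≠ 6 → x ≠ 7 → s'.word x = s.word x

theorem SweepFrame.ctx (h : SweepFrame n m s s') (hc : Ctx I s) : Ctx I s' :=
  hc.congr (fun x hx => h.word x (by omega) (by omega) (by omega)) fun x hx => h.real x (by omega)

theorem SweepFrame.onCurve (h : SweepFrame n m s s') (hc : OnCurve n m σ A B s) :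
    OnCurve n m σ A B s' :=
  hc.congr fun c hc => h.real _ (by omega)

theorem SweepFrame.valOf (h : SweepFrame n m s s') (hc : Ctx I s) : valOf s' = valOf s := by
  funext x
  rw [(h.ctx hc).valOf_eq, hc.valOf_eq, h.real _ (by omega)]

theorem SweepFrame.trans {s'' : State} (h : SweepFrame n m s s') (h' : SweepFrame n m s' s'') :
    SweepFrame n m s s'' :=
  ⟨fun x hx => (h'.real x hx).trans (h.real x hx), h'.idx.trans h.idx,
    fun x hx h6 h7 => (h'.word x hx h6 h7).trans (h.word x hx h6 h7)⟩

theorem straight_evaluate (hw : Room n m w) (hs : s.Fits w) (hc : Ctx I s)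
    (hu : OnCurve n m σ A B s) (hk : s.word 23 = k) {u : ℝ} {p : ℕ}
    (hue : valOf s (idxOf s k) = u) (hp : pairOf (n * m) (idxOf s k) = p) :
    Straight w evaluate s (fun s' => s'.Fits w ∧ s'.real = s.real ∧ idxOf s' = idxOf s ∧
      (∀ r, cellOf r s' = cellOf r s) ∧
      (∀ x < 64, x ≠ 25 → x ≠ 27 → x ≠ 28 → s'.word x = s.word x) ∧
      s'.word 25 = p ∧ s'.word 27 = I.pairChi σ A B p u ∧ s'.word 28 = I.pairPsi σ A B p u) := by
  obtain ⟨r1, r2⟩ := hw.cells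
  have hnm : 0 < n * m := Nat.mul_pos hw.n_pos hw.m_pos
  have hpn : p < n * m := by rw [← hp]; exact Nat.mod_lt _ hnm
  have hp' : ((Prog.idx (wvar 23) / 32).mod (wvar 3)).eval s = p := by
    simp [hc.pairs, hk, ← hp, pairOf]
  refine Straight.seq (Straight.wset hs (by simp; omega) (by omega) fun F1 => ?_)
  rw [hp'] at F1 ⊢
  simp only [WExpr.eval_lit] at F1 ⊢
  -- The two geometric tests are unaffected by the writes to cells 25, 27 and 28 except through the
  -- pair index, so one computation serves both.
  have reads : ∀ s1 : State, s1.real = s.real → idxOf s1 = idxOf s →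
      (∀ x < 64, x ≠ 25 → x ≠ 27 → x ≠ 28 → s1.word x = s.word x) → s1.word 25 = p →
      evalPair s1 (tailE (wvar 25)) = I.tail p ∧ evalPair s1 (headE (wvar 25)) = I.head p ∧
        evalPair s1 (posE (wvar 25) sweepParam) = I.pairPos σ A B p u := by
    intro s1 e1 e2 e3 e4
    have c1 : Ctx I s1 := hc.congr (fun x hx => e3 x (by omega) (by omega) (by omega) (by omega))
      fun x hx => by rw [e1]
    have u1 : OnCurve n m σ A B s1 := hu.congr fun c hc => by rw [e1]
    have hpe : (wvar 25).eval s1 = p := e4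
    have hval : sweepParam.eval s1 = u := by
      rw [← hue, sweepParam, eval_val, eval_idx, eval_wvar, e2,
        e3 23 (by omega) (by omega) (by omega) (by omega), hk, c1.valOf_eq, hc.valOf_eq, e1]
    refine ⟨?_, ?_, ?_⟩
    · rw [c1.evalPair_tailE hw.m_pos, hpe]
    · rw [c1.evalPair_headE hw.m_pos, hpe]
    · rw [c1.evalPair_posE u1 (by rw [hpe]; exact hpn), hpe, hval]
  set s1 := s.setWord 25 p with hs1
  have a1 : s1.real = s.real := rfl
  have a2 : idxOf s1 = idxOf s := idxOf_setWord_scalar (by omega)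
  have a3 : ∀ x < 64, x ≠ 25 → x ≠ 27 → x ≠ 28 → s1.word x = s.word x :=
    fun x _ hx _ _ => State.word_setWord_of_ne _ _ hx
  have a4 : s1.word 25 = p := by simp [hs1]
  have a5 : ∀ r, cellOf r s1 = cellOf r s := fun r => cellOf_setWord_scalar (by omega)
  clear_value s1
  obtain ⟨t1, t2, t3⟩ := reads s1 a1 a2 a3 a4
  refine Straight.seq (Straight.imp (Q := fun s2 => s2.Fits w ∧
    s2 = s1.setWord 27 (I.pairChi σ A B p u)) (Straight.ite (fun hb => ?_) fun hb => ?_) ?_)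
  · rw [eval_rayTest, t1, t2, t3] at hb
    refine Straight.wset F1 (by simp; omega) (by simp; omega) fun F2 => ⟨F2, ?_⟩
    simp [Instance.pairChi, chiN, hb]
  · rw [eval_rayTest, t1, t2, t3] at hb
    refine Straight.wset F1 (by simp; omega) (by simp) fun F2 => ⟨F2, ?_⟩
    simp [Instance.pairChi, chiN, hb]
  rintro s2 ⟨F2, hs2⟩
  have b2 : idxOf s2 = idxOf s := by rw [hs2, idxOf_setWord_scalar (by omega), a2]
  have b3 : ∀ x < 64, x ≠ 25 → x ≠ 27 → x ≠ 28 → s2.word x = s.word x :=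
    fun x h1 h2 h3 h4 => by rw [hs2, State.word_setWord_of_ne _ _ h3, a3 x h1 h2 h3 h4]
  have b4 : s2.word 25 = p := by rw [hs2, State.word_setWord_of_ne _ _ (by omega), a4]
  have b1 : s2.real = s.real := by rw [hs2, State.real_setWord, a1]
  have b5 : ∀ r, cellOf r s2 = cellOf r s := fun r => by
    rw [hs2, cellOf_setWord_scalar (by omega), a5]
  have b6 : s2.word 27 = I.pairChi σ A B p u := by rw [hs2, State.word_setWord_self]
  obtain ⟨t1, t2, t3⟩ := reads s2 b1 b2 b3 b4
  refine Straight.imp (Q := fun s3 => s3.Fits w ∧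
    s3 = s2.setWord 28 (I.pairPsi σ A B p u)) (Straight.ite (fun hb => ?_) fun hb => ?_) ?_
  · rw [eval_edgeTest, t1, t2, t3] at hb
    refine Straight.wset F2 (by simp; omega) (by simp; omega) fun F2 => ⟨F2, ?_⟩
    simp [Instance.pairPsi, psiN, hb]
  · rw [eval_edgeTest, t1, t2, t3] at hb
    refine Straight.wset F2 (by simp; omega) (by simp) fun F2 => ⟨F2, ?_⟩
    simp [Instance.pairPsi, psiN, hb]
  rintro s3 ⟨F3, rfl⟩
  refine ⟨F3, b1, by rw [idxOf_setWord_scalar (by omega), b2], fun r => by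
    rw [cellOf_setWord_scalar (by omega), b5], fun x h1 h2 h3 h4 => by
    rw [State.word_setWord_of_ne _ _ h4, b3 x h1 h2 h3 h4], ?_, ?_, by simp⟩
  · rw [State.word_setWord_of_ne _ _ (by omega), b4]
  · rw [State.word_setWord_of_ne _ _ (by omega), b6]

theorem straight_angleCode (hw : Room n m w) (hs : s.Fits w) (hc : Ctx I s)
    (hu : OnCurve n m σ A B s) {Q : State → Prop} (e : RExpr)
    (hQ : (s.setReal (inputLen n m + 13)
      (angleOf (cosU σ (e.eval s)) (sinU σ (e.eval s)))).Fits w → Q (s.setReal (inputLen n m + 13)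
      (angleOf (cosU σ (e.eval s)) (sinU σ (e.eval s))))) : Straight w (angleCode e) s Q := by
  obtain ⟨r1, r2⟩ := hw.cells
  have ha : (wvar 2 + 13).eval s = inputLen n m + 13 := by simp [hc.base]
  refine Straight.ite (fun hb => ?_) fun hb => ?_
  · have hv : (2 * .arccos (0 - 1) - .arccos (cosE e) : RExpr).eval s =
        angleOf (cosU σ (e.eval s)) (sinU σ (e.eval s)) := by
      rw [angleOf, if_pos (by simpa [hc.eval_sinE hu] using hb)]
      simp [hc.eval_cosE hu]
    refine Straight.rset hs (by omega) fun F => ?_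
    rw [ha, hv] at F ⊢
    exact hQ F
  · have hv : (.arccos (cosE e) : RExpr).eval s =
        angleOf (cosU σ (e.eval s)) (sinU σ (e.eval s)) := by
      rw [angleOf, if_neg (by simpa [hc.eval_sinE hu] using hb)]
      simp [hc.eval_cosE hu]
    refine Straight.rset hs (by omega) fun F => ?_
    rw [ha, hv] at F ⊢
    exact hQ F

end

end MCR

namespace MCR
open RealRAM Code

variable {n m w k L : ℕ} {I : Instance n m} {σ : ℝ} {A B : Quad ℝ} {s s' : State}

/-- The counter need only be the true coverage at valid ends of groups, since at all other samples
the test rejects whatever it contains. -/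
theorem straight_record (hw : Room n m w) (hs : s.Fits w) (hc : Ctx I s)
    (hu : OnCurve n m σ A B s) (hk : s.word 23 = k) (h7 : s.word 7 ≤ n) (hσ : σ = 1 ∨ σ = -1)
    (hcnt : GroupEnd (3 * (32 * (n * m))) s k → ValidAt A B (valOf s (idxOf s k)) →
      s.word 7 = I.covAt σ A B (valOf s (idxOf s k))) (hb : BestOk I s) :
    Straight w record s (fun s' => s'.Fits w ∧ SweepFrame n m s s' ∧
      (∀ r, cellOf r s' = cellOf r s) ∧ s'.word 7 = s.word 7 ∧ s'.word 23 = k ∧ BestOk I s' ∧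
      s.word 6 ≤ s'.word 6 ∧ (GroupEnd (3 * (32 * (n * m))) s k →
        ValidAt A B (valOf s (idxOf s k)) → s.word 7 + 1 ≤ s'.word 6)) := by
  obtain ⟨r1, r2⟩ := hw.cells
  have hn := hw.n_le
  have hu' : sweepParam.eval s = valOf s (idxOf s k) := by simp [sweepParam, hk]
  have htest : recordTest.eval s ↔ GroupEnd (3 * (32 * (n * m))) s k ∧
      ValidAt A B (valOf s (idxOf s k)) ∧ s.word 6 < s.word 7 + 1 := by
    simp only [recordTest, Test.eval_and, Test.eval_not, hc.eval_validTest hu, hu', Test.eval_wlt,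
      Test.eval_rlt, WExpr.eval_add, WExpr.eval_mul, eval_wvar, WExpr.eval_ofNat, hk, hc.crits,
      eval_val, eval_idx, GroupEnd, not_and, not_not]
  refine Straight.ite (fun ht => ?_) fun ht => ?_
  · obtain ⟨hg, hv, hlt⟩ := htest.1 ht
    refine Straight.seq (Straight.wset hs (by simp; omega) (by simp; omega) fun F1 => ?_)
    simp only [WExpr.eval_lit, WExpr.eval_add, eval_wvar, WExpr.eval_ofNat] at F1 ⊢
    set s1 := s.setWord 6 (s.word 7 + 1) with hs1
    have c1 : Ctx I s1 := hc.congr (fun x hx => State.word_setWord_of_ne _ _ (by omega))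
      fun x hx => rfl
    have u1 : OnCurve n m σ A B s1 := hu.congr fun c hc => rfl
    have i1 : idxOf s1 = idxOf s := idxOf_setWord_scalar (by omega)
    have v1 : valOf s1 = valOf s := valOf_setWord (by omega)
    have k1 : s1.word 23 = k := by rw [hs1, State.word_setWord_of_ne _ _ (by omega), hk]
    have p1 : sweepParam.eval s1 = valOf s (idxOf s k) := by simp [sweepParam, k1, i1, v1]
    have e1 := c1.evalPair_centerE u1 sweepParam
    rw [p1] at e1
    refine Straight.seq (Straight.rset F1 (by simp [c1.base]; omega) fun F2 => ?_)
    have a11 : (wvar 2 + 11).eval s1 = inputLen n m + 11 := by simp [c1.base]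
    have x11 : (centerE sweepParam).1.eval s1 = (evalPair s1 (centerE sweepParam)).1 := rfl
    rw [a11, x11, e1] at F2 ⊢
    set u := valOf s (idxOf s k) with hu0
    set r := center I.a I.dir ((0 - B.at u) / A.at u) with hr
    set s2 := s1.setReal (inputLen n m + 11) r.1 with hs2
    have c2 : Ctx I s2 := c1.congr (fun x hx => rfl)
      fun x hx => State.real_setReal_of_ne _ _ (by omega)
    have u2 : OnCurve n m σ A B s2 := u1.congr fun c hc => State.real_setReal_of_ne _ _ (by omega)
    have v2 : valOf s2 = valOf s := by
      funext x
      rw [c2.valOf_eq, ← v1, c1.valOf_eq]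
      exact State.real_setReal_of_ne _ _ (by omega)
    have p2 : sweepParam.eval s2 = u := by
      rw [sweepParam, eval_val, v2, eval_idx, hu0]
      change valOf s (idxOf s1 (s1.word 23)) = _
      rw [i1, k1]
    have e2 := c2.evalPair_centerE u2 sweepParam
    rw [p2, ← hr] at e2
    have a12 : (wvar 2 + 12).eval s2 = inputLen n m + 12 := by
      rw [WExpr.eval_add, eval_wvar, c2.base]; rfl
    refine Straight.seq (Straight.rset F2 (by rw [a12]; omega) fun F3 => ?_)
    have x12 : (centerE sweepParam).2.eval s2 = (evalPair s2 (centerE sweepParam)).2 := rfl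
    rw [a12, x12, e2] at F3 ⊢
    set s3 := s2.setReal (inputLen n m + 12) r.2 with hs3
    have c3 : Ctx I s3 := c2.congr (fun x hx => rfl)
      fun x hx => State.real_setReal_of_ne _ _ (by omega)
    have u3 : OnCurve n m σ A B s3 := u2.congr fun c hc => State.real_setReal_of_ne _ _ (by omega)
    have v3 : valOf s3 = valOf s := by
      funext x
      rw [c3.valOf_eq, ← v2, c2.valOf_eq]
      exact State.real_setReal_of_ne _ _ (by omega)
    have p3 : sweepParam.eval s3 = u := by
      rw [sweepParam, eval_val, v3, eval_idx, hu0]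
      change valOf s (idxOf s1 (s1.word 23)) = _
      rw [i1, k1]
    refine straight_angleCode hw F3 c3 u3 sweepParam fun F4 => ?_
    rw [p3] at F4 ⊢
    obtain ⟨q1, q2, q3⟩ := angleOf_spec (cosU_sq_add_sinU_sq hσ u)
    refine ⟨F4, ⟨fun x hx => ?_, i1, fun x hx h6 h7 => ?_⟩, fun q => ?_, ?_, k1, ?_, ?_, ?_⟩
    · rw [State.real_setReal_of_ne _ _ (by omega), hs3, State.real_setReal_of_ne _ _ (by omega), hs2,
        State.real_setReal_of_ne _ _ (by omega), hs1, State.real_setWord]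
    · exact State.word_setWord_of_ne _ _ h6
    · exact cellOf_setWord_scalar (by omega)
    · exact State.word_setWord_of_ne s (s.word 7 + 1) (show 7 ≠ 6 by omega)
    · right
      have z1 : (s3.setReal (inputLen n m + 13) (angleOf (cosU σ u) (sinU σ u))).real
          (inputLen n m + 11) = r.1 := by
        rw [State.real_setReal_of_ne _ _ (by omega), hs3, State.real_setReal_of_ne _ _ (by omega),
          hs2, State.real_setReal_self]
      have z2 : (s3.setReal (inputLen n m + 13) (angleOf (cosU σ u) (sinU σ u))).real
          (inputLen n m + 12) = r.2 := by
        rw [State.real_setReal_of_ne _ _ (by omega), hs3, State.real_setReal_self]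
      have z3 : (s3.setReal (inputLen n m + 13) (angleOf (cosU σ u) (sinU σ u))).word 6 =
          s.word 7 + 1 := by
        change s1.word 6 = _
        rw [hs1, State.word_setWord_self]
      rw [z1, z2, z3, State.real_setReal_self, q2, q3]
      refine ⟨Instance.center_mem_segment hv.2.1 hv.2.2, q1, ?_⟩
      rw [hcnt hg hv]
      rfl
    · change s.word 6 ≤ s1.word 6
      rw [hs1, State.word_setWord_self]; omega
    · intro _ _
      change _ ≤ s1.word 6
      rw [hs1, State.word_setWord_self]
  · refine Straight.skip hs ⟨hs, ⟨fun _ _ => rfl, rfl, fun _ _ _ _ => rfl⟩, fun _ => rfl, rfl, hk, hb,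
      le_rfl, fun hg hv => ?_⟩
    by_contra hc
    exact ht (htest.2 ⟨hg, hv, by omega⟩)

/-- The state of the sweep started in `s` after `k` samples. -/
structure SweepInv (I : Instance n m) (w : ℕ) (σ : ℝ) (A B : Quad ℝ) (s : State) (k : ℕ)
    (s' : State) : Prop where
  fits : s'.Fits w
  frame : SweepFrame n m s s'
  acc : Acc n m s'
  best : BestOk I s'
  best_le : s.word 6 ≤ s'.word 6
  tracks : Tracks I σ A B s k s'
  checked : ∀ x < k, GroupEnd (3 * (32 * (n * m))) s x → ValidAt A B (valOf s (idxOf s x)) →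
    I.covAt σ A B (valOf s (idxOf s x)) + 1 ≤ s'.word 6

theorem straight_sweepStep (hw : Room n m w) (hc : Ctx I s) (hu : OnCurve n m σ A B s)
    (hσ : σ = 1 ∨ σ = -1) (hp : Prepared I σ A B s) (hk : k < 3 * (32 * (n * m)))
    (h : SweepInv I w σ A B s k s') (hk' : s'.word 23 = k) :
    Straight w sweepStep s' (fun s'' => s''.word 23 = k ∧ SweepInv I w σ A B s (k + 1) s'') := by
  have hnm : 0 < n * m := Nat.mul_pos hw.n_pos hw.m_pos
  have hv0 := h.frame.valOf hc
  have hi0 := h.frame.idx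
  set p := pairOf (n * m) (idxOf s k) with hpdef
  set u := valOf s (idxOf s k) with hudef
  have hpn : p < n * m := Nat.mod_lt _ hnm
  refine Straight.seq ((straight_evaluate hw h.fits (h.frame.ctx hc) (h.frame.onCurve hu) hk'
    (u := u) (p := p) (by rw [hv0, hi0]) (by rw [hi0])).imp ?_)
  rintro s1 ⟨F1, a1, a2, a3, a4, a5, a6, a7⟩
  have acc1 : Acc n m s1 := h.acc.congr (a4 7 (by omega) (by omega) (by omega) (by omega))
    fun r _ _ => a3 r
  have f1 : SweepFrame n m s s1 := h.frame.trans ⟨fun x _ => by rw [a1], a2, fun x hx _ _ =>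
    a4 x (by omega) (by omega) (by omega) (by omega)⟩
  have c1 := f1.ctx hc
  have chi_le : I.pairChi σ A B p u ≤ 1 := by
    unfold Instance.pairChi chiN; split_ifs <;> omega
  have psi_le : I.pairPsi σ A B p u ≤ 1 := by
    unfold Instance.pairPsi psiN; split_ifs <;> omega
  refine Straight.seq ((straight_update hw F1 acc1 c1.m_eq a5 hpn (by rw [a6]; exact chi_le)
    (by rw [a7]; exact psi_le)).imp ?_)
  rintro s2 ⟨F2, acc2, b1, b2, b3, b4, b5⟩
  have f2 : SweepFrame n m s s2 := f1.trans ⟨fun x _ => by rw [b1], b2, fun x hx _ h7 =>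
    b3 x (by omega) h7⟩
  have w6 : s2.word 6 = s'.word 6 := by
    rw [b3 6 (by omega) (by omega), a4 6 (by omega) (by omega) (by omega) (by omega)]
  have best2 : BestOk I s2 := h.best.congr w6 fun c _ _ => by rw [b1, a1]
  have t2 : Tracks I σ A B s (k + 1) s2 := by
    intro x hx hlast
    rw [b4, b5, a3, a3, a6, a7]
    -- A last occurrence of the pair just updated must be position `k` itself; other pairs keep
    -- their entries.
    by_cases e : pairOf (n * m) (idxOf s x) = p
    · have hxk : x = k := by
        by_contra hne
        exact hlast k (by omega) (by omega) e.symm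
      rw [e, hxk, Function.update_self, Function.update_self]
      exact ⟨rfl, rfl⟩
    · rw [Function.update_of_ne e, Function.update_of_ne e]
      have hxk : x ≠ k := by rintro rfl; exact e rfl
      exact h.tracks x (by omega) fun y hy hyk => hlast y hy (by omega)
  have k2 : s2.word 23 = k := by
    rw [b3 23 (by omega) (by omega), a4 23 (by omega) (by omega) (by omega) (by omega), hk']
  have v2 := f2.valOf hc
  have g2 : GroupEnd (3 * (32 * (n * m))) s2 k ↔ GroupEnd (3 * (32 * (n * m))) s k := by
    unfold GroupEnd; rw [v2, f2.idx]
  have hcount : GroupEnd (3 * (32 * (n * m))) s k → ValidAt A B u → s2.word 7 = I.covAt σ A B u :=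
    fun hg hv => hp.count_eq hk t2 acc2 hg hv.1
  refine (straight_record hw F2 (f2.ctx hc) (f2.onCurve hu) k2 acc2.count_le hσ (by
    rw [v2, f2.idx, g2]; exact hcount) best2).imp ?_
  rintro s3 ⟨F3, d1, d2, d3, d4, d5, d6, d7⟩
  rw [v2, f2.idx, g2] at d7
  refine ⟨d4, F3, f2.trans d1, acc2.congr d3 fun r _ _ => d2 r, d5,
    h.best_le.trans (w6 ▸ d6), ?_, ?_⟩
  · intro x hx hlast
    rw [d2, d2]
    exact t2 x hx hlast
  · intro x hx hg hv
    by_cases e : x = k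
    · rw [e] at hg hv ⊢
      rw [← hcount hg hv]
      exact d7 hg hv
    · exact (h.checked x (by omega) hg hv).trans (w6 ▸ d6)

theorem ok_sweep : ∃ K, ∀ (n m w : ℕ) (I : Instance n m) (σ : ℝ) (A B : Quad ℝ) (s : State),
    Room n m w → Ctx I s → OnCurve n m σ A B s → σ = 1 ∨ σ = -1 → Prepared I σ A B s → s.Fits w →
    Acc n m s → BestOk I s →
    Ok w sweep s (K * (3 * (32 * (n * m)) + 1)) (SweepInv I w σ A B s (3 * (32 * (n * m)))) := by
  refine ⟨(3 * wvar 4).cost + Program.time sweepStep + 12,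
    fun n m w I σ A B s hw hc hu hσ hp hs hacc hb => ?_⟩
  obtain ⟨r1, r2⟩ := hw.cells
  refine (Ok.for (N := 3 * (32 * (n * m))) (T := Program.time sweepStep)
    (I := SweepInv I w σ A B s) (by omega) (by omega) hs ?_ ?_ ?_ ?_).imp ?_
  · intro k s' h
    exact ⟨h.fits, by simp [(h.frame.ctx hc).crits]⟩
  · intro k s' v h hv
    have h6 : (s'.setWord 23 v).word 6 = s'.word 6 := State.word_setWord_of_ne _ _ (by omega)
    have hcell : ∀ r, cellOf r (s'.setWord 23 v) = cellOf r s' :=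
      fun r => cellOf_setWord_scalar (by omega)
    refine ⟨h.fits.setWord (by omega) hv, h.frame.trans ⟨fun _ _ => rfl,
      idxOf_setWord_scalar (by omega), fun x _ _ _ => State.word_setWord_of_ne _ _ (by omega)⟩,
      h.acc.congr (State.word_setWord_of_ne _ _ (by omega)) fun r _ _ => hcell r,
      h.best.congr h6 fun _ _ _ => rfl, h6 ▸ h.best_le, ?_, h6 ▸ h.checked⟩
    unfold Tracks
    rw [hcell, hcell]
    exact h.tracks
  · have h6 : (s.setWord 23 0).word 6 = s.word 6 := State.word_setWord_of_ne _ _ (by omega)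
    exact ⟨hs.setWord (by omega) (by omega), ⟨fun _ _ => rfl,
      idxOf_setWord_scalar (by omega), fun x _ _ _ => State.word_setWord_of_ne _ _ (by omega)⟩,
      hacc.congr (State.word_setWord_of_ne _ _ (by omega)) fun r _ _ =>
        cellOf_setWord_scalar (by omega),
      hb.congr h6 fun _ _ _ => rfl, h6.ge, fun x hx => absurd hx (by omega),
      fun x hx => absurd hx (by omega)⟩
  · intro k hk s' h hk'
    exact straight_sweepStep hw hc hu hσ hp hk h hk'
  · exact fun s' h => h.2

end MCR

namespace RealRAM

theorem Ok.unroll {w T : ℕ} {f : ℕ → Program} {s : State} {I : ℕ → State → Prop} {k : ℕ}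
    (hs : s.Fits w) (h0 : I 0 s) (hstep : ∀ o < k, ∀ s, I o s → Ok w (f o) s T (I (o + 1))) :
    Ok w (.unroll f k) s (k * T + 1) (I k) := by
  induction k with
  | zero => exact (Ok.skip hs h0).le (by omega)
  | succ k ih =>
    exact (Ok.seq (ih fun o ho => hstep o (by omega)) fun s' => hstep k (by omega) s').le
      (by rw [Nat.succ_mul]; omega)

end RealRAM

namespace MCR
open RealRAM Code

/-! ### Searching all curves -/

namespace Code

def curve : Program := .seq prepare sweep

/-- The cells that describe a curve. -/
def quadCell (A B : Quad RExpr) : ℕ → RExpr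
  | 0 => A.c0
  | 1 => A.c1
  | 2 => A.c2
  | 3 => B.c0
  | 4 => B.c1
  | _ => B.c2

def setCurve (A B : Quad RExpr) : Program :=
  .unroll (fun c => .rset (wvar 2 + 1 + .lit c) (quadCell A B c)) 6

def edgeE (p : WExpr) (f : Fin 5) : Lin RExpr :=
  edgeLin (tailE p).1 (tailE p).2 (headE p).1 (headE p).2 f

def edgeA (p : WExpr) (f : Fin 5) : Quad RExpr := quadA sigE dirE.1 dirE.2 (edgeE p f)

def edgeB (p : WExpr) (f : Fin 5) : Quad RExpr :=
  quadB sigE aE.1 aE.2 (ptE (p / wvar 1)).1 (ptE (p / wvar 1)).2 (edgeE p f)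

def edgeCurve (f : Fin 5) : Program :=
  .seq (setCurve (edgeA (wvar 8) f) (edgeB (wvar 8) f)) curve

def pairCurves : Program := .unroll (fun f => edgeCurve (Fin.ofNat 5 f)) 5

/-- Search all curves with the given value of `σ`. -/
def side (σ : RExpr) : Program :=
  .seq (.rset (wvar 2) σ) (.seq (setCurve ⟨1, 0, 0⟩ ⟨0, 0, 0⟩) (.seq curve
    (.for 8 (wvar 3) pairCurves)))

def init : Program :=
  .seq (.wset (.lit 2) (4 + 2 * wvar 0 + 2 * wvar 1))
    (.seq (.wset (.lit 3) (wvar 0 * wvar 1)) (.wset (.lit 4) (32 * wvar 3)))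

/-- Overwriting input cells is harmless: the results lie beyond the input and their base address is
in an integer cell. -/
def output : Program :=
  .seq (.rset (.lit 0) (.cell (wvar 2 + 11)))
    (.seq (.rset (.lit 1) (.cell (wvar 2 + 12))) (.rset (.lit 2) (.cell (wvar 2 + 13))))

def main : Program := .seq init (.seq (side 1) (.seq (side (0 - 1)) output))

end Code

/-- The time for one curve, up to a constant factor. -/
def curveTime (M : ℕ) : ℕ := (3 * (32 * M) + 1) * (Nat.clog 2 (3 * (32 * M)) + 1)

theorem curveTime_pos (M : ℕ) : 1 ≤ curveTime M := Nat.mul_pos (by omega) (by omega)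

section
variable {n m w : ℕ} {I : Instance n m} {σ : ℝ} {A B : Quad ℝ} {s s' : State}

/-- The value `v` is larger than the number of points covered anywhere on the curve. -/
def Seen (I : Instance n m) (σ : ℝ) (A B : Quad ℝ) (v : ℕ) : Prop :=
  ∀ u, ValidAt A B u → I.covAt σ A B u + 1 ≤ v

theorem Seen.mono {v v' : ℕ} (h : Seen I σ A B v) (hv : v ≤ v') : Seen I σ A B v' :=
  fun u hu => (h u hu).trans hv

/-- The state between the searches of two curves. -/
structure Ready (I : Instance n m) (w : ℕ) (s : State) : Prop where
  fits : s.Fits w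
  ctx : Ctx I s
  acc : Acc n m s
  best : BestOk I s

theorem Ready.setReal (h : Ready I w s) (hw : Room n m w) {a : ℕ} {v : ℝ} (h1 : inputLen n m ≤ a)
    (h2 : a < inputLen n m + 11) : Ready I w (s.setReal a v) := by
  have := hw.cells
  exact ⟨h.fits.setReal (by omega) v, h.ctx.congr (fun _ _ => rfl) fun x hx =>
    State.real_setReal_of_ne _ _ (by omega), h.acc.congr rfl fun _ _ _ => rfl,
    h.best.congr rfl fun c _ _ => State.real_setReal_of_ne _ _ (by omega)⟩

theorem Ready.setWord (h : Ready I w s) (hw : Room n m w) {a v : ℕ} (h1 : 8 ≤ a)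
    (h2 : a < 64) (hv : v ≤ w) : Ready I w (s.setWord a v) := by
  have := hw.cells
  exact ⟨h.fits.setWord (by omega) hv, h.ctx.congr
    (fun x hx => State.word_setWord_of_ne _ _ (by omega)) fun x hx => rfl,
    h.acc.congr (State.word_setWord_of_ne _ _ (by omega)) fun _ _ _ => cellOf_setWord_scalar h2,
    h.best.congr (State.word_setWord_of_ne _ _ (by omega)) fun c _ _ => rfl⟩

/-- What the search of a curve does not change. -/
structure CurveFrame (n m : ℕ) (s s' : State) : Prop where
  best_le : s.word 6 ≤ s'.word 6
  word : s'.word 8 = s.word 8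
  real : s'.real (inputLen n m) = s.real (inputLen n m)

theorem CurveFrame.trans {s'' : State} (h : CurveFrame n m s s') (h' : CurveFrame n m s' s'') :
    CurveFrame n m s s'' :=
  ⟨h.1.trans h'.1, h'.2.trans h.2, h'.3.trans h.3⟩

end

/-- Any valid parameter has the coverage of some valid sample, and the last sample of that group is
checked by the sweep. The counters left from the previous curve need no reset: they only have to be
consistent, and every pair is reevaluated before anything is recorded. -/
theorem ok_curve : ∃ K, ∀ (n m w : ℕ) (I : Instance n m) (σ : ℝ) (A B : Quad ℝ) (s : State),
    Room n m w → Ready I w s → OnCurve n m σ A B s → σ = 1 ∨ σ = -1 →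
    Ok w curve s (K * curveTime (n * m)) (fun s' => Ready I w s' ∧ CurveFrame n m s s' ∧
      Seen I σ A B (s'.word 6)) := by
  obtain ⟨K1, H1⟩ := ok_prepare
  obtain ⟨K2, H2⟩ := ok_sweep
  refine ⟨K1 + K2, fun n m w I σ A B s hw hs hu hσ => ?_⟩
  have hnm : 0 < n * m := Nat.mul_pos hw.n_pos hw.m_pos
  refine Ok.le (T := K1 * curveTime (n * m) + K2 * (3 * (32 * (n * m)) + 1)) ?_ ?_
  · refine Ok.seq (H1 n m w I σ A B s hw hs.ctx hu hs.fits) ?_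
    rintro s1 ⟨F1, f1, p1⟩
    have w6 : s1.word 6 = s.word 6 := f1.word_low 6 (by omega)
    have acc1 : Acc n m s1 := hs.acc.congr (f1.word_low 7 (by omega)) fun r h1 h2 => by
      funext x
      exact f1.word_high _ (by simp only [addr]; omega) (by simp only [addr]; omega)
    have best1 : BestOk I s1 := hs.best.congr w6 fun c _ _ => f1.real_low _ (by omega)
    refine (H2 n m w I σ A B s1 hw (f1.ctx hs.ctx) (f1.onCurve hu) hσ p1 F1 acc1 best1).imp ?_
    intro s2 h
    refine ⟨⟨h.fits, h.frame.ctx (f1.ctx hs.ctx), h.acc, h.best⟩, ⟨w6 ▸ h.best_le, ?_, ?_⟩, ?_⟩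
    · rw [h.frame.word 8 (by omega) (by omega) (by omega), f1.word_low 8 (by omega)]
    · rw [h.frame.real _ (by omega), f1.real_low _ (by omega)]
    · intro u hv
      obtain ⟨e, he, hv', heq⟩ := Instance.exists_sample_covAt p1.samples hnm p1.crit hv
      rw [← heq]
      obtain ⟨x, hx, rfl⟩ := p1.ordered.surj e he
      classical
      -- The last position with the same parameter is the end of its group.
      have hspec := Nat.findGreatest_spec (P := fun y => x ≤ y ∧ y < 3 * (32 * (n * m)) ∧
        valOf s1 (idxOf s1 y) = valOf s1 (idxOf s1 x)) hx.le ⟨le_rfl, hx, rfl⟩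
      have hmax := fun y => Nat.le_findGreatest (m := y) (n := 3 * (32 * (n * m)))
        (P := fun y => x ≤ y ∧ y < 3 * (32 * (n * m)) ∧
          valOf s1 (idxOf s1 y) = valOf s1 (idxOf s1 x))
      set y := Nat.findGreatest (fun y => x ≤ y ∧ y < 3 * (32 * (n * m)) ∧
        valOf s1 (idxOf s1 y) = valOf s1 (idxOf s1 x)) (3 * (32 * (n * m)))
      obtain ⟨h1, h2, h3⟩ := hspec
      have := h.checked y h2 (fun hy => lt_of_le_of_ne (p1.ordered.sorted y hy) fun heq => by
        have := hmax (y + 1) (by omega) ⟨by omega, hy, heq.symm.trans h3⟩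
        omega) (h3 ▸ hv')
      rwa [h3] at this
  · have : 3 * (32 * (n * m)) + 1 ≤ curveTime (n * m) := Nat.le_mul_of_pos_right _ (by omega)
    have := Nat.mul_le_mul_left K2 this
    rw [add_mul]; omega

/-- The coefficients are written one at a time, so `hQ` asks that the expressions depend only on the
input, on `σ` and on cell 8, none of which is overwritten. -/
theorem straight_setCurve {n m w : ℕ} {I : Instance n m} {σ : ℝ} {A B : Quad ℝ} {s : State}
    {QA QB : Quad RExpr} (hw : Room n m w) (hs : Ready I w s) (hσ : s.real (inputLen n m) = σ)
    (hQ : ∀ s', Ctx I s' → s'.real (inputLen n m) = σ → s'.word 8 = s.word 8 →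
      QA.evalE s' = A ∧ QB.evalE s' = B) :
    Straight w (setCurve QA QB) s (fun s' => Ready I w s' ∧ CurveFrame n m s s' ∧
      OnCurve n m σ A B s') := by
  obtain ⟨r1, r2⟩ := hw.cells
  let val : ℕ → ℝ := fun c => match c with
    | 0 => A.c0
    | 1 => A.c1
    | 2 => A.c2
    | 3 => B.c0
    | 4 => B.c1
    | _ => B.c2
  refine (Straight.unroll (I := fun o s' => Ready I w s' ∧ CurveFrame n m s s' ∧
    ∀ c < o, s'.real (inputLen n m + 1 + c) = val c) hs.fits ⟨hs, ⟨le_rfl, rfl, rfl⟩, by simp⟩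
    ?_).imp ?_
  · rintro o ho s1 ⟨h1, h2, h3⟩
    have ha : (wvar 2 + 1 + .lit o).eval s1 = inputLen n m + 1 + o := by simp [h1.ctx.base]
    have hv : (quadCell QA QB o).eval s1 = val o := by
      obtain ⟨rfl, rfl⟩ := hQ s1 h1.ctx (h2.real.trans hσ) h2.word
      rcases o with _ | _ | _ | _ | _ | _ | o <;> rfl
    refine Straight.rset h1.fits (by omega) fun _ => ?_
    rw [ha, hv]
    refine ⟨h1.setReal hw (by omega) (by omega), ⟨h2.best_le, h2.word, ?_⟩, fun c hc => ?_⟩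
    · rw [State.real_setReal_of_ne _ _ (by omega), h2.real]
    · rw [State.real_setReal]
      split_ifs with h
      · rw [Nat.add_left_cancel h]
      · exact h3 c (by omega)
  · rintro s' ⟨h1, h2, h3⟩
    exact ⟨h1, h2, h2.real.trans hσ, h3 0 (by omega), h3 1 (by omega), h3 2 (by omega),
      h3 3 (by omega), h3 4 (by omega), h3 5 (by omega)⟩

/-- The quadratic polynomials of the curve that belongs to a pair and a functional. -/
noncomputable def Instance.pairA {n m : ℕ} (I : Instance n m) (σ : ℝ) (p : ℕ) (f : Fin 5) :
    Quad ℝ := linA σ I.dir (edgeFun (I.tail p) (I.head p) f)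
noncomputable def Instance.pairB {n m : ℕ} (I : Instance n m) (σ : ℝ) (p : ℕ) (f : Fin 5) :
    Quad ℝ := linB σ I.a (I.pt (p / m)) (edgeFun (I.tail p) (I.head p) f)

theorem evalE_edge {n m : ℕ} {I : Instance n m} {σ : ℝ} {s : State} (hc : Ctx I s) (hm : 0 < m)
    (hσ : s.real (inputLen n m) = σ) {p : WExpr} (hp : p.eval s < n * m) (f : Fin 5) :
    (edgeA p f).evalE s = I.pairA σ (p.eval s) f ∧ (edgeB p f).evalE s = I.pairB σ (p.eval s) f := by
  have hd : (p / wvar 1).eval s < n := by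
    simp only [WExpr.eval_div, eval_wvar, hc.m_eq]
    exact Nat.div_lt_of_lt_mul (by rwa [mul_comm])
  have h1 := hc.evalPair_ptE hd
  simp only [WExpr.eval_div, eval_wvar, hc.m_eq] at h1
  have hs : sigE.eval s = σ := by simp [sigE, hc.base, hσ]
  have he : (edgeE p f).evalE s = edgeFun (I.tail (p.eval s)) (I.head (p.eval s)) f := by
    rw [edgeE, evalE_edgeLin, edgeFun, ← hc.evalPair_tailE hm p, ← hc.evalPair_headE hm p]
    rfl
  constructor
  · rw [edgeA, evalE_quadA, he, hs, Instance.pairA, linA, ← hc.evalPair_dirE]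
    rfl
  · rw [edgeB, evalE_quadB, he, hs, Instance.pairB, linB, ← hc.evalPair_aE, ← h1]
    rfl

theorem ok_edgeCurve : ∃ K, ∀ (n m w p : ℕ) (I : Instance n m) (σ : ℝ) (s : State) (f : Fin 5),
    Room n m w → Ready I w s → σ = 1 ∨ σ = -1 → s.real (inputLen n m) = σ → s.word 8 = p →
    p < n * m →
    Ok w (edgeCurve f) s (K * curveTime (n * m)) (fun s' => Ready I w s' ∧ CurveFrame n m s s' ∧
      Seen I σ (I.pairA σ p f) (I.pairB σ p f) (s'.word 6)) := by
  obtain ⟨K, H⟩ := ok_curve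
  -- The five program texts differ, so their times are bounded by a common constant.
  obtain ⟨T, hT⟩ : ∃ T, ∀ f : Fin 5,
      (setCurve (edgeA (wvar 8) f) (edgeB (wvar 8) f)).time ≤ T :=
    ⟨∑ f : Fin 5, (setCurve (edgeA (wvar 8) f) (edgeB (wvar 8) f)).time, fun f =>
      Finset.single_le_sum (f := fun f : Fin 5 =>
        (setCurve (edgeA (wvar 8) f) (edgeB (wvar 8) f)).time) (fun _ _ => Nat.zero_le _)
        (Finset.mem_univ f)⟩
  refine ⟨T + K, fun n m w p I σ s f hw hs hσ hsσ hp hpn => ?_⟩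
  refine Ok.le (T := T + K * curveTime (n * m)) ?_ (by
    have := Nat.le_mul_of_pos_right T (curveTime_pos (n * m))
    rw [add_mul]; omega)
  refine Ok.seq (Ok.le (straight_setCurve hw hs hsσ (A := I.pairA σ p f) (B := I.pairB σ p f)
    fun s' hc hσ' h8 => ?_).ok (hT f)) ?_
  · have h8 : (wvar 8).eval s' = p := by rw [eval_wvar, h8, hp]
    have := evalE_edge hc hw.m_pos hσ' (p := wvar 8) (by rwa [h8]) f
    rwa [h8] at this
  · rintro s1 ⟨h1, h2, h3⟩
    refine (H n m w I σ _ _ s1 hw h1 h3 hσ).imp ?_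
    rintro s2 ⟨h4, h5, h6⟩
    exact ⟨h4, h2.trans h5, h6⟩

theorem ok_pairCurves : ∃ K, ∀ (n m w p : ℕ) (I : Instance n m) (σ : ℝ) (s : State),
    Room n m w → Ready I w s → σ = 1 ∨ σ = -1 → s.real (inputLen n m) = σ → s.word 8 = p →
    p < n * m →
    Ok w pairCurves s (K * curveTime (n * m)) (fun s' => Ready I w s' ∧ CurveFrame n m s s' ∧
      ∀ f, Seen I σ (I.pairA σ p f) (I.pairB σ p f) (s'.word 6)) := by
  obtain ⟨K, H⟩ := ok_edgeCurve
  refine ⟨5 * K + 1, fun n m w p I σ s hw hs hσ hsσ hp hpn => ?_⟩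
  refine Ok.mono (T := 5 * (K * curveTime (n * m)) + 1) (Ok.unroll (I := fun o s' => Ready I w s' ∧
    CurveFrame n m s s' ∧ ∀ f : Fin 5, f < o → Seen I σ (I.pairA σ p f) (I.pairB σ p f) (s'.word 6))
    hs.fits ⟨hs, ⟨le_rfl, rfl, rfl⟩, fun f hf => absurd hf (by omega)⟩ ?_) ?_ ?_
  · rintro o ho s1 ⟨h1, h2, h3⟩
    refine (H n m w p I σ s1 (Fin.ofNat 5 o) hw h1 hσ (h2.real.trans hsσ) (h2.word.trans hp)
      hpn).imp ?_
    rintro s2 ⟨h4, h5, h6⟩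
    refine ⟨h4, h2.trans h5, fun f hf => ?_⟩
    by_cases e : (f : ℕ) = o
    · have : Fin.ofNat 5 o = f := Fin.ext (by rw [← e]; exact Nat.mod_eq_of_lt f.2)
      rwa [this] at h6
    · exact (h3 f (by omega)).mono h5.best_le
  · have := curveTime_pos (n * m)
    rw [add_mul, mul_assoc]; omega
  · rintro s' ⟨h1, h2, h3⟩
    exact ⟨h1, h2, fun f => h3 f f.2⟩

theorem ok_side (e : RExpr) : ∃ K, ∀ (n m w : ℕ) (I : Instance n m) (σ : ℝ) (s : State),
    Room n m w → Ready I w s → σ = 1 ∨ σ = -1 → e.eval s = σ →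
    Ok w (side e) s (K * ((n * m + 1) * curveTime (n * m))) (fun s' => Ready I w s' ∧
      s.word 6 ≤ s'.word 6 ∧ ∀ A B, I.IsCurve σ A B → Seen I σ A B (s'.word 6)) := by
  obtain ⟨K1, H1⟩ := ok_curve
  obtain ⟨K2, H2⟩ := ok_pairCurves
  set c1 := (Program.rset (wvar 2) e).time with hc1
  set c2 := (setCurve ⟨1, 0, 0⟩ ⟨0, 0, 0⟩).time with hc2
  set c3 := (wvar 3).cost + 12 with hc3
  refine ⟨c1 + c2 + K1 + (c3 + K2), fun n m w I σ s hw hs hσ hes => ?_⟩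
  obtain ⟨r1, r2⟩ := hw.cells
  refine Ok.le (T := c1 + (c2 + (K1 * curveTime (n * m) +
    ((wvar 3).cost + K2 * curveTime (n * m) + 12) * (n * m + 1)))) ?_ ?_
  · have ha : (wvar 2).eval s = inputLen n m := hs.ctx.base
    refine Ok.seq (Ok.rset (Q := fun s1 => Ready I w s1 ∧ s1.word 6 = s.word 6 ∧
      s1.real (inputLen n m) = σ) hs.fits (by omega) fun F => ?_) ?_
    · rw [ha, hes]
      exact ⟨hs.setReal hw le_rfl (by omega), rfl, State.real_setReal_self _ _ _⟩
    rintro s1 ⟨h1, w1, σ1⟩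
    refine Ok.seq (straight_setCurve (A := ⟨1, 0, 0⟩) (B := ⟨0, 0, 0⟩) hw h1 σ1 fun s' _ _ _ => by
      simp [Quad.evalE]).ok ?_
    rintro s2 ⟨h2, f2, u2⟩
    refine Ok.seq (H1 n m w I σ _ _ s2 hw h2 u2 hσ) ?_
    rintro s3 ⟨h3, f3, seen3⟩
    have le3 : s.word 6 ≤ s3.word 6 := w1 ▸ f2.best_le.trans f3.best_le
    have σ3 : s3.real (inputLen n m) = σ := (f3.real.trans f2.real).trans σ1
    refine (Ok.for (N := n * m) (T := K2 * curveTime (n * m)) (I := fun k s' => Ready I w s' ∧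
      s3.word 6 ≤ s'.word 6 ∧ s'.real (inputLen n m) = σ ∧ ∀ p < k, ∀ f,
        Seen I σ (I.pairA σ p f) (I.pairB σ p f) (s'.word 6)) (by omega) (by omega) h3.fits
      ?_ ?_ ?_ ?_).imp ?_
    · rintro k s' ⟨g1, -⟩
      exact ⟨g1.fits, g1.ctx.pairs⟩
    · rintro k s' v ⟨g1, g2, g3, g4⟩ hv
      have : (s'.setWord 8 v).word 6 = s'.word 6 := State.word_setWord_of_ne _ _ (by omega)
      exact ⟨g1.setWord hw (by omega) (by omega) hv, this ▸ g2, g3, this ▸ g4⟩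
    · have : (s3.setWord 8 0).word 6 = s3.word 6 := State.word_setWord_of_ne _ _ (by omega)
      exact ⟨h3.setWord hw (by omega) (by omega) (by omega), this.ge, σ3,
        fun p hp => absurd hp (by omega)⟩
    · rintro k hk s' ⟨g1, g2, g3, g4⟩ hk'
      refine (H2 n m w k I σ s' hw g1 hσ g3 hk' hk).imp ?_
      rintro s'' ⟨k1, k2, k3⟩
      refine ⟨k2.word.trans hk', k1, g2.trans k2.best_le, k2.real.trans g3, fun p hp f => ?_⟩
      by_cases e : p = k
      · rw [e]; exact k3 f
      · exact (g4 p (by omega) f).mono k2.best_le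
    · rintro s' ⟨-, g1, g2, g3, g4⟩
      refine ⟨g1, le3.trans g2, ?_⟩
      -- Point `i` and edge `j` form the pair with index `i * m + j`.
      rintro A B (⟨rfl, rfl⟩ | ⟨i, hi, j, hj, f, rfl, rfl⟩)
      · exact seen3.mono g2
      · have hd : (i * m + j) / m = i := by
          rw [mul_comm, Nat.mul_add_div (by omega), Nat.div_eq_of_lt hj, add_zero]
        have hr : (i * m + j) % m = j := by rw [mul_comm, Nat.mul_add_mod, Nat.mod_eq_of_lt hj]
        have := g4 (i * m + j) (add_mul_lt hi hj) f
        rwa [Instance.pairA, Instance.pairB, Instance.tail, Instance.head, hd, hr] at this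
  · have hp := curveTime_pos (n * m)
    generalize curveTime (n * m) = X at hp ⊢
    have e1 : X ≤ (n * m + 1) * X := Nat.le_mul_of_pos_left _ (by omega)
    have e2 : n * m + 1 ≤ (n * m + 1) * X := Nat.le_mul_of_pos_right _ hp
    have f1 := Nat.mul_le_mul_left K1 e1
    have f2 := Nat.mul_le_mul_left c3 e2
    have f3 := Nat.le_mul_of_pos_right (c1 + c2) (show 0 < (n * m + 1) * X by omega)
    calc _ = c1 + c2 + K1 * X + (c3 * (n * m + 1) + K2 * ((n * m + 1) * X)) := by rw [hc3]; ring
      _ ≤ (c1 + c2) * ((n * m + 1) * X) + K1 * ((n * m + 1) * X) +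
          (c3 * ((n * m + 1) * X) + K2 * ((n * m + 1) * X)) := by omega
      _ = _ := by ring

end MCR

namespace MCR
open RealRAM Code

/-! ### The input -/

theorem getD_flatMap_pair (l : List (ℝ × ℝ)) (i : ℕ) :
    (l.flatMap fun p => [p.1, p.2]).getD (2 * i) 0 = (l.getD i 0).1 ∧
      (l.flatMap fun p => [p.1, p.2]).getD (2 * i + 1) 0 = (l.getD i 0).2 := by
  induction l generalizing i with
  | nil => simp
  | cons p l ih =>
    cases i with
    | zero => simp
    | succ i =>
      have := ih i
      simpa [Nat.mul_succ] using this

namespace Instance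
variable {n m w : ℕ} (I : Instance n m)

/-- The points of the plane that form the input. -/
noncomputable def inputPoints : List (ℝ × ℝ) :=
  [I.a, I.b] ++ List.ofFn I.points ++ List.ofFn I.polygon.vertices

theorem input_real_eq (i : ℕ) : I.input.real (2 * i) = (I.inputPoints.getD i 0).1 ∧
    I.input.real (2 * i + 1) = (I.inputPoints.getD i 0).2 :=
  getD_flatMap_pair _ _

theorem inputPoints_pt {i : ℕ} (hi : i < n) : I.inputPoints.getD (2 + i) 0 = I.pt i := by
  rw [inputPoints, List.append_assoc, List.getD_append_right _ _ _ _ (by simp),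
    List.getD_append _ _ _ _ (by simpa using hi)]
  simp [pt, hi]

theorem inputPoints_vert {j : ℕ} (hj : j < m) : I.inputPoints.getD (2 + n + j) 0 = I.vert j := by
  rw [inputPoints, List.getD_append_right _ _ _ _ (by simp; omega)]
  have : 2 + n + j - ([I.a, I.b] ++ List.ofFn I.points).length = j := by simp; omega
  rw [this]
  simp [vert, hj]

theorem inputPoints_ge {k : ℕ} (hk : 2 + n + m ≤ k) : I.inputPoints.getD k 0 = 0 :=
  List.getD_eq_default _ _ (by simp [inputPoints]; omega)

theorem input_word_ge {x : ℕ} (hx : 2 ≤ x) : I.input.word x = 0 :=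
  List.getD_eq_default _ _ (by simpa using hx)

theorem input_real_ge {x : ℕ} (hx : inputLen n m ≤ x) : I.input.real x = 0 := by
  rw [inputLen_eq] at hx
  obtain ⟨k, rfl | rfl⟩ : ∃ k, x = 2 * k ∨ x = 2 * k + 1 := ⟨x / 2, by omega⟩
  · rw [(I.input_real_eq k).1, inputPoints_ge _ (by omega)]; rfl
  · rw [(I.input_real_eq k).2, inputPoints_ge _ (by omega)]; rfl

theorem input_fits (hw : Room n m w) : I.input.Fits w := by
  obtain ⟨r1, r2⟩ := hw.cells
  have := hw.n_le
  have := hw.m_le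
  have e := inputLen_eq n m
  refine ⟨fun x hx => ⟨I.input_word_ge (by omega), I.input_real_ge (by omega)⟩, fun x => ?_⟩
  rcases x with _ | _ | x
  · change n ≤ w; omega
  · change m ≤ w; omega
  · rw [I.input_word_ge (by omega)]; omega

end Instance

theorem straight_init {n m w : ℕ} (I : Instance n m) (hw : Room n m w) :
    Straight w init I.input (fun s => Ready I w s ∧ s.word 6 = 0) := by
  obtain ⟨r1, r2⟩ := hw.cells
  have hn := hw.n_le
  have hm := hw.m_le
  have e := inputLen_eq n m
  have w0 : I.input.word 0 = n := rfl
  have w1 : I.input.word 1 = m := rfl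
  refine Straight.seq (Straight.wset (I.input_fits hw) (by simp; omega)
    (by simp [w0, w1]; omega) fun F1 => ?_)
  have e2 : (4 + 2 * wvar 0 + 2 * wvar 1).eval I.input = inputLen n m := by simp [w0, w1, e]
  rw [e2] at F1 ⊢
  simp only [WExpr.eval_lit] at F1 ⊢
  set s1 := I.input.setWord 2 (inputLen n m) with hs1
  have e3 : (wvar 0 * wvar 1).eval s1 = n * m := by
    simp [hs1, State.word_setWord, w0, w1]
  refine Straight.seq (Straight.wset F1 (by simp; omega) (by rw [e3]; omega) fun F2 => ?_)
  rw [e3] at F2 ⊢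
  simp only [WExpr.eval_lit] at F2 ⊢
  set s2 := s1.setWord 3 (n * m) with hs2
  have e4 : (32 * wvar 3).eval s2 = 32 * (n * m) := by simp [hs2]
  refine Straight.wset F2 (by simp; omega) (by rw [e4]; omega) fun F3 => ?_
  rw [e4] at F3 ⊢
  simp only [WExpr.eval_lit] at F3 ⊢
  set s3 := s2.setWord 4 (32 * (n * m)) with hs3
  have hword : ∀ x, 5 ≤ x → s3.word x = 0 := fun x hx => by
    rw [hs3, State.word_setWord_of_ne _ _ (by omega), hs2, State.word_setWord_of_ne _ _ (by omega),
      hs1, State.word_setWord_of_ne _ _ (by omega), I.input_word_ge (by omega)]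
  have hcell : ∀ r x, cellOf r s3 x = 0 := fun r x => hword _ (by simp only [addr]; omega)
  have hreal : s3.real = I.input.real := rfl
  refine ⟨⟨F3, ?_, ?_, Or.inl (hword 6 (by omega))⟩, hword 6 (by omega)⟩
  · constructor
    · simp [hs3, hs2, hs1, State.word_setWord, w0]
    · simp [hs3, hs2, hs1, State.word_setWord, w1]
    · simp [hs3, hs2, hs1, State.word_setWord]
    · simp [hs3, hs2, hs1, State.word_setWord]
    · simp [hs3, hs2, hs1, State.word_setWord]
    · exact (I.input_real_eq 0).1
    · exact (I.input_real_eq 0).2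
    · exact (I.input_real_eq 1).1
    · exact (I.input_real_eq 1).2
    · intro i hi
      rw [hreal, ← I.inputPoints_pt hi, ← (I.input_real_eq (2 + i)).1, Nat.mul_add]
    · intro i hi
      rw [hreal, ← I.inputPoints_pt hi, ← (I.input_real_eq (2 + i)).2]
      congr 1; ring
    · intro j hj
      rw [hreal, ← I.inputPoints_vert hj, ← (I.input_real_eq (2 + n + j)).1]
      congr 1; ring
    · intro j hj
      rw [hreal, ← I.inputPoints_vert hj, ← (I.input_real_eq (2 + n + j)).2]
      congr 1; ring
  · constructor
    · simp [hcell]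
    · simp [hcell]
    · simp [hcell]
    · simp [hcell]
    · simp [hcell, statusOf]
    · simp [hcell, hword]

theorem straight_output {n m w : ℕ} {I : Instance n m} {s : State} (hw : Room n m w)
    (hs : Ready I w s) : Straight w output s (fun s' =>
      s'.real 0 = s.real (inputLen n m + 11) ∧ s'.real 1 = s.real (inputLen n m + 12) ∧
      s'.real 2 = s.real (inputLen n m + 13)) := by
  obtain ⟨r1, r2⟩ := hw.cells
  have e := inputLen_eq n m
  refine Straight.seq (Straight.rset hs.fits (by simp; omega) fun F1 => ?_)
  refine Straight.seq (Straight.rset F1 (by simp; omega) fun F2 => ?_)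
  refine Straight.rset F2 (by simp; omega) fun F3 => ?_
  have h2 : s.word 2 = inputLen n m := hs.ctx.base
  simp [State.real_setReal, h2]

theorem ok_main : ∃ K, ∀ (n m w : ℕ) (I : Instance n m), I.Valid → Room n m w →
    Ok w main I.input (K * ((n * m + 1) * curveTime (n * m))) I.Answer := by
  obtain ⟨K1, H1⟩ := ok_side 1
  obtain ⟨K2, H2⟩ := ok_side (0 - 1)
  refine ⟨init.time + K1 + K2 + output.time, fun n m w I hI hw => ?_⟩
  refine Ok.le (T := init.time + (K1 * ((n * m + 1) * curveTime (n * m)) +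
    (K2 * ((n * m + 1) * curveTime (n * m)) + output.time))) ?_ ?_
  · refine Ok.seq (straight_init I hw).ok ?_
    rintro s0 ⟨h0, -⟩
    refine Ok.seq (H1 n m w I 1 s0 hw h0 (Or.inl rfl) (by simp)) ?_
    rintro s1 ⟨h1, -, seen1⟩
    refine Ok.seq (H2 n m w I (-1) s1 hw h1 (Or.inr rfl) (by simp)) ?_
    rintro s2 ⟨h2, le2, seen2⟩
    refine (straight_output hw h2).ok.imp ?_
    rintro s3 ⟨e1, e2, e3⟩
    -- The curve `t = 0` is valid at every parameter, so some position has been recorded.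
    have hpos : 1 ≤ s2.word 6 := by
      have := seen2 ⟨1, 0, 0⟩ ⟨0, 0, 0⟩ (Or.inl ⟨rfl, rfl⟩) 0 (by simp [ValidAt, Quad.at])
      omega
    rcases h2.best with h | ⟨hr, hθ, hcov⟩
    · omega
    · rw [Instance.Answer, e1, e2, e3]
      refine Instance.isSolution_of_forall hI hr hθ ?_
      rintro σ (rfl | rfl) A B hAB u hu
      · have := (seen1 A B hAB).mono le2 u hu
        omega
      · have := seen2 A B hAB u hu
        omega
  · have hX : 0 < (n * m + 1) * curveTime (n * m) := Nat.mul_pos (by omega) (curveTime_pos _)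
    generalize (n * m + 1) * curveTime (n * m) = X at hX ⊢
    have f1 := Nat.le_mul_of_pos_right init.time hX
    have f2 := Nat.le_mul_of_pos_right output.time hX
    calc _ ≤ init.time * X + (K1 * X + (K2 * X + output.time * X)) := by omega
      _ = _ := by ring

/-! ### Final estimates -/

theorem curveTime_le {M : ℕ} (hM : 3 ≤ M) :
    (((M + 1) * curveTime M : ℕ) : ℝ) ≤ 2800 * ((M : ℝ) ^ 2 * Real.log M) := by
  have hM' : (3 : ℝ) ≤ M := by exact_mod_cast hM
  have hlog : 1 ≤ Real.log M := by
    rw [Real.le_log_iff_exp_le (by linarith)]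
    have := Real.exp_one_lt_d9
    linarith
  have hc : (Nat.clog 2 (3 * (32 * M)) : ℝ) ≤ 1 + 12 * Real.log M := by
    have h1 : 2 ^ (Nat.clog 2 (3 * (32 * M)) - 1) < 3 * (32 * M) :=
      Nat.pow_pred_clog_lt_self (by omega) (by omega)
    have h2 : 1 ≤ Nat.clog 2 (3 * (32 * M)) := Nat.clog_pos (by omega) (by omega)
    obtain ⟨k, hk⟩ := Nat.exists_eq_add_of_le' h2
    rw [hk, Nat.add_sub_cancel] at h1
    -- From `96 ≤ 3 ^ 5 ≤ M ^ 5`. With `log 2 ≥ 1/2` this bounds `k` by `12 log M`, and `log M ≥ 1`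
    -- for `M ≥ 3` absorbs additive constants.
    have h3 : (2 : ℝ) ^ k ≤ (M : ℝ) ^ 6 := by
      have h4 : (2 : ℝ) ^ k ≤ 96 * M := by
        have : 2 ^ k ≤ 96 * M := by omega
        exact_mod_cast this
      have h5 : (3 : ℝ) ^ 5 ≤ (M : ℝ) ^ 5 := by gcongr
      nlinarith
    have h6 := Real.log_le_log (by positivity) h3
    rw [Real.log_pow, Real.log_pow] at h6
    have h7 := Real.log_two_gt_d9
    rw [hk]
    push_cast at h6 ⊢
    have : (k : ℝ) * (1 / 2) ≤ k * Real.log 2 := by gcongr; linarith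
    linarith
  have h8 : ((3 * (32 * M) + 1 : ℕ) : ℝ) ≤ 97 * M := by push_cast; linarith
  have h9 : ((M + 1 : ℕ) : ℝ) ≤ 2 * M := by push_cast; linarith
  have h10 : ((Nat.clog 2 (3 * (32 * M)) + 1 : ℕ) : ℝ) ≤ 14 * Real.log M := by
    push_cast; linarith
  rw [curveTime, Nat.cast_mul, Nat.cast_mul]
  calc _ ≤ (2 * (M : ℝ)) * ((97 * M) * (14 * Real.log M)) := by gcongr
    _ = 2716 * ((M : ℝ) ^ 2 * Real.log M) := by ring
    _ ≤ _ := by gcongr; norm_num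

end MCR

theorem theorem4 :
    ∃ (prog : RealRAM.Program) (C : ℝ), ∀ (n m : ℕ) (I : MCR.Instance n m), I.Valid →
      ∃ (t w : ℕ) (s : RealRAM.State),
        RealRAM.Runs w prog I.input t s ∧ I.Answer s ∧
        (t : ℝ) ≤ C * ((n : ℝ) ^ 2 * (m : ℝ) ^ 2 * Real.log ((n : ℝ) * (m : ℝ))) ∧
        (w : ℝ) ≤ C * ((n : ℝ) ^ 2 * (m : ℝ) ^ 2) := by
  obtain ⟨K, H⟩ := MCR.ok_main
  -- The first summand pays for the time and the second for the `1000nm` memory cells; as `nm ≥ 3`,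
  -- this linear space is below the quadratic bound.
  refine ⟨MCR.Code.main, 2800 * K + 1000, fun n m I hI => ?_⟩
  have hn : 1 ≤ n := hI.2.1
  have hm : 3 ≤ m := hI.2.2.2.1
  have hM : 3 ≤ n * m := by nlinarith
  have hw : MCR.Room n m (1000 * (n * m)) :=
    ⟨by omega, by omega, Nat.le_mul_of_pos_right _ (by omega), Nat.le_mul_of_pos_left _ (by omega),
      le_rfl⟩
  obtain ⟨t, s, h1, h2, h3⟩ := H n m _ I hI hw
  have hM' : (3 : ℝ) ≤ (n : ℝ) * m := by exact_mod_cast hM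
  have e : (n : ℝ) ^ 2 * (m : ℝ) ^ 2 = ((n : ℝ) * m) ^ 2 := by ring
  have hlog : 0 ≤ Real.log ((n : ℝ) * m) := Real.log_nonneg (by linarith)
  refine ⟨t, _, s, h1, h3, ?_, ?_⟩
  · have h4 := MCR.curveTime_le hM
    rw [Nat.cast_mul n m] at h4
    have h5 : (t : ℝ) ≤ K * (((n * m + 1) * MCR.curveTime (n * m) : ℕ) : ℝ) := by exact_mod_cast h2
    rw [e]
    have h6 : 0 ≤ ((n : ℝ) * m) ^ 2 * Real.log ((n : ℝ) * m) := by positivity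
    calc (t : ℝ) ≤ K * (2800 * (((n : ℝ) * m) ^ 2 * Real.log ((n : ℝ) * m))) :=
          h5.trans (by gcongr)
      _ ≤ _ := by linarith
  · rw [e]
    push_cast
    have : (0 : ℝ) ≤ K := Nat.cast_nonneg _
    have h7 : (n : ℝ) * m ≤ ((n : ℝ) * m) ^ 2 := by nlinarith
    have h8 : 0 ≤ K * ((n : ℝ) * m) ^ 2 := by positivity
    linarith
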